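/- Let $N\ge 1$, let $\overline{\mathbb C}=\mathbb C\cup\{\infty\}$, let $\xi_\pm=\xi_1\pm i\xi_2$ and $\partial_\pm=\frac12(\partial_{\xi_1}\mp i\,\partial_{\xi_2})$. Fix $r\in\mathbb N\cup\{\infty\}$ with $r\ge N+2$; a matrix-valued map on $\overline{\mathbb C}$ is called $C^r$ if its components are (real) $C^r$ in the coordinate $\xi$ and in the coordinate $1/\xi$. A finite action solution of the $\mathbb{CP}^{N-1}$ sigma model on $\overline{\mathbb C}$ is a $C^r$ map $P$ from $\overline{\mathbb C}$ to the Hermitian projectors of rank 1 in $\mathbb C^{N\times N}$ such that $[\partial_+\partial_-P,P]=0$ and $\int_{\mathbb R^2}\operatorname{tr}(\partial_+P\,\partial_-P)\,d\xi_1d\xi_2<\infty$. A map $P:\overline{\mathbb C}\to\mathbb C^{N\times N}$ is called full if the ranges of the matrices $P(\xi)$, $\xi\in\mathbb C$, together span $\mathbb C^N$. Let $F:\overline{\mathbb C}\to su(N)$ be a $C^r$ surface. For $k\in\{0,\dots,N-1\}$ and $\lambda\in\mathbb R$ consider the two conditions on $F$: (a) at every point the characteristic polynomial of $F$ is $$\det(t-F)=(t-i\lambda)^{N-k-1}\,(t-i(\lambda-1))\,(t-i(\lambda-2))^{k}$$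 (so that in particular $\det F=i^N\lambda^{N-k-1}(\lambda-1)(\lambda-2)^k$); (b) on $\mathbb C$, $$dF=-i\big[\partial_+(F-i(\lambda-1))^2,(F-i(\lambda-1))^2\big]d\xi_+ + i\big[\partial_-(F-i(\lambda-1))^2,(F-i(\lambda-1))^2\big]d\xi_- .$$ 1. Let $P$ be full. Then the following are equivalent. (i) $P$ is a finite action solution and $F$ is its associated surface, that is, $dF=-i[\partial_+P,P]\,d\xi_+ + i[\partial_-P,P]\,d\xi_-$ with the constant of integration chosen so that, for some $k\in\{0,\dots,N-1\}$, $F=-i\big(P_k+2\sum_{j<k}P_j-\frac{1+2k}{N}I\big)$, where $P_0,\dots,P_k=P$ are $C^r$ maps from $\overline{\mathbb C}$ to the rank-1 Hermitian projectors, $P_0$ projects onto the line of a holomorphic vector, and $P_{j+1}=\Pi_+P_j=\dfrac{\partial_+P_j\,P_j\,\partial_-P_j}{\operatorname{tr}(\partial_+P_j\,P_j\,\partial_-P_j)}$ for $0\le j<k$ (extended by continuity at the zeros of the numerator, which is not identically zero). (ii) There exist $k\in\{0,\dots,N-1\}$ and $\lambda\in\mathbb R$ such that (a) and (b) hold and $P=(F-i(\lambda-1))^2+I$.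 2. Let $P:\overline{\mathbb C}\to\mathbb C^{N\times N}$ be arbitrary, full or not. Then $P$ is a finite action solution with $dF=-i[\partial_+P,P]\,d\xi_+ + i[\partial_-P,P]\,d\xi_-$ if and only if there exist a constant $A\in su(N)$, a $k\in\{0,\dots,N-1\}$ and a $\lambda\in\mathbb R$ such that $F-A$ satisfies (a) and (b), and $P=(F-A-i(\lambda-1))^2+I$. -/

import Mathlib

open Matrix MeasureTheory Topology

noncomputable section

namespace CPModel

/-- The Lie algebra `su(N)`: traceless skew-Hermitian matrices. -/
def su (N : ℕ) : Set (Matrix (Fin N) (Fin N) ℂ) :=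
  {A | Aᴴ = -A ∧ A.trace = 0}

/-- A matrix-valued map on the extended complex plane read in the coordinate `w = 1/ξ`. -/
def hat {N : ℕ} (X : OnePoint ℂ → Matrix (Fin N) (Fin N) ℂ) (w : ℂ) :
    Matrix (Fin N) (Fin N) ℂ :=
  if w = 0 then X OnePoint.infty else X ((w⁻¹ : ℂ) : OnePoint ℂ)

/-- `X` is of class `C^r` on the extended complex plane, in the real sense: its components are
`C^r` in the coordinate `ξ` and in the coordinate `w = 1/ξ` around infinity. -/
def IsCrOnSphere {N : ℕ} (r : ℕ∞) (X : OnePoint ℂ → Matrix (Fin N) (Fin N) ℂ) : Prop :=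
  (∀ i j, ContDiff ℝ r (fun z : ℂ => X (z : OnePoint ℂ) i j)) ∧
  (∀ i j, ContDiff ℝ r (fun w : ℂ => hat X w i j))

/-- `∂₊ = (∂₁ - i ∂₂) / 2`, applied to each component of a matrix-valued function on `ℂ`. -/
def dPlus {N : ℕ} (X : ℂ → Matrix (Fin N) (Fin N) ℂ) (z : ℂ) : Matrix (Fin N) (Fin N) ℂ :=
  Matrix.of fun i j => (1 / 2 : ℂ) *
    (fderiv ℝ (fun u => X u i j) z 1 - Complex.I * fderiv ℝ (fun u => X u i j) z Complex.I)

/-- `∂₋ = (∂₁ + i ∂₂) / 2`, applied to each component of a matrix-valued function on `ℂ`. -/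
def dMinus {N : ℕ} (X : ℂ → Matrix (Fin N) (Fin N) ℂ) (z : ℂ) : Matrix (Fin N) (Fin N) ℂ :=
  Matrix.of fun i j => (1 / 2 : ℂ) *
    (fderiv ℝ (fun u => X u i j) z 1 + Complex.I * fderiv ℝ (fun u => X u i j) z Complex.I)

/-- The restriction to the finite plane of a map on the extended plane. -/
def onPlane {N : ℕ} (X : OnePoint ℂ → Matrix (Fin N) (Fin N) ℂ) (z : ℂ) :
    Matrix (Fin N) (Fin N) ℂ :=
  X (z : OnePoint ℂ)

/-- A `C^r` map from the extended plane to the rank-1 Hermitian projectors. -/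
structure IsProjectorMap {N : ℕ} (r : ℕ∞) (P : OnePoint ℂ → Matrix (Fin N) (Fin N) ℂ) :
    Prop where
  cr : IsCrOnSphere r P
  idem : ∀ z, P z * P z = P z
  herm : ∀ z, (P z)ᴴ = P z
  trace_one : ∀ z, (P z).trace = 1

/-- A finite action solution of the `ℂP^{N-1}` sigma model on the extended complex plane. The
Lagrangian density `tr (∂₊P ∂₋P)` is continuous and takes nonnegative real values, so finiteness
of the action is its integrability. -/
structure IsFiniteActionSolution {N : ℕ} (r : ℕ∞)
    (P : OnePoint ℂ → Matrix (Fin N) (Fin N) ℂ) : Prop where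
  projector : IsProjectorMap r P
  euler_lagrange : ∀ z : ℂ,
    dPlus (dMinus (onPlane P)) z * onPlane P z - onPlane P z * dPlus (dMinus (onPlane P)) z = 0
  finite_action :
    Integrable (fun z : ℂ => (dPlus (onPlane P) z * dMinus (onPlane P) z).trace) volume

/-- `dF = -i [∂₊R, R] dξ₊ + i [∂₋R, R] dξ₋`. -/
def HasWeierstrassDifferential {N : ℕ} (F R : OnePoint ℂ → Matrix (Fin N) (Fin N) ℂ) : Prop :=
  ∀ z : ℂ,
    dPlus (onPlane F) z =
      (-Complex.I) • (dPlus (onPlane R) z * onPlane R z - onPlane R z * dPlus (onPlane R) z) ∧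
    dMinus (onPlane F) z =
      Complex.I • (dMinus (onPlane R) z * onPlane R z - onPlane R z * dMinus (onPlane R) z)

/-- The projector map `X` is holomorphic: it projects onto the line spanned by a (local)
nowhere vanishing holomorphic vector. -/
def IsHolomorphic {N : ℕ} (X : OnePoint ℂ → Matrix (Fin N) (Fin N) ℂ) : Prop :=
  ∀ z₀ : ℂ, ∃ f : ℂ → Fin N → ℂ, ∀ᶠ z in 𝓝 z₀,
    DifferentiableAt ℂ f z ∧ f z ≠ 0 ∧ onPlane X z *ᵥ f z = f z

/-- The numerator `∂₊X X ∂₋X` of the raising operator. -/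
def raisingNum {N : ℕ} (X : OnePoint ℂ → Matrix (Fin N) (Fin N) ℂ) (z : ℂ) :
    Matrix (Fin N) (Fin N) ℂ :=
  dPlus (onPlane X) z * onPlane X z * dMinus (onPlane X) z

/-- `Y = Π₊X = ∂₊X X ∂₋X / tr (∂₊X X ∂₋X)` and `Π₊X` is not the zero operator. The identity is
cleared of its denominator, so that at the isolated zeros of the numerator the quotient is
understood through its continuous extension; this is used for continuous `Y` only. -/
def IsRaising {N : ℕ} (X Y : OnePoint ℂ → Matrix (Fin N) (Fin N) ℂ) : Prop :=
  (∃ z : ℂ, raisingNum X z ≠ 0) ∧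
  ∀ z : ℂ, raisingNum X z = (raisingNum X z).trace • onPlane Y z

/-- The choice of the constant of integration: `P = P_k` and
`F = -i (P_k + 2 ∑_{j<k} P_j - (1+2k)/N)`, where `P_j = Π₊^j P_0` with `P_0` holomorphic. -/
def HasNormalForm {N : ℕ} (r : ℕ∞) (k : ℕ)
    (F P : OnePoint ℂ → Matrix (Fin N) (Fin N) ℂ) : Prop :=
  ∃ Q : ℕ → OnePoint ℂ → Matrix (Fin N) (Fin N) ℂ,
    IsHolomorphic (Q 0) ∧
    (∀ j ≤ k, IsProjectorMap r (Q j)) ∧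
    (∀ j < k, IsRaising (Q j) (Q (j + 1))) ∧
    Q k = P ∧
    ∀ z, F z = (-Complex.I) •
      (Q k z + (2 : ℂ) • ∑ j ∈ Finset.range k, Q j z
        - ((1 + 2 * (k : ℂ)) / (N : ℂ)) • (1 : Matrix (Fin N) (Fin N) ℂ))

/-- The ranges of the `P(ξ)` span `ℂ^N`, i.e. the model does not reduce to a lower dimension. -/
def IsFull {N : ℕ} (P : OnePoint ℂ → Matrix (Fin N) (Fin N) ℂ) : Prop :=
  Submodule.span ℂ {v : Fin N → ℂ | ∃ (z : ℂ) (u : Fin N → ℂ), v = onPlane P z *ᵥ u} = ⊤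

/-- `(F - i(λ-1))²`. -/
def shiftSq {N : ℕ} (lam : ℝ) (F : OnePoint ℂ → Matrix (Fin N) (Fin N) ℂ) (z : OnePoint ℂ) :
    Matrix (Fin N) (Fin N) ℂ :=
  (F z - (Complex.I * ((lam : ℂ) - 1)) • (1 : Matrix (Fin N) (Fin N) ℂ)) ^ 2

/-- The projector `(F - i(λ-1))² + I` associated to the surface `F`. -/
def surfaceProjector {N : ℕ} (lam : ℝ) (F : OnePoint ℂ → Matrix (Fin N) (Fin N) ℂ)
    (z : OnePoint ℂ) : Matrix (Fin N) (Fin N) ℂ :=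
  shiftSq lam F z + 1

/-- The two conditions on the surface `F`: its characteristic polynomial is
`(t - iλ)^{N-k-1} (t - i(λ-1)) (t - i(λ-2))^k` at every point, and
`dF = -i [∂₊G, G] dξ₊ + i [∂₋G, G] dξ₋` with `G = (F - i(λ-1))²`. -/
def SurfaceConditions {N : ℕ} (k : ℕ) (lam : ℝ)
    (F : OnePoint ℂ → Matrix (Fin N) (Fin N) ℂ) : Prop :=
  (∀ z, (F z).charpoly =
    (Polynomial.X - Polynomial.C (Complex.I * (lam : ℂ))) ^ (N - k - 1) *
    (Polynomial.X - Polynomial.C (Complex.I * ((lam : ℂ) - 1))) *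
    (Polynomial.X - Polynomial.C (Complex.I * ((lam : ℂ) - 2))) ^ k) ∧
  HasWeierstrassDifferential F (shiftSq lam F)

end CPModel

end

/-! Everything passes through a pair `(P, S)`. Write W = ∂₋P P (`lowerForm`) and V = ∂₊P P
(`raiseForm`), so that ∂₋P = W + V* and ∂₊P = V + W*. The Weierstrass formula makes S = ½(iF + λ −
P) a Hermitian potential, ∂₋S = −W, and F = −i(P + 2S − λ). Pointwise, −i(F − i(λ−1)) = 1 − P − 2S,
so the characteristic polynomial in (a) says that S is an orthogonal projector of rank k with PS =
0. Conditions (a) and (b) thus describe a flag pair `IsFlagPair`. Equality of the mixed derivatives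
of S is the Euler-Lagrange equation (`IsPotential.isHarmonic`), and finiteness of the action follows
from regularity at infinity.

For part 1, flag pairs are moved up and down: raising sends (P, S) to (Y, S + P), lowering sends it
to (Y, S − Y). In local frames W becomes an antiholomorphic function, so its zeros have finite order
and its line extends across them (`IsFlagPair.exists_lowered`). Starting from rank k, k lowerings
reach S = 0, that is W = 0, a holomorphic map. Fullness prevents W from vanishing identically while
S ≠ 0: S would then be constant with range orthogonal to every P. The trace of F forces λ =
(1+2k)/N.

For part 2, the difficulty is to find the constant of integration turning a potential into a
projector. Take the chain forms ω₀ = W, ω_{b+1} = (1−P) ∂₋ω_b P. If V*ω_j = 0 for j < b, then ∂₊ω_b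
is, up to the connection, a combination of the earlier ω_j, the curvature acting by scalars because
P has rank one. Hence τ(V*ω_b) is antiholomorphic and vanishes at infinity, so it is zero by
Liouville, and the induction goes on (`IsHarmonic.chain_expansion_and_isotropic`). Each step costs a
derivative, and fewer than N forms can be independent; this is where r ≥ N + 2 enters. Let k be the
generic number of independent chain forms. Where they are independent, the projection onto their
span is itself a potential, so the right constant makes S equal to it near one point.

Being a flag then has to spread to the whole plane without real-analyticity of P. In frames, the
determinant of the chain forms is antiholomorphic where S is a flag and vanishes where the forms are
dependent. Its square, extended by zero, is antiholomorphic on a full disc, so its zeros are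
isolated (`IsIsotropic.closure_goodSet_mem_nhds`), and the closure of the good set is open and
closed.

The calculus runs in a C*-algebra with a faithful trace τ; rank one enters through p x p = τ(x p) p.
-/

noncomputable section

namespace CPModel

/-! ### Wirtinger calculus for vector-valued functions. -/

section Wirtinger

variable {E F : Type*} [NormedAddCommGroup E] [NormedSpace ℂ E] [NormedAddCommGroup F]
  [NormedSpace ℂ F]

/-- The Wirtinger derivative `∂/∂z`. -/
def dz (f : ℂ → E) (z : ℂ) : E :=
  (1 / 2 : ℂ) • (fderiv ℝ f z 1 - Complex.I • fderiv ℝ f z Complex.I)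

/-- The Wirtinger derivative `∂/∂z̄`. -/
def dzb (f : ℂ → E) (z : ℂ) : E :=
  (1 / 2 : ℂ) • (fderiv ℝ f z 1 + Complex.I • fderiv ℝ f z Complex.I)

theorem fderiv_one_eq (f : ℂ → E) (z : ℂ) : fderiv ℝ f z 1 = dz f z + dzb f z := by
  simp only [dz, dzb]; module

theorem fderiv_I_eq (f : ℂ → E) (z : ℂ) :
    fderiv ℝ f z Complex.I = Complex.I • (dz f z - dzb f z) := by
  have h : Complex.I • (dz f z - dzb f z) =
      -(Complex.I * Complex.I) • fderiv ℝ f z Complex.I := by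
    simp only [dz, dzb]; module
  rw [h, Complex.I_mul_I, neg_neg, one_smul]

theorem fderiv_apply_eq (f : ℂ → E) (z v : ℂ) :
    fderiv ℝ f z v = v • dz f z + (starRingEnd ℂ v) • dzb f z := by
  have hv : v = v.re • (1 : ℂ) + v.im • Complex.I := by
    simp [Complex.re_add_im]
  have h1 : fderiv ℝ f z v = v.re • fderiv ℝ f z 1 + v.im • fderiv ℝ f z Complex.I := by
    conv_lhs => rw [hv]
    rw [map_add, map_smul, map_smul]
  rw [h1, fderiv_one_eq, fderiv_I_eq]
  rw [← Complex.coe_smul, ← Complex.coe_smul]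
  have h2 : v = (v.re : ℂ) + v.im * Complex.I := (Complex.re_add_im v).symm
  have h3 : starRingEnd ℂ v = (v.re : ℂ) - v.im * Complex.I := by
    apply Complex.ext <;> simp
  rw [h3]
  conv_rhs => rw [h2]
  simp only [Complex.add_re, Complex.add_im, Complex.ofReal_re, Complex.ofReal_im,
    Complex.mul_re, Complex.mul_im, Complex.I_re, Complex.I_im, mul_zero, mul_one, sub_zero,
    add_zero, zero_add]
  module

theorem dz_congr {f g : ℂ → E} {z : ℂ} (h : f =ᶠ[𝓝 z] g) : dz f z = dz g z := by
  simp only [dz, h.fderiv_eq]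

theorem dzb_congr {f g : ℂ → E} {z : ℂ} (h : f =ᶠ[𝓝 z] g) : dzb f z = dzb g z := by
  simp only [dzb, h.fderiv_eq]

@[simp] theorem dz_const (c : E) (z : ℂ) : dz (fun _ => c) z = 0 := by simp [dz]
@[simp] theorem dzb_const (c : E) (z : ℂ) : dzb (fun _ => c) z = 0 := by simp [dzb]

theorem dz_add {f g : ℂ → E} {z : ℂ} (hf : DifferentiableAt ℝ f z)
    (hg : DifferentiableAt ℝ g z) : dz (fun w => f w + g w) z = dz f z + dz g z := by
  simp only [dz, fderiv_fun_add hf hg, _root_.add_apply]; module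

theorem dzb_add {f g : ℂ → E} {z : ℂ} (hf : DifferentiableAt ℝ f z)
    (hg : DifferentiableAt ℝ g z) : dzb (fun w => f w + g w) z = dzb f z + dzb g z := by
  simp only [dzb, fderiv_fun_add hf hg, _root_.add_apply]; module

theorem dz_sub {f g : ℂ → E} {z : ℂ} (hf : DifferentiableAt ℝ f z)
    (hg : DifferentiableAt ℝ g z) : dz (fun w => f w - g w) z = dz f z - dz g z := by
  simp only [dz, fderiv_fun_sub hf hg, _root_.sub_apply]; module

theorem dzb_sub {f g : ℂ → E} {z : ℂ} (hf : DifferentiableAt ℝ f z)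
    (hg : DifferentiableAt ℝ g z) : dzb (fun w => f w - g w) z = dzb f z - dzb g z := by
  simp only [dzb, fderiv_fun_sub hf hg, _root_.sub_apply]; module

theorem dz_neg (f : ℂ → E) (z : ℂ) : dz (fun w => -f w) z = -dz f z := by
  simp only [dz, fderiv_fun_neg, _root_.neg_apply]; module

theorem dzb_neg (f : ℂ → E) (z : ℂ) : dzb (fun w => -f w) z = -dzb f z := by
  simp only [dzb, fderiv_fun_neg, _root_.neg_apply]; module

theorem dzb_sum {ι : Type*} {s : Finset ι} {f : ι → ℂ → E} {z : ℂ}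
    (hf : ∀ i ∈ s, DifferentiableAt ℝ (f i) z) :
    dzb (fun w => ∑ i ∈ s, f i w) z = ∑ i ∈ s, dzb (f i) z := by
  simp only [dzb, fderiv_fun_sum hf, _root_.sum_apply, Finset.smul_sum,
    ← Finset.sum_add_distrib]

theorem dz_clm (L : E →L[ℂ] F) {f : ℂ → E} {z : ℂ} (hf : DifferentiableAt ℝ f z) :
    dz (fun w => L (f w)) z = L (dz f z) := by
  have h : fderiv ℝ (fun w => L (f w)) z = (L.restrictScalars ℝ).comp (fderiv ℝ f z) :=
    ((L.restrictScalars ℝ).hasFDerivAt.comp z hf.hasFDerivAt).fderiv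
  simp [dz, h]

theorem dzb_clm (L : E →L[ℂ] F) {f : ℂ → E} {z : ℂ} (hf : DifferentiableAt ℝ f z) :
    dzb (fun w => L (f w)) z = L (dzb f z) := by
  have h : fderiv ℝ (fun w => L (f w)) z = (L.restrictScalars ℝ).comp (fderiv ℝ f z) :=
    ((L.restrictScalars ℝ).hasFDerivAt.comp z hf.hasFDerivAt).fderiv
  simp [dzb, h]

theorem clm_differentiableAt (L : E →L[ℂ] F) {f : ℂ → E} {z : ℂ}
    (hf : DifferentiableAt ℝ f z) : DifferentiableAt ℝ (fun w => L (f w)) z :=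
  (L.restrictScalars ℝ).differentiableAt.comp z hf

theorem clm_contDiff (L : E →L[ℂ] F) {n : WithTop ℕ∞} {f : ℂ → E}
    (hf : ContDiff ℝ n f) : ContDiff ℝ n (fun w => L (f w)) :=
  (L.restrictScalars ℝ).contDiff.comp hf

theorem clm_contDiffAt (L : E →L[ℂ] F) {n : WithTop ℕ∞} {f : ℂ → E} {z : ℂ}
    (hf : ContDiffAt ℝ n f z) : ContDiffAt ℝ n (fun w => L (f w)) z :=
  (L.restrictScalars ℝ).contDiff.contDiffAt.comp z hf

theorem dz_const_smul (c : ℂ) {f : ℂ → E} {z : ℂ} (hf : DifferentiableAt ℝ f z) :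
    dz (fun w => c • f w) z = c • dz f z :=
  dz_clm (c • ContinuousLinearMap.id ℂ E) hf

theorem dzb_const_smul (c : ℂ) {f : ℂ → E} {z : ℂ} (hf : DifferentiableAt ℝ f z) :
    dzb (fun w => c • f w) z = c • dzb f z :=
  dzb_clm (c • ContinuousLinearMap.id ℂ E) hf

theorem dzb_smul {c : ℂ → ℂ} {f : ℂ → E} {z : ℂ} (hc : DifferentiableAt ℝ c z)
    (hf : DifferentiableAt ℝ f z) :
    dzb (fun w => c w • f w) z = dzb c z • f z + c z • dzb f z := by
  simp only [dzb, fderiv_fun_smul hc hf, _root_.add_apply,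
    _root_.smul_apply, ContinuousLinearMap.smulRight_apply, smul_eq_mul]
  module

theorem dz_comp_conj (f : ℂ → E) (z : ℂ) :
    dz (fun w => f (starRingEnd ℂ w)) z = dzb f (starRingEnd ℂ z) := by
  have h : fderiv ℝ (fun w => f (starRingEnd ℂ w)) z =
      (fderiv ℝ f (starRingEnd ℂ z)).comp (Complex.conjCLE : ℂ →L[ℝ] ℂ) :=
    Complex.conjCLE.comp_right_fderiv (f := f) (x := z)
  simp [dz, dzb, h]

theorem dzb_comp_conj (f : ℂ → E) (z : ℂ) :
    dzb (fun w => f (starRingEnd ℂ w)) z = dz f (starRingEnd ℂ z) := by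
  have h : fderiv ℝ (fun w => f (starRingEnd ℂ w)) z =
      (fderiv ℝ f (starRingEnd ℂ z)).comp (Complex.conjCLE : ℂ →L[ℝ] ℂ) :=
    Complex.conjCLE.comp_right_fderiv (f := f) (x := z)
  simp [dz, dzb, h, sub_eq_add_neg]

/-- Inversion is holomorphic with derivative −z⁻², so ∂₊ is rescaled by this factor and ∂₋ by its
conjugate. These factors carry all the information about the chart at infinity. -/
theorem dz_comp_inv {f : ℂ → E} {z : ℂ} (hz : z ≠ 0) (hf : DifferentiableAt ℝ f z⁻¹) :
    dz (fun w => f w⁻¹) z = (-(z⁻¹ ^ 2)) • dz f z⁻¹ ∧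
    dzb (fun w => f w⁻¹) z = starRingEnd ℂ (-(z⁻¹ ^ 2)) • dzb f z⁻¹ := by
  have h0 : HasFDerivAt (fun w : ℂ => w⁻¹)
      ((ContinuousLinearMap.smulRight (1 : ℂ →L[ℂ] ℂ) (-(z ^ 2)⁻¹)).restrictScalars ℝ) z :=
    ((hasDerivAt_inv hz).hasFDerivAt).restrictScalars ℝ
  have h := (hf.hasFDerivAt.comp z h0).fderiv
  have h' : ∀ v, fderiv ℝ (fun w => f w⁻¹) z v = fderiv ℝ f z⁻¹ (v * (-(z⁻¹ ^ 2))) := by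
    intro v
    have := congrArg (fun L => L v) h
    simpa [Function.comp_def] using this
  have hc : starRingEnd ℂ Complex.I = -Complex.I := Complex.conj_I
  constructor
  · have e : dz (fun w => f w⁻¹) z = (1 / 2 : ℂ) • ((-(z⁻¹ ^ 2) * (1 - Complex.I * Complex.I)) •
        dz f z⁻¹ + (starRingEnd ℂ (-(z⁻¹ ^ 2)) * (1 + Complex.I * Complex.I)) • dzb f z⁻¹) := by
      rw [dz]
      simp only [h']
      simp only [fderiv_apply_eq f, map_mul, map_one, hc]
      module
    rw [e, Complex.I_mul_I]; module
  · have e : dzb (fun w => f w⁻¹) z = (1 / 2 : ℂ) • ((-(z⁻¹ ^ 2) * (1 + Complex.I * Complex.I)) •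
        dz f z⁻¹ + (starRingEnd ℂ (-(z⁻¹ ^ 2)) * (1 - Complex.I * Complex.I)) • dzb f z⁻¹) := by
      rw [dzb]
      simp only [h']
      simp only [fderiv_apply_eq f, map_mul, map_one, hc]
      module
    rw [e, Complex.I_mul_I]; module

theorem differentiableAt_complex_of_dzb_eq_zero {f : ℂ → E} {z : ℂ}
    (hf : DifferentiableAt ℝ f z) (h : dzb f z = 0) : DifferentiableAt ℂ f z := by
  rw [differentiableAt_complex_iff_differentiableAt_real]
  refine ⟨hf, ?_⟩
  rw [fderiv_I_eq, fderiv_one_eq, h]; simp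

theorem fderiv_eq_zero_of_dz_dzb {f : ℂ → E} {z : ℂ} (h1 : dz f z = 0) (h2 : dzb f z = 0) :
    fderiv ℝ f z = 0 := by
  ext v; rw [fderiv_apply_eq, h1, h2]; simp

theorem contDiff_fderiv_apply {n m : WithTop ℕ∞} {f : ℂ → E} (hf : ContDiff ℝ n f)
    (h : m + 1 ≤ n) (v : ℂ) : ContDiff ℝ m (fun z => fderiv ℝ f z v) :=
  (hf.fderiv_right h).clm_apply contDiff_const

theorem contDiff_const_smul_complex {n : WithTop ℕ∞} {f : ℂ → E} (c : ℂ)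
    (hf : ContDiff ℝ n f) : ContDiff ℝ n (fun z => c • f z) :=
  clm_contDiff (c • ContinuousLinearMap.id ℂ E) hf

theorem contDiff_dz {n m : WithTop ℕ∞} {f : ℂ → E} (hf : ContDiff ℝ n f)
    (h : m + 1 ≤ n) : ContDiff ℝ m (dz f) :=
  contDiff_const_smul_complex _ ((contDiff_fderiv_apply hf h 1).sub
    (contDiff_const_smul_complex _ (contDiff_fderiv_apply hf h Complex.I)))

theorem contDiff_dzb {n m : WithTop ℕ∞} {f : ℂ → E} (hf : ContDiff ℝ n f)
    (h : m + 1 ≤ n) : ContDiff ℝ m (dzb f) :=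
  contDiff_const_smul_complex _ ((contDiff_fderiv_apply hf h 1).add
    (contDiff_const_smul_complex _ (contDiff_fderiv_apply hf h Complex.I)))

theorem dz_dzb_comm {f : ℂ → E} (hf : ContDiff ℝ 2 f) (z : ℂ) :
    dz (dzb f) z = dzb (dz f) z := by
  have hd : Differentiable ℝ (fderiv ℝ f) :=
    (hf.fderiv_right (m := 1) (by norm_num)).differentiable (by norm_num)
  have hv : ∀ v : ℂ, DifferentiableAt ℝ (fun z => fderiv ℝ f z v) z := fun v =>
    (contDiff_fderiv_apply (m := 1) hf (by norm_num) v).differentiable (by norm_num) z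
  have hv' : ∀ v w : ℂ, fderiv ℝ (fun z => fderiv ℝ f z v) z w = fderiv ℝ (fderiv ℝ f) z w v := by
    intro v w
    have := ((hd z).hasFDerivAt.clm_apply (hasFDerivAt_const v z)).fderiv
    rw [this]; simp
  have hsymm : IsSymmSndFDerivAt ℝ f z :=
    hf.contDiffAt.isSymmSndFDerivAt (by simp)
  have hs : fderiv ℝ (fderiv ℝ f) z 1 Complex.I = fderiv ℝ (fderiv ℝ f) z Complex.I 1 :=
    hsymm.eq 1 Complex.I
  have hI : ∀ c : ℂ, DifferentiableAt ℝ (fun z => c • fderiv ℝ f z Complex.I) z := fun c =>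
    clm_differentiableAt (c • ContinuousLinearMap.id ℂ E) (hv _)
  have e1 : dz (dzb f) z = (1 / 2 : ℂ) • (dz (fun z => fderiv ℝ f z 1) z +
      Complex.I • dz (fun z => fderiv ℝ f z Complex.I) z) := by
    change dz (fun z => (1 / 2 : ℂ) • (fderiv ℝ f z 1 + Complex.I • fderiv ℝ f z Complex.I)) z = _
    rw [dz_const_smul (f := fun z => fderiv ℝ f z 1 + Complex.I • fderiv ℝ f z Complex.I) _
      ((hv 1).add (hI _)), dz_add (hv 1) (hI _), dz_const_smul _ (hv _)]
  have e2 : dzb (dz f) z = (1 / 2 : ℂ) • (dzb (fun z => fderiv ℝ f z 1) z -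
      Complex.I • dzb (fun z => fderiv ℝ f z Complex.I) z) := by
    change dzb (fun z => (1 / 2 : ℂ) • (fderiv ℝ f z 1 - Complex.I • fderiv ℝ f z Complex.I)) z = _
    rw [dzb_const_smul (f := fun z => fderiv ℝ f z 1 - Complex.I • fderiv ℝ f z Complex.I) _
      ((hv 1).sub (hI _)), dzb_sub (hv 1) (hI _), dzb_const_smul _ (hv _)]
  rw [e1, e2]
  simp only [dz, dzb, hv', hs]
  module

end Wirtinger

/-! ### Product rule, adjoint and inverse in a C*-algebra. -/

section Algebra

variable {A : Type*} [CStarAlgebra A]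

theorem dz_mul {f g : ℂ → A} {z : ℂ} (hf : DifferentiableAt ℝ f z)
    (hg : DifferentiableAt ℝ g z) :
    dz (fun w => f w * g w) z = dz f z * g z + f z * dz g z := by
  simp only [dz, fderiv_fun_mul' hf hg, _root_.add_apply,
    _root_.smul_apply, smul_eq_mul, MulOpposite.smul_eq_mul_unop,
    MulOpposite.unop_op, smul_mul_assoc, mul_smul_comm, sub_mul, mul_sub]
  module

theorem dzb_mul {f g : ℂ → A} {z : ℂ} (hf : DifferentiableAt ℝ f z)
    (hg : DifferentiableAt ℝ g z) :
    dzb (fun w => f w * g w) z = dzb f z * g z + f z * dzb g z := by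
  simp only [dzb, fderiv_fun_mul' hf hg, _root_.add_apply,
    _root_.smul_apply, smul_eq_mul, MulOpposite.smul_eq_mul_unop,
    MulOpposite.unop_op, smul_mul_assoc, mul_smul_comm, add_mul, mul_add]
  module

theorem dz_star (f : ℂ → A) (z : ℂ) :
    dz (fun w => star (f w)) z = star (dzb f z) := by
  simp [dz, dzb, sub_eq_add_neg]

theorem dzb_star (f : ℂ → A) (z : ℂ) :
    dzb (fun w => star (f w)) z = star (dz f z) := by
  simp [dz, dzb, sub_eq_add_neg]

theorem contDiffAt_star {n : WithTop ℕ∞} {f : ℂ → A} {z : ℂ} (hf : ContDiffAt ℝ n f z) :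
    ContDiffAt ℝ n (fun w => star (f w)) z :=
  ((starL' ℝ : A ≃L[ℝ] A) : A →L[ℝ] A).contDiff.contDiffAt.comp z hf

theorem contDiff_star {n : WithTop ℕ∞} {f : ℂ → A} (hf : ContDiff ℝ n f) :
    ContDiff ℝ n (fun w => star (f w)) :=
  ((starL' ℝ : A ≃L[ℝ] A) : A →L[ℝ] A).contDiff.comp hf

theorem contDiffAt_inverse_comp {n : WithTop ℕ∞} {f : ℂ → A} {z : ℂ} (hf : ContDiffAt ℝ n f z)
    (hu : IsUnit (f z)) : ContDiffAt ℝ n (fun w => Ring.inverse (f w)) z := by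
  obtain ⟨u, hu⟩ := hu
  have := contDiffAt_ringInverse (n := n) ℝ u
  rw [hu] at this
  exact this.comp z hf

end Algebra

/-! ### Projector maps, the harmonic map equation and potentials. -/

section Projections

variable {A : Type*} [CStarAlgebra A] {τ : A →L[ℂ] ℂ}

/-- A faithful positive trace on a C*-algebra. -/
structure IsFaithfulTrace (τ : A →L[ℂ] ℂ) : Prop where
  comm : ∀ a b, τ (a * b) = τ (b * a)
  map_star : ∀ a, τ (star a) = star (τ a)
  nonneg : ∀ a, 0 ≤ (τ (star a * a)).re
  faithful : ∀ a, τ (star a * a) = 0 → a = 0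

/-- A projection of rank one, characterized through the trace `τ`. -/
structure IsRankOne (τ : A →L[ℂ] ℂ) (p : A) : Prop where
  idem : p * p = p
  herm : star p = p
  sandwich : ∀ x, p * x * p = τ (x * p) • p
  trace_one : τ p = 1

theorem mul_mul_of_eq {a b c : A} (h : a * b = c) (x : A) : a * (b * x) = c * x := by
  rw [← mul_assoc, h]

/-- The component `∂₋P P` of the differential of a projector map. -/
def lowerForm (P : ℂ → A) (z : ℂ) : A := dzb P z * P z

/-- The component `∂₊P P` of the differential of a projector map. -/
def raiseForm (P : ℂ → A) (z : ℂ) : A := dz P z * P z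

section ProjMap

variable {P : ℂ → A} (hd : Differentiable ℝ P) (hi : ∀ z, P z * P z = P z)
  (hs : ∀ z, star (P z) = P z)

theorem star_dz_of_herm (hs : ∀ z, star (P z) = P z) (z : ℂ) : star (dz P z) = dzb P z := by
  rw [← dzb_star P z]; exact dzb_congr (Filter.Eventually.of_forall hs)

theorem star_dzb_of_herm (hs : ∀ z, star (P z) = P z) (z : ℂ) : star (dzb P z) = dz P z := by
  rw [← star_dz_of_herm hs, star_star]

include hd hi in
theorem dz_idem (z : ℂ) : dz P z * P z + P z * dz P z = dz P z := by
  rw [← dz_mul (hd z) (hd z)]; exact dz_congr (Filter.Eventually.of_forall hi)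

include hd hi in
theorem dzb_idem (z : ℂ) : dzb P z * P z + P z * dzb P z = dzb P z := by
  rw [← dzb_mul (hd z) (hd z)]; exact dzb_congr (Filter.Eventually.of_forall hi)

/-- The derivative of a projection is off-diagonal: compressing d = dp + pd by p gives pdp = 2pdp.
-/
theorem mul_mul_eq_zero_of_derivation {p d : A} (hp : p * p = p) (h : d * p + p * d = d) :
    p * (d * p) = 0 := by
  have h1 : p * (d * p + p * d) * p = p * d * p := by rw [h]
  have h2 : p * (d * p + p * d) * p = p * d * p + p * d * p := by
    simp only [mul_add, add_mul, mul_assoc, hp, mul_mul_of_eq hp]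
  rw [h2] at h1
  simpa [mul_assoc] using h1

include hd hi in
theorem proj_mul_lowerForm (z : ℂ) : P z * lowerForm P z = 0 :=
  mul_mul_eq_zero_of_derivation (hi z) (dzb_idem hd hi z)

include hd hi in
theorem proj_mul_raiseForm (z : ℂ) : P z * raiseForm P z = 0 :=
  mul_mul_eq_zero_of_derivation (hi z) (dz_idem hd hi z)

include hi in
theorem lowerForm_mul_proj (z : ℂ) : lowerForm P z * P z = lowerForm P z := by
  rw [lowerForm, mul_assoc, hi]

include hi in
theorem raiseForm_mul_proj (z : ℂ) : raiseForm P z * P z = raiseForm P z := by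
  rw [raiseForm, mul_assoc, hi]

include hs in
theorem star_lowerForm (z : ℂ) : star (lowerForm P z) = P z * dz P z := by
  rw [lowerForm, star_mul, hs, star_dzb_of_herm hs]

include hs in
theorem star_raiseForm (z : ℂ) : star (raiseForm P z) = P z * dzb P z := by
  rw [raiseForm, star_mul, hs, star_dz_of_herm hs]

include hd hi hs in
theorem dz_eq_forms (z : ℂ) : dz P z = raiseForm P z + star (lowerForm P z) := by
  rw [star_lowerForm hs, raiseForm, dz_idem hd hi]

include hd hi hs in
theorem dzb_eq_forms (z : ℂ) : dzb P z = lowerForm P z + star (raiseForm P z) := by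
  rw [star_raiseForm hs, lowerForm, dzb_idem hd hi]

include hd hi hs in
theorem star_lowerForm_mul_proj (z : ℂ) : star (lowerForm P z) * P z = 0 := by
  have := congrArg star (proj_mul_lowerForm hd hi z)
  rwa [star_mul, hs, star_zero] at this

include hd hi hs in
theorem star_raiseForm_mul_proj (z : ℂ) : star (raiseForm P z) * P z = 0 := by
  have := congrArg star (proj_mul_raiseForm hd hi z)
  rwa [star_mul, hs, star_zero] at this

include hi hs in
theorem proj_mul_star_lowerForm (z : ℂ) : P z * star (lowerForm P z) = star (lowerForm P z) := by
  rw [star_lowerForm hs, mul_mul_of_eq (hi z)]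

include hi hs in
theorem proj_mul_star_raiseForm (z : ℂ) : P z * star (raiseForm P z) = star (raiseForm P z) := by
  rw [star_raiseForm hs, mul_mul_of_eq (hi z)]

theorem contDiff_lowerForm {n m : WithTop ℕ∞} (hP : ContDiff ℝ n P) (h : m + 1 ≤ n) :
    ContDiff ℝ m (lowerForm P) :=
  (contDiff_dzb hP h).mul (hP.of_le (le_self_add.trans h))

theorem contDiff_raiseForm {n m : WithTop ℕ∞} (hP : ContDiff ℝ n P) (h : m + 1 ≤ n) :
    ContDiff ℝ m (raiseForm P) :=
  (contDiff_dz hP h).mul (hP.of_le (le_self_add.trans h))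

end ProjMap

/-- A `C²` map to the rank-one projections solving the Euler-Lagrange equation. -/
structure IsHarmonic (τ : A →L[ℂ] ℂ) (P : ℂ → A) : Prop where
  contDiff : ContDiff ℝ 2 P
  rank : ∀ z, IsRankOne τ (P z)
  el : ∀ z, dz (dzb P) z * P z = P z * dz (dzb P) z

namespace IsHarmonic

variable {P : ℂ → A} (h : IsHarmonic τ P)
include h

theorem diff : Differentiable ℝ P := h.contDiff.differentiable (by norm_num)
theorem idem (z : ℂ) : P z * P z = P z := (h.rank z).idem
theorem herm (z : ℂ) : star (P z) = P z := (h.rank z).herm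

theorem diff_dz : Differentiable ℝ (dz P) :=
  (contDiff_dz (m := 1) h.contDiff (by norm_num)).differentiable (by norm_num)
theorem diff_dzb : Differentiable ℝ (dzb P) :=
  (contDiff_dzb (m := 1) h.contDiff (by norm_num)).differentiable (by norm_num)
theorem diff_lowerForm : Differentiable ℝ (lowerForm P) :=
  (contDiff_lowerForm (m := 1) h.contDiff (by norm_num)).differentiable (by norm_num)
theorem diff_raiseForm : Differentiable ℝ (raiseForm P) :=
  (contDiff_raiseForm (m := 1) h.contDiff (by norm_num)).differentiable (by norm_num)

theorem P_W (z : ℂ) : P z * lowerForm P z = 0 := proj_mul_lowerForm h.diff h.idem z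
theorem P_V (z : ℂ) : P z * raiseForm P z = 0 := proj_mul_raiseForm h.diff h.idem z
theorem W_P (z : ℂ) : lowerForm P z * P z = lowerForm P z := lowerForm_mul_proj h.idem z
theorem V_P (z : ℂ) : raiseForm P z * P z = raiseForm P z := raiseForm_mul_proj h.idem z
theorem sW_P (z : ℂ) : star (lowerForm P z) * P z = 0 :=
  star_lowerForm_mul_proj h.diff h.idem h.herm z
theorem sV_P (z : ℂ) : star (raiseForm P z) * P z = 0 :=
  star_raiseForm_mul_proj h.diff h.idem h.herm z
theorem P_sW (z : ℂ) : P z * star (lowerForm P z) = star (lowerForm P z) :=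
  proj_mul_star_lowerForm h.idem h.herm z
theorem P_sV (z : ℂ) : P z * star (raiseForm P z) = star (raiseForm P z) :=
  proj_mul_star_raiseForm h.idem h.herm z
theorem dz_eq (z : ℂ) : dz P z = raiseForm P z + star (lowerForm P z) :=
  dz_eq_forms h.diff h.idem h.herm z
theorem dzb_eq (z : ℂ) : dzb P z = lowerForm P z + star (raiseForm P z) :=
  dzb_eq_forms h.diff h.idem h.herm z

/-- The Laplacian of a harmonic projector map, compressed to its range. -/
theorem laplacian_mul_proj (z : ℂ) : dz (dzb P) z * P z =
    -(star (lowerForm P z) * lowerForm P z + star (raiseForm P z) * raiseForm P z) := by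
  set X := dz (dzb P) z with hX
  set p := P z with hp
  set W := lowerForm P z with hW
  set V := raiseForm P z with hV
  -- Apply ∂₊ to ∂₋P = ∂₋P P + P ∂₋P. After compression by p, the Euler-Lagrange equation turns
  -- every term containing X into Xp, leaving Xp = 2Xp + V*V + W*W.
  have e : X = X * p + dzb P z * dz P z + (dz P z * dzb P z + p * X) := by
    have h1 : dz (fun w => dzb P w * P w + P w * dzb P w) z = X :=
      dz_congr (Filter.Eventually.of_forall fun w => dzb_idem h.diff h.idem w)
    rw [dz_add (f := fun w => dzb P w * P w) (g := fun w => P w * dzb P w)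
      ((h.diff_dzb z).mul (h.diff z)) ((h.diff z).mul (h.diff_dzb z)),
      dz_mul (h.diff_dzb z) (h.diff z), dz_mul (h.diff z) (h.diff_dzb z)] at h1
    exact h1.symm
  have hxp : X * p = p * X := h.el z
  have hpp : p * p = p := h.idem z
  have e2 : p * X * p = p * (X * p + dzb P z * dz P z + (dz P z * dzb P z + p * X)) * p :=
    congrArg (fun y => p * y * p) e
  have hWp : W * p = W := h.W_P z
  have hVp : V * p = V := h.V_P z
  have hpW : p * W = 0 := h.P_W z
  have hpV : p * V = 0 := h.P_V z
  have hsWp : star W * p = 0 := h.sW_P z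
  have hsVp : star V * p = 0 := h.sV_P z
  have hpsW : p * star W = star W := h.P_sW z
  have hpsV : p * star V = star V := h.P_sV z
  rw [h.dz_eq, h.dzb_eq, ← hW, ← hV] at e2
  have e3 : p * X * p = X * p := by rw [← hxp, mul_assoc, hpp]
  have e4 : p * (X * p + (W + star V) * (V + star W) + ((V + star W) * (W + star V) + p * X)) * p
      = X * p + X * p + (star V * V + star W * W) := by
    simp only [mul_add, add_mul, mul_assoc, hpp, hWp, hVp, mul_mul_of_eq hpW,
      mul_mul_of_eq hpV, hsWp, hsVp, mul_mul_of_eq hpsW, mul_mul_of_eq hpsV, mul_zero, zero_mul,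
      ← hxp]
    simp only [mul_mul_of_eq hxp.symm, mul_assoc, hpp]
    abel
  rw [e3, e4] at e2
  have : X * p + (star V * V + star W * W) = 0 := by
    have h5 : X * p = X * p + (X * p + (star V * V + star W * W)) := by
      rw [← add_assoc]; exact e2
    exact left_eq_add.mp h5
  rw [eq_neg_of_add_eq_zero_left this, add_comm]

/-- The right side is block diagonal with respect to P, so ∂₊W has no component from the line of P
to its complement: W is covariantly antiholomorphic. -/
theorem dz_lowerForm (z : ℂ) : dz (lowerForm P) z =
    lowerForm P z * star (lowerForm P z) - star (lowerForm P z) * lowerForm P z := by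
  have e : dz (lowerForm P) z = dz (dzb P) z * P z + dzb P z * dz P z :=
    dz_mul (h.diff_dzb z) (h.diff z)
  rw [e, h.laplacian_mul_proj, h.dz_eq, h.dzb_eq]
  have h1 : lowerForm P z * raiseForm P z = 0 := by
    rw [← h.W_P, mul_assoc, h.P_V, mul_zero]
  have h2 : star (raiseForm P z) * star (lowerForm P z) = 0 := by
    rw [← star_mul, h1, star_zero]
  simp only [mul_add, add_mul, h1, h2]
  abel

theorem dzb_raiseForm (z : ℂ) : dzb (raiseForm P) z =
    raiseForm P z * star (raiseForm P z) - star (raiseForm P z) * raiseForm P z := by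
  have e : dzb (raiseForm P) z = dzb (dz P) z * P z + dz P z * dzb P z :=
    dzb_mul (h.diff_dz z) (h.diff z)
  rw [e, ← dz_dzb_comm h.contDiff, h.laplacian_mul_proj, h.dz_eq, h.dzb_eq]
  have h1 : raiseForm P z * lowerForm P z = 0 := by
    rw [← h.V_P, mul_assoc, h.P_W, mul_zero]
  have h2 : star (lowerForm P z) * star (raiseForm P z) = 0 := by
    rw [← star_mul, h1, star_zero]
  simp only [mul_add, add_mul, h1, h2]
  abel

end IsHarmonic

/-- `S` is a Hermitian potential of the rank-one projector map `P`: `∂₋S = -∂₋P P`. -/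
structure IsPotential (τ : A →L[ℂ] ℂ) (P S : ℂ → A) : Prop where
  contDiff : ContDiff ℝ 2 P
  rank : ∀ z, IsRankOne τ (P z)
  contDiff_pot : ContDiff ℝ 2 S
  herm_pot : ∀ z, star (S z) = S z
  dzb_pot : ∀ z, dzb S z = -lowerForm P z

theorem IsPotential.dz_pot {P S : ℂ → A} (h : IsPotential τ P S) (z : ℂ) :
    dz S z = -star (lowerForm P z) := by
  rw [← star_dzb_of_herm h.herm_pot, h.dzb_pot, star_neg]

/-- Integrability: ∂₊∂₋S and ∂₋∂₊S are the derivatives of −∂₋P P and −P ∂₊P, and their equality is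
the commutation of ∂₊∂₋P with P. -/
theorem IsPotential.isHarmonic {P S : ℂ → A} (h : IsPotential τ P S) : IsHarmonic τ P where
  contDiff := h.contDiff
  rank := h.rank
  el := by
    intro z
    have hP : Differentiable ℝ P := h.contDiff.differentiable (by norm_num)
    have hdzb : Differentiable ℝ (dzb P) :=
      (contDiff_dzb (m := 1) h.contDiff (by norm_num)).differentiable (by norm_num)
    have hdz : Differentiable ℝ (dz P) :=
      (contDiff_dz (m := 1) h.contDiff (by norm_num)).differentiable (by norm_num)
    have e1 : dz (dzb S) z = -dz (lowerForm P) z := by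
      rw [← dz_neg]; exact dz_congr (Filter.Eventually.of_forall h.dzb_pot)
    have e2 : dzb (dz S) z = -dzb (fun w => P w * dz P w) z := by
      rw [← dzb_neg]
      refine dzb_congr (Filter.Eventually.of_forall fun w => ?_)
      change dz S w = -(P w * dz P w)
      rw [h.dz_pot, star_lowerForm (fun z => (h.rank z).herm)]
    have e3 : dz (lowerForm P) z = dz (dzb P) z * P z + dzb P z * dz P z :=
      dz_mul (hdzb z) (hP z)
    have e4 := dz_dzb_comm h.contDiff_pot z
    rw [e1, e2, e3, dzb_mul (hP z) (hdz z), ← dz_dzb_comm h.contDiff, neg_inj, add_comm,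
      add_right_inj] at e4
    exact e4

/-- The potential `S` is at `z` a projection orthogonal to `P`. -/
def FlagAt (P S : ℂ → A) (z : ℂ) : Prop := S z * S z = S z ∧ P z * S z = 0

end Projections

/-! ### Holomorphic local frames of a family of projections. -/

section Frames

variable {A : Type*} [CStarAlgebra A] {τ : A →L[ℂ] ℂ}

/-- The intertwiner of the projection `s₁` with the projection `s`. -/
def intertwiner (s₁ s : A) : A := s₁ * s + (1 - s₁) * (1 - s)

/-- The frame of the range of `s` with coordinates in the range of `s₁`. -/
def frame (s₁ s : A) : A := s * Ring.inverse (intertwiner s₁ s)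

theorem intertwiner_self {s : A} (hs : s * s = s) : intertwiner s s = 1 := by
  have : (1 - s) * (1 - s) = 1 - s := by
    simp [mul_sub, sub_mul, hs]
  rw [intertwiner, hs, this]; abel

theorem frame_self {s : A} (hs : s * s = s) : frame s s = s := by
  rw [frame, intertwiner_self hs, Ring.inverse_one, mul_one]

section

variable {s₁ s : A} (h₁ : s₁ * s₁ = s₁) (hs : s * s = s) (hu : IsUnit (intertwiner s₁ s))

include hs in
theorem intertwiner_mul_right : intertwiner s₁ s * s = s₁ * s := by
  simp [intertwiner, add_mul, mul_assoc, sub_mul, mul_sub, hs]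

include h₁ in
theorem mul_intertwiner_left : s₁ * intertwiner s₁ s = s₁ * s := by
  simp [intertwiner, mul_add, sub_mul, mul_sub, mul_mul_of_eq h₁, h₁]

include h₁ hu in
theorem left_mul_frame : s₁ * frame s₁ s = s₁ := by
  rw [frame, ← mul_assoc, ← mul_intertwiner_left h₁, mul_assoc, Ring.mul_inverse_cancel _ hu,
    mul_one]

include hs in
theorem proj_mul_frame : s * frame s₁ s = frame s₁ s := by
  rw [frame, ← mul_assoc, hs]

include h₁ hs hu in
theorem frame_mul_of_mem {y : A} (hy : s * y = y) : frame s₁ s * y = y := by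
  -- The intertwiner u satisfies us = s₁u, so the frame su⁻¹ is also u⁻¹s₁; moreover u agrees with
  -- s₁ on the range of s.
  have h2 : s * Ring.inverse (intertwiner s₁ s) = Ring.inverse (intertwiner s₁ s) * s₁ := by
    have e : intertwiner s₁ s * s = s₁ * intertwiner s₁ s := by
      rw [intertwiner_mul_right hs, mul_intertwiner_left h₁]
    calc s * Ring.inverse (intertwiner s₁ s)
        = Ring.inverse (intertwiner s₁ s) * (intertwiner s₁ s * s) *
          Ring.inverse (intertwiner s₁ s) := by
          rw [← mul_assoc, Ring.inverse_mul_cancel _ hu, one_mul]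
      _ = Ring.inverse (intertwiner s₁ s) * s₁ := by
          rw [e, mul_assoc, mul_assoc, Ring.mul_inverse_cancel _ hu, mul_one]
  rw [frame, h2, mul_assoc]
  have h3 : s₁ * y = intertwiner s₁ s * y := by
    conv_lhs => rw [← hy, ← mul_assoc, ← intertwiner_mul_right hs, mul_assoc, hy]
  rw [h3, ← mul_assoc, Ring.inverse_mul_cancel _ hu, one_mul]

include hu in
theorem star_intertwiner_mul_star_frame_mul (hh : star s = s) {y : A} (hy : s * y = y) :
    star (intertwiner s₁ s) * (star (frame s₁ s) * y) = y := by
  rw [← mul_assoc, ← star_mul, frame, mul_assoc, Ring.inverse_mul_cancel _ hu, mul_one, hh, hy]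

end

/-- The frame of a holomorphic family of projections is holomorphic. -/
theorem dzb_frame {s₁ : A} {S : ℂ → A} {z : ℂ} (h₁ : s₁ * s₁ = s₁)
    (hS : DifferentiableAt ℝ S z) (hi : ∀ᶠ w in 𝓝 z, S w * S w = S w)
    (hhol : dzb S z * S z = 0) (hu : ∀ᶠ w in 𝓝 z, IsUnit (intertwiner s₁ (S w)))
    (hE : DifferentiableAt ℝ (fun w => frame s₁ (S w)) z) :
    dzb (fun w => frame s₁ (S w)) z = 0 := by
  set E := fun w => frame s₁ (S w) with hEdef
  -- ∂₋E is annihilated by s₁ and fixed by S, hence annihilated by the intertwiner, which is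
  -- invertible.
  have e1 : s₁ * dzb E z = 0 := by
    have : dzb (fun w => s₁ * E w) z = dzb (fun _ => s₁) z :=
      dzb_congr (hu.mono fun w hw => left_mul_frame h₁ hw)
    rwa [dzb_mul (differentiableAt_const _) hE, dzb_const, zero_mul, zero_add] at this
  have e2 : S z * dzb E z = dzb E z := by
    have : dzb (fun w => S w * E w) z = dzb E z :=
      dzb_congr (hi.mono fun w hw => proj_mul_frame hw)
    rw [dzb_mul hS hE] at this
    have e0 : dzb S z * E z = 0 := by
      simp only [hEdef]
      rw [← proj_mul_frame hi.self_of_nhds (s₁ := s₁), ← mul_assoc, hhol, zero_mul]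
    rwa [e0, zero_add] at this
  have e3 : intertwiner s₁ (S z) * dzb E z = 0 := by
    rw [intertwiner, add_mul, mul_assoc, e2, e1, mul_assoc, sub_mul 1 (S z), e2]; simp
  have := congrArg (fun y => Ring.inverse (intertwiner s₁ (S z)) * y) e3
  simpa [← mul_assoc, Ring.inverse_mul_cancel _ hu.self_of_nhds] using this

theorem contDiffAt_intertwiner {n : WithTop ℕ∞} {S : ℂ → A} {z : ℂ} (s₁ : A)
    (hS : ContDiffAt ℝ n S z) : ContDiffAt ℝ n (fun w => intertwiner s₁ (S w)) z :=
  (contDiffAt_const.mul hS).add (contDiffAt_const.mul (contDiffAt_const.sub hS))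

theorem contDiffAt_frame {n : WithTop ℕ∞} {s₁ : A} {S : ℂ → A} {z : ℂ}
    (hS : ContDiffAt ℝ n S z) (hu : IsUnit (intertwiner s₁ (S z))) :
    ContDiffAt ℝ n (fun w => frame s₁ (S w)) z :=
  hS.mul (contDiffAt_inverse_comp (contDiffAt_intertwiner s₁ hS) hu)

theorem eventually_isUnit_intertwiner {S : ℂ → A} {z : ℂ} (hS : ContinuousAt S z)
    (hi : S z * S z = S z) : ∀ᶠ w in 𝓝 z, IsUnit (intertwiner (S z) (S w)) := by
  have hc : ContinuousAt (fun w => intertwiner (S z) (S w)) z := by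
    unfold intertwiner
    exact (continuousAt_const.mul hS).add (continuousAt_const.mul (continuousAt_const.sub hS))
  refine hc.eventually_mem (s := {y : A | IsUnit y}) ?_
  rw [intertwiner_self hi]
  exact Units.isOpen.mem_nhds isUnit_one

/-- Local frames around a point where `S` is a projection orthogonal to `P`: `E` spans the range
of `S`, while `G` and `H` span the range of `P`. They are holomorphic, respectively
antiholomorphic, where `S` remains a projection orthogonal to `P`. -/
structure IsLocalFrame (n : WithTop ℕ∞) (P S : ℂ → A) (z₁ : ℂ) (E X G H : ℂ → A) (z : ℂ) :
    Prop where
  contDiff_E : ContDiffAt ℝ n E z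
  contDiff_X : ContDiffAt ℝ n X z
  contDiff_G : ContDiffAt ℝ n G z
  contDiff_H : ContDiffAt ℝ n H z
  P_G : P z * G z = G z
  P_H : P z * H z = H z
  H_P : H z * P z₁ = H z
  H_G : H z * star (G z) = P z
  dzb_E : (∀ᶠ w in 𝓝 z, FlagAt P S w) → dzb E z = 0
  dz_H : (∀ᶠ w in 𝓝 z, FlagAt P S w) → P z * dz H z = 0
  S_E : FlagAt P S z → S z * E z = E z
  E_mul : FlagAt P S z → ∀ y, S z * y = y → E z * y = y
  X_E : FlagAt P S z → ∀ y, S z * y = y → star (X z) * (star (E z) * y) = y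

theorem IsRankOne.star_mul_self {p₁ x : A} (hp₁ : IsRankOne τ p₁)
    (hx : x * p₁ = x) : star x * x = τ (star x * x) • p₁ := by
  have h1 : p₁ * (star x * x) * p₁ = star x * x := by
    have : p₁ * star x = star x := by
      have := congrArg star hx
      rwa [star_mul, hp₁.herm] at this
    rw [← mul_assoc, this, mul_assoc, hx]
  have h2 := hp₁.sandwich (star x * x)
  rwa [h1, mul_assoc (star x) x, hx] at h2

theorem IsRankOne.self_mul_star {p x : A} (hp : IsRankOne τ p) (hτ : IsFaithfulTrace τ)
    (hx : p * x = x) : x * star x = τ (star x * x) • p := by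
  have h : star x * p = star x := by
    have := congrArg star hx
    rwa [star_mul, hp.herm] at this
  have := hp.star_mul_self h
  rwa [star_star, hτ.comm] at this

/-- The frames must be smooth on a whole neighbourhood of z₁, including points where `S` is not
known to be a projector. They are therefore built from inverses of intertwiners, and their
holomorphy is claimed only where `FlagAt` holds nearby. -/
theorem exists_localFrame (hτ : IsFaithfulTrace τ) {n : WithTop ℕ∞} (hn : 2 ≤ n) {P S : ℂ → A}
    (h : IsPotential τ P S) (hPn : ContDiff ℝ n P) (hSn : ContDiff ℝ n S) {z₁ : ℂ}
    (hz₁ : FlagAt P S z₁) :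
    ∃ E X G H : ℂ → A, X z₁ = 1 ∧ G z₁ = P z₁ ∧ ∀ᶠ z in 𝓝 z₁, IsLocalFrame n P S z₁ E X G H z := by
  set p₁ := P z₁ with hp₁
  set s₁ := S z₁ with hs₁
  have hr := h.isHarmonic
  have hPd := hr.diff
  have hSd : Differentiable ℝ S := h.contDiff_pot.differentiable (by norm_num)
  have hn0 : n ≠ 0 := by
    rintro rfl; simp at hn
  -- On the flag locus the ranges of S and of T = S + P are both holomorphic. `G` compresses the
  -- frame of T to P, a holomorphic section of the quotient T/S, and `H` is the dual frame, hence
  -- antiholomorphic.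
  set T := fun z => S z + P z with hT
  have hSP : ∀ z, FlagAt P S z → S z * P z = 0 := fun z hz => by
    have := congrArg star hz.2
    rwa [star_mul, h.herm_pot, hr.herm, star_zero] at this
  have hTi : ∀ z, FlagAt P S z → T z * T z = T z := fun z hz => by
    simp only [hT, mul_add, add_mul, hz.1, hz.2, hSP z hz, hr.idem]; simp
  have hTn : ContDiff ℝ n T := hSn.add hPn
  have hTd : Differentiable ℝ T := hSd.add hPd
  set G := fun z => P z * frame (T z₁) (T z) * p₁ with hG
  set ν := fun z => τ (star (G z) * G z) with hν
  set H := fun z => (ν z)⁻¹ • G z with hH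
  have hG1 : G z₁ = P z₁ := by
    simp only [hG]
    rw [frame_self (hTi z₁ hz₁)]
    simp only [hT, mul_add, hz₁.2, zero_add, hr.idem, hp₁]
  have hν1 : ν z₁ = 1 := by
    simp only [hν]; rw [hG1, hr.herm, hr.idem, (h.rank z₁).trace_one]
  have hPG : ∀ z, P z * G z = G z := fun z => by
    simp only [hG, ← mul_assoc, hr.idem]
  have hGP : ∀ z, G z * p₁ = G z := fun z => by
    simp only [hG, mul_assoc]; rw [hr.idem z₁]
  have uS : ∀ᶠ z in 𝓝 z₁, IsUnit (intertwiner s₁ (S z)) :=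
    eventually_isUnit_intertwiner (hSd z₁).continuousAt hz₁.1
  have uT : ∀ᶠ z in 𝓝 z₁, IsUnit (intertwiner (T z₁) (T z)) :=
    eventually_isUnit_intertwiner (hTd z₁).continuousAt (hTi z₁ hz₁)
  have cG : ∀ z, IsUnit (intertwiner (T z₁) (T z)) → ContDiffAt ℝ n G z := fun z hz =>
    ((hPn.contDiffAt).mul (contDiffAt_frame hTn.contDiffAt hz)).mul contDiffAt_const
  have cν : ∀ z, IsUnit (intertwiner (T z₁) (T z)) → ContDiffAt ℝ n ν z := fun z hz =>
    clm_contDiffAt τ ((contDiffAt_star (cG z hz)).mul (cG z hz))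
  have uν : ∀ᶠ z in 𝓝 z₁, ν z ≠ 0 :=
    (cν z₁ uT.self_of_nhds).continuousAt.eventually_ne (by rw [hν1]; exact one_ne_zero)
  refine ⟨fun z => frame s₁ (S z), fun z => intertwiner s₁ (S z), G, H,
    intertwiner_self hz₁.1, hG1, ?_⟩
  filter_upwards [uS.eventually_nhds, uT.eventually_nhds, uν.eventually_nhds] with z uS uT uν
  have hE : ContDiffAt ℝ n (fun z => frame s₁ (S z)) z :=
    contDiffAt_frame hSn.contDiffAt uS.self_of_nhds
  have hHn : ContDiffAt ℝ n H z := by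
    have : ContDiffAt ℝ n (fun z => (ν z)⁻¹) z :=
      (cν z uT.self_of_nhds).inv uν.self_of_nhds
    exact this.smul (cG z uT.self_of_nhds)
  have hGd : DifferentiableAt ℝ G z := (cG z uT.self_of_nhds).differentiableAt hn0
  have hHd : DifferentiableAt ℝ H z := hHn.differentiableAt hn0
  have hHG : H z * star (G z) = P z := by
    simp only [hH, smul_mul_assoc]
    rw [(h.rank z).self_mul_star hτ (hPG z), smul_smul, inv_mul_cancel₀ uν.self_of_nhds, one_smul]
  refine ⟨hE, contDiffAt_intertwiner s₁ hSn.contDiffAt, cG z uT.self_of_nhds, hHn, hPG z, ?_, ?_,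
    hHG, ?_, ?_, fun hf => proj_mul_frame hf.1,
    fun hf y hy => frame_mul_of_mem hz₁.1 hf.1 uS.self_of_nhds hy,
    fun hf y hy => star_intertwiner_mul_star_frame_mul uS.self_of_nhds (h.herm_pot z) hy⟩
  · simp only [hH, mul_smul_comm, hPG]
  · simp only [hH, smul_mul_assoc]; rw [hGP]
  · intro hf
    refine dzb_frame hz₁.1 (hSd z) (hf.mono fun w hw => hw.1) ?_ uS (hE.differentiableAt hn0)
    rw [h.dzb_pot, neg_mul, ← hr.W_P, mul_assoc, hf.self_of_nhds.2, mul_zero, neg_zero]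
  · intro hf
    have hf0 := hf.self_of_nhds
    have hdPS : dzb P z * S z = 0 := by
      have : dzb (fun w => P w * S w) z = dzb (fun _ => (0 : A)) z :=
        dzb_congr (hf.mono fun w hw => hw.2)
      rw [dzb_mul (hPd z) (hSd z), dzb_const, h.dzb_pot, mul_neg, hr.P_W, neg_zero, add_zero]
        at this
      exact this
    have hPdT : P z * (dzb P z * T z) = 0 := by
      simp only [hT, mul_add, hdPS, zero_add]
      exact hr.P_W z
    have hdT : dzb T z * T z = 0 := by
      have : dzb T z = star (raiseForm P z) := by
        rw [show dzb T z = dzb S z + dzb P z from dzb_add (hSd z) (hPd z), h.dzb_pot, hr.dzb_eq]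
        abel
      rw [this, star_raiseForm hr.herm, mul_assoc, hPdT]
    have hET : DifferentiableAt ℝ (fun w => frame (T z₁) (T w)) z :=
      (contDiffAt_frame hTn.contDiffAt uT.self_of_nhds).differentiableAt hn0
    have hdET : dzb (fun w => frame (T z₁) (T w)) z = 0 :=
      dzb_frame (hTi z₁ hz₁) (hTd z) (hf.mono fun w hw => hTi w hw) hdT uT hET
    have hdG : P z * dzb G z = 0 := by
      have : dzb G z = dzb P z * frame (T z₁) (T z) * p₁ := by
        simp only [hG]
        rw [dzb_mul (f := fun w => P w * frame (T z₁) (T w)) ((hPd z).mul hET)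
          (differentiableAt_const _), dzb_const, mul_zero, add_zero, dzb_mul (hPd z) hET, hdET,
          mul_zero, add_zero]
      rw [this, ← proj_mul_frame (hTi z hf0) (s₁ := T z₁)]
      have e := congrArg (fun y => y * (frame (T z₁) (T z) * p₁)) hPdT
      simpa [mul_assoc] using e
    -- Differentiating this duality by ∂₊ transfers P ∂₋G = 0 to P ∂₊H = 0.
    have hGH : ∀ᶠ w in 𝓝 z, star (G w) * H w = p₁ := by
      filter_upwards [uν] with w hw
      simp only [hH, mul_smul_comm]
      rw [(h.rank z₁).star_mul_self (hGP w), smul_smul, inv_mul_cancel₀ hw, one_smul]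
    have e := dz_congr hGH
    rw [dz_const, dz_mul hGd.star hHd, dz_star] at e
    have hPH : P z * H z = H z := by simp only [hH, mul_smul_comm, hPG]
    have e0 : star (dzb G z) * H z = 0 := by
      have := congrArg star hdG
      rw [star_mul, hr.herm, star_zero] at this
      rw [← hPH, ← mul_assoc, this, zero_mul]
    rw [e0, zero_add] at e
    rw [← hHG, mul_assoc, e, mul_zero]

/-- Compressing a form by local frames turns its covariant derivative into a plain one. -/
theorem IsLocalFrame.dz_compress {n : WithTop ℕ∞} (hn : 2 ≤ n) {P S E X G H : ℂ → A} {z₁ z : ℂ}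
    (hL : IsLocalFrame n P S z₁ E X G H z)
    (hf : ∀ᶠ w in 𝓝 z, FlagAt P S w) {ω : ℂ → A} (hω : DifferentiableAt ℝ ω z)
    (hωP : ω z * P z = ω z) :
    dz (fun w => star (E w) * ω w * H w) z = star (E z) * dz ω z * H z := by
  have hn0 : n ≠ 0 := by
    rintro rfl; simp at hn
  have hE := hL.contDiff_E.differentiableAt hn0
  have hH := hL.contDiff_H.differentiableAt hn0
  rw [dz_mul (f := fun w => star (E w) * ω w) (hE.star.mul hω) hH, dz_mul hE.star hω, dz_star, hL.dzb_E hf, star_zero, zero_mul,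
    zero_add]
  have : star (E z) * ω z * dz H z = 0 := by
    rw [← hωP, mul_assoc, mul_assoc, hL.dz_H hf, mul_zero, mul_zero]
  rw [this, add_zero]

theorem IsLocalFrame.star_E_mul_P {n : WithTop ℕ∞} {P S E X G H : ℂ → A} {z₁ z : ℂ}
    (h : IsPotential τ P S) (hL : IsLocalFrame n P S z₁ E X G H z) (hf : FlagAt P S z) :
    star (E z) * P z = 0 := by
  have : P z * E z = 0 := by rw [← hL.S_E hf, ← mul_assoc, hf.2, zero_mul]
  have := congrArg star this
  rwa [star_mul, (h.rank z).herm, star_zero] at this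

/-- The compression of the lowering form by local frames is antiholomorphic. -/
theorem IsLocalFrame.dz_lowerForm {n : WithTop ℕ∞} (hn : 2 ≤ n) {P S E X G H : ℂ → A} {z₁ z : ℂ}
    (h : IsPotential τ P S) (hL : IsLocalFrame n P S z₁ E X G H z)
    (hf : ∀ᶠ w in 𝓝 z, FlagAt P S w) :
    dz (fun w => star (E w) * lowerForm P w * H w) z = 0 := by
  have hr := h.isHarmonic
  rw [hL.dz_compress hn hf (hr.diff_lowerForm z) (hr.W_P z), hr.dz_lowerForm]
  have e1 : star (E z) * star (lowerForm P z) = 0 := by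
    rw [← hr.P_sW, ← mul_assoc, hL.star_E_mul_P h hf.self_of_nhds, zero_mul]
  have e2 : star (lowerForm P z) * H z = 0 := by
    rw [← hL.P_H, ← mul_assoc, hr.sW_P, zero_mul]
  have e3 : star (E z) * (star (lowerForm P z) * lowerForm P z) = 0 := by
    rw [← mul_assoc, e1, zero_mul]
  rw [mul_sub, e3, sub_zero, mul_assoc, mul_assoc, e2, mul_zero, mul_zero]

/-- Apply ∂₋ to SP = 0 and multiply by P on the right: −W + SW = 0. -/
theorem FlagAt.pot_mul_lowerForm {P S : ℂ → A} {z : ℂ} (h : IsPotential τ P S)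
    (hf : ∀ᶠ w in 𝓝 z, FlagAt P S w) : S z * lowerForm P z = lowerForm P z := by
  have hr := h.isHarmonic
  have hSd : Differentiable ℝ S := h.contDiff_pot.differentiable (by norm_num)
  have hSP : ∀ᶠ w in 𝓝 z, S w * P w = 0 := hf.mono fun w hw => by
    have := congrArg star hw.2
    rwa [star_mul, h.herm_pot, hr.herm, star_zero] at this
  have : dzb (fun w => S w * P w) z = dzb (fun _ => (0 : A)) z := dzb_congr hSP
  rw [dzb_mul (hSd z) (hr.diff z), dzb_const, h.dzb_pot] at this
  have e := congrArg (fun y => y * P z) this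
  simp only [add_mul, neg_mul, zero_mul, mul_assoc, hr.W_P] at e
  exact (neg_add_eq_zero.mp e).symm

end Frames

/-! ### Flag pairs; raising and lowering. -/

section FlagPairs

variable {A : Type*} [CStarAlgebra A] {τ : A →L[ℂ] ℂ}

/-- A rank-one projector map `P` together with a projector-valued potential orthogonal to it. -/
structure IsFlagPair (τ : A →L[ℂ] ℂ) (P S : ℂ → A) : Prop extends IsPotential τ P S where
  flag : ∀ z, FlagAt P S z

/-- The projection onto the range of the rank-one element `x`. -/
def lineProj (τ : A →L[ℂ] ℂ) (x : A) : A := (τ (star x * x))⁻¹ • (x * star x)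

theorem lineProj_smul {c : ℂ} (hc : c ≠ 0) (x : A) : lineProj τ (c • x) = lineProj τ x := by
  simp only [lineProj, star_smul, smul_mul_assoc, mul_smul_comm, smul_smul, map_smul, smul_eq_mul]
  congr 1
  have : star c ≠ 0 := star_ne_zero.mpr hc
  field_simp

theorem IsFaithfulTrace.ne_zero (hτ : IsFaithfulTrace τ) {x : A} (hx : x ≠ 0) :
    τ (star x * x) ≠ 0 := fun h => hx (hτ.faithful x h)

theorem IsFaithfulTrace.star_apply (hτ : IsFaithfulTrace τ) (x : A) :
    star (τ (star x * x)) = τ (star x * x) := by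
  rw [← hτ.map_star, star_mul, star_star]

theorem isRankOne_lineProj (hτ : IsFaithfulTrace τ) {p x : A} (hp : IsRankOne τ p)
    (hxp : x * p = x) (hx : x ≠ 0) : IsRankOne τ (lineProj τ x) := by
  have hn := hτ.ne_zero hx
  have hxx := hp.star_mul_self hxp
  have key : ∀ y, x * star x * y * (x * star x) = τ (y * (x * star x)) • (x * star x) := by
    intro y
    have h1 : star x * y * x = τ (star x * y * x) • p := by
      have hps : p * star x = star x := by
        have := congrArg star hxp
        rwa [star_mul, hp.herm] at this
      have := hp.sandwich (star x * y * x)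
      have e : p * (star x * y * x) * p = star x * y * x := by
        rw [mul_assoc, mul_assoc (star x * y), hxp, ← mul_assoc, ← mul_assoc, hps]
      rwa [e, mul_assoc (star x * y), hxp] at this
    calc x * star x * y * (x * star x) = x * (star x * y * x) * star x := by noncomm_ring
      _ = τ (star x * y * x) • (x * star x) := by
        rw [h1, map_smul, hp.trace_one, smul_eq_mul, mul_one, mul_smul_comm, smul_mul_assoc, hxp]
      _ = _ := by rw [mul_assoc, hτ.comm, mul_assoc]
  have htr : τ (x * star x) = τ (star x * x) := hτ.comm _ _
  refine ⟨?_, ?_, ?_, ?_⟩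
  · have h1 := key 1
    rw [mul_one, one_mul, htr] at h1
    simp only [lineProj, smul_mul_assoc, mul_smul_comm, h1, smul_smul]
    congr 1; field_simp
  · simp only [lineProj, star_smul, star_mul, star_star, star_inv₀, hτ.star_apply]
  · intro y
    simp only [lineProj, smul_mul_assoc, mul_smul_comm, key, smul_smul, map_smul, smul_eq_mul]
    congr 1; ring
  · simp only [lineProj, map_smul, htr, smul_eq_mul, inv_mul_cancel₀ hn]

theorem lineProj_spec (hτ : IsFaithfulTrace τ) {x : A} (hx : x ≠ 0) :
    x * star x = τ (x * star x) • lineProj τ x := by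
  rw [lineProj, smul_smul, hτ.comm x, mul_inv_cancel₀ (hτ.ne_zero hx), one_smul]

theorem contDiffAt_lineProj {n : WithTop ℕ∞} {Z : ℂ → A} {z : ℂ} (hZ : ContDiffAt ℝ n Z z)
    (h0 : τ (star (Z z) * Z z) ≠ 0) : ContDiffAt ℝ n (fun w => lineProj τ (Z w)) z := by
  have h1 : ContDiffAt ℝ n (fun w => (τ (star (Z w) * Z w))⁻¹) z :=
    (clm_contDiffAt τ ((contDiffAt_star hZ).mul hZ)).inv h0
  exact h1.smul (hZ.mul (contDiffAt_star hZ))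

theorem tendsto_conj (z : ℂ) : Filter.Tendsto (starRingEnd ℂ) (𝓝 z) (𝓝 (starRingEnd ℂ z)) :=
  Complex.continuous_conj.tendsto z

/-- Around every point, the lowering form either vanishes identically or is a scalar multiple of a
nowhere vanishing `C^n` form. -/
theorem IsFlagPair.lowerForm_local (hτ : IsFaithfulTrace τ) {P S : ℂ → A} (h : IsFlagPair τ P S)
    {n : WithTop ℕ∞} (hn : 2 ≤ n) (hPn : ContDiff ℝ n P) (hSn : ContDiff ℝ n S) (z₁ : ℂ) :
    (∀ᶠ z in 𝓝 z₁, lowerForm P z = 0) ∨ ((∀ᶠ z in 𝓝[≠] z₁, lowerForm P z ≠ 0) ∧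
      ∃ Z : ℂ → A, ContDiffAt ℝ n Z z₁ ∧
        ∀ᶠ z in 𝓝 z₁, Z z ≠ 0 ∧ Z z * P z = Z z ∧ ∃ c : ℂ, lowerForm P z = c • Z z) := by
  have hr := h.isHarmonic
  have hn0 : n ≠ 0 := by
    rintro rfl; simp at hn
  obtain ⟨E, X, G, H, hX1, hG1, hL⟩ := exists_localFrame hτ hn h.toIsPotential hPn hSn (h.flag z₁)
  -- W read in the frames. It is antiholomorphic, hence analytic in the conjugate variable ζ.
  set η : ℂ → A := fun z => star (E z) * lowerForm P z * H z with hη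
  have hflag : ∀ z, ∀ᶠ w in 𝓝 z, FlagAt P S w := fun z => Filter.Eventually.of_forall h.flag
  set ζ₁ := starRingEnd ℂ z₁ with hζ₁
  have hLc : ∀ᶠ ζ in 𝓝 ζ₁, IsLocalFrame n P S z₁ E X G H (starRingEnd ℂ ζ) := by
    have := tendsto_conj ζ₁
    rw [hζ₁, Complex.conj_conj] at this
    exact this.eventually hL
  have han : AnalyticAt ℂ (fun ζ => η (starRingEnd ℂ ζ)) ζ₁ := by
    rw [Complex.analyticAt_iff_eventually_differentiableAt]
    filter_upwards [hLc] with ζ hζ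
    have hd : DifferentiableAt ℝ η (starRingEnd ℂ ζ) :=
      ((hζ.contDiff_E.differentiableAt hn0).star.mul (hr.diff_lowerForm _)).mul
        (hζ.contDiff_H.differentiableAt hn0)
    refine differentiableAt_complex_of_dzb_eq_zero ?_ ?_
    · exact hd.comp ζ Complex.conjCLE.differentiableAt
    · rw [dzb_comp_conj]
      exact hζ.dz_lowerForm hn h.toIsPotential (hflag _)
  -- Nothing is lost by the compression: X* inverts E* on the range of S, which contains that of W,
  -- and H G* = P.
  have hW : ∀ᶠ z in 𝓝 z₁, lowerForm P z = star (X z) * η z * star (G z) := by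
    filter_upwards [hL] with z hz
    have e1 : S z * (lowerForm P z * H z) = lowerForm P z * H z := by
      rw [← mul_assoc, FlagAt.pot_mul_lowerForm h.toIsPotential (hflag z)]
    have e2 := hz.X_E (h.flag z) _ e1
    have e3 := congrArg (fun y => y * star (G z)) e2
    simp only [mul_assoc, hz.H_G, hr.W_P] at e3
    simp only [hη, mul_assoc, hz.H_G, hr.W_P]
    exact e3.symm
  by_cases h0 : ∀ᶠ ζ in 𝓝 ζ₁, η (starRingEnd ℂ ζ) = 0
  · left
    have h0' : ∀ᶠ z in 𝓝 z₁, η z = 0 := by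
      have := (tendsto_conj z₁).eventually h0
      simpa using this
    filter_upwards [hW, h0'] with z h1 h2
    rw [h1, h2]; simp
  · right
    -- Split off the order of vanishing; the remaining factor `u` is nonzero at ζ₁ and continues the
    -- direction of W through z₁.
    obtain ⟨m, u, hu, hu0, hu1⟩ := han.exists_eventuallyEq_pow_smul_nonzero_iff.mpr h0
    set Z : ℂ → A := fun z => star (X z) * u (starRingEnd ℂ z) * star (G z) with hZ
    have hu1' : ∀ᶠ z in 𝓝 z₁, η z = (starRingEnd ℂ z - ζ₁) ^ m • u (starRingEnd ℂ z) := by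
      have := (tendsto_conj z₁).eventually hu1
      simpa using this
    have hWZ : ∀ᶠ z in 𝓝 z₁, lowerForm P z = (starRingEnd ℂ z - ζ₁) ^ m • Z z := by
      filter_upwards [hW, hu1'] with z h1 h2
      rw [h1, h2, hZ]; simp
    have hne : ∀ᶠ z in 𝓝[≠] z₁, (starRingEnd ℂ z - ζ₁) ^ m ≠ 0 := by
      filter_upwards [self_mem_nhdsWithin] with z hz
      refine pow_ne_zero _ (sub_ne_zero.mpr fun he => hz ?_)
      exact (starRingEnd ℂ).injective he
    have huc : ContinuousAt (fun z => u (starRingEnd ℂ z)) z₁ :=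
      ContinuousAt.comp (f := starRingEnd ℂ) hu.continuousAt (tendsto_conj z₁)
    -- At z₁ itself this is a limit, since W may vanish there. As X = 1 and G = P at z₁, it gives Z
    -- = u ≠ 0 at that point.
    have hup : u ζ₁ * P z₁ = u ζ₁ := by
      refine tendsto_nhds_unique_of_eventuallyEq (l := 𝓝[≠] z₁)
        (f := fun z => u (starRingEnd ℂ z) * P z₁) (g := fun z => u (starRingEnd ℂ z))
        ((huc.mul continuousAt_const).tendsto.mono_left nhdsWithin_le_nhds)
        (huc.tendsto.mono_left nhdsWithin_le_nhds) ?_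
      filter_upwards [hne, hu1'.filter_mono nhdsWithin_le_nhds,
        hL.filter_mono nhdsWithin_le_nhds] with z h1 h2 h3
      have e : η z * P z₁ = η z := by rw [hη]; simp only [mul_assoc, h3.H_P]
      rw [h2, smul_mul_assoc] at e
      exact smul_right_injective _ h1 e
    have hZ1 : Z z₁ ≠ 0 := by
      have : Z z₁ = u ζ₁ := by
        simp only [hZ]; rw [hX1, hG1, hr.herm, star_one, one_mul, hup]
      rwa [this]
    have hZn : ContDiffAt ℝ n Z z₁ := by
      have h1 : ContDiffAt ℝ n (fun z => u (starRingEnd ℂ z)) z₁ := by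
        have : ContDiffAt ℝ n u ζ₁ := hu.contDiffAt.restrict_scalars ℝ
        exact this.comp z₁ Complex.conjCLE.contDiff.contDiffAt
      exact ((contDiffAt_star hL.self_of_nhds.contDiff_X).mul h1).mul
        (contDiffAt_star hL.self_of_nhds.contDiff_G)
    have hZne : ∀ᶠ z in 𝓝 z₁, Z z ≠ 0 := hZn.continuousAt.eventually_ne hZ1
    refine ⟨?_, Z, hZn, ?_⟩
    · filter_upwards [hne, hWZ.filter_mono nhdsWithin_le_nhds,
        hZne.filter_mono nhdsWithin_le_nhds] with z h1 h2 h3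
      rw [h2]; exact smul_ne_zero h1 h3
    · filter_upwards [hZne, hWZ, hL] with z h1 h2 h3
      refine ⟨h1, ?_, _, h2⟩
      have : star (G z) * P z = star (G z) := by
        have := congrArg star h3.P_G
        rwa [star_mul, hr.herm] at this
      simp only [hZ, mul_assoc, this]

/-- The zeros of the lowering form of a flag pair are isolated, unless it vanishes identically. -/
theorem IsFlagPair.lowerForm_ne_zero (hτ : IsFaithfulTrace τ) {P S : ℂ → A} (h : IsFlagPair τ P S)
    (hW : ∃ z, lowerForm P z ≠ 0) (z : ℂ) : ∀ᶠ w in 𝓝[≠] z, lowerForm P w ≠ 0 := by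
  have hloc := fun z => h.lowerForm_local hτ (n := 2) le_rfl h.contDiff h.contDiff_pot z
  -- By the local dichotomy this set is open and closed.
  set Zs := {z : ℂ | ∀ᶠ w in 𝓝 z, lowerForm P w = 0} with hZs
  have hopen : IsOpen Zs := isOpen_setOfPred_eventually_nhds
  have hclosed : IsClosed Zs := by
    rw [← isOpen_compl_iff, isOpen_iff_mem_nhds]
    intro z hz
    have h1 := ((hloc z).resolve_left hz).1
    rw [eventually_nhdsWithin_iff] at h1
    filter_upwards [h1] with w hw
    by_cases hwz : w = z
    · rwa [hwz]
    · exact fun hw' => hw hwz hw'.self_of_nhds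
  rcases isClopen_iff.mp ⟨hclosed, hopen⟩ with h1 | h1
  · have hz : z ∉ Zs := by rw [h1]; simp
    exact ((hloc z).resolve_left hz).1
  · obtain ⟨w, hw⟩ := hW
    have hw' : w ∈ Zs := by rw [h1]; trivial
    exact absurd hw'.self_of_nhds hw

/-- The line spanned by the lowering form extends across its zeros. -/
theorem IsFlagPair.exists_lowered (hτ : IsFaithfulTrace τ) {P S : ℂ → A} (h : IsFlagPair τ P S)
    {n : WithTop ℕ∞} (hn : 2 ≤ n) (hPn : ContDiff ℝ n P) (hSn : ContDiff ℝ n S)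
    (hW : ∃ z, lowerForm P z ≠ 0) :
    ∃ Q : ℂ → A, ContDiff ℝ n Q ∧ (∀ z, IsRankOne τ (Q z)) ∧
      ∀ z, lowerForm P z ≠ 0 → Q z = lineProj τ (lowerForm P z) := by
  have hloc : ∀ z₁, ∃ Z : ℂ → A, ContDiffAt ℝ n Z z₁ ∧
      ∀ᶠ z in 𝓝 z₁, Z z ≠ 0 ∧ Z z * P z = Z z ∧ ∃ c : ℂ, lowerForm P z = c • Z z := by
    intro z₁
    refine ((h.lowerForm_local hτ hn hPn hSn z₁).resolve_left fun h0 => ?_).2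
    have := (h0.filter_mono nhdsWithin_le_nhds).and (h.lowerForm_ne_zero hτ hW z₁)
    exact this.exists.elim fun w hw => hw.2 hw.1
  choose Z hZn hZ using hloc
  have hspec : ∀ z, lowerForm P z ≠ 0 → ∀ x : A, (∃ c : ℂ, lowerForm P z = c • x) →
      lineProj τ x = lineProj τ (lowerForm P z) := by
    rintro z h0 x ⟨c, hc⟩
    have hc0 : c ≠ 0 := by rintro rfl; exact h0 (by rw [hc, zero_smul])
    rw [hc, lineProj_smul hc0]
  -- Off the zeros of W every admissible Z spans the line of W, so the diagonal choice coincides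
  -- near z₁ with the smooth `Z z₁`.
  refine ⟨fun z => lineProj τ (Z z z), ?_, ?_, ?_⟩
  · rw [contDiff_iff_contDiffAt]
    intro z₁
    have h1 := contDiffAt_lineProj (τ := τ) (hZn z₁) (hτ.ne_zero (hZ z₁).self_of_nhds.1)
    refine h1.congr_of_eventuallyEq ?_
    have h2 := h.lowerForm_ne_zero hτ hW z₁
    rw [eventually_nhdsWithin_iff] at h2
    filter_upwards [h2, hZ z₁] with w hw hw2
    by_cases hwz : w = z₁
    · rw [hwz]
    · rw [hspec w (hw hwz) _ (hZ w).self_of_nhds.2.2, hspec w (hw hwz) _ hw2.2.2]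
  · intro z
    exact isRankOne_lineProj hτ (h.rank z) (hZ z).self_of_nhds.2.1 (hZ z).self_of_nhds.1
  · intro z hz
    exact hspec z hz _ (hZ z).self_of_nhds.2.2

/-- Identities obtained by dividing by a function with isolated zeros extend to the zeros by
continuity. -/
theorem eq_of_eq_of_ne_zero {E F : Type*} [TopologicalSpace E] [T2Space E] [Zero F] {f g : ℂ → E}
    {u : ℂ → F} (hf : Continuous f) (hg : Continuous g) (hu : ∀ z, ∀ᶠ w in 𝓝[≠] z, u w ≠ 0)
    (h : ∀ z, u z ≠ 0 → f z = g z) (z : ℂ) : f z = g z :=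
  tendsto_nhds_unique_of_eventuallyEq (l := 𝓝[≠] z)
    (hf.continuousAt.tendsto.mono_left nhdsWithin_le_nhds)
    (hg.continuousAt.tendsto.mono_left nhdsWithin_le_nhds) ((hu z).mono h)

/-- The raising operator maps flag pairs to flag pairs. -/
theorem IsFlagPair.raise (hτ : IsFaithfulTrace τ) {Q S Y : ℂ → A} (h : IsFlagPair τ Q S)
    (cY : ContDiff ℝ 2 Y) (rY : ∀ z, IsRankOne τ (Y z))
    (hY : ∀ z, raiseForm Q z * star (raiseForm Q z) =
      τ (raiseForm Q z * star (raiseForm Q z)) • Y z)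
    (hV : ∀ z, ∀ᶠ w in 𝓝[≠] z, raiseForm Q w ≠ 0) :
    IsFlagPair τ Y (fun z => S z + Q z) ∧ ∀ z, lowerForm Y z = -star (raiseForm Q z) := by
  have hr := h.isHarmonic
  have hSd : Differentiable ℝ S := h.contDiff_pot.differentiable (by norm_num)
  have hYd : Differentiable ℝ Y := cY.differentiable (by norm_num)
  have hSQ : ∀ z, S z * Q z = 0 := fun z => by
    have := congrArg star (h.flag z).2
    rwa [star_mul, h.herm_pot, hr.herm, star_zero] at this
  have hne : ∀ z, raiseForm Q z ≠ 0 → τ (raiseForm Q z * star (raiseForm Q z)) ≠ 0 := fun z hz => by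
    rw [hτ.comm]; exact hτ.ne_zero hz
  have hvv : ∀ z, star (raiseForm Q z) * raiseForm Q z =
      τ (raiseForm Q z * star (raiseForm Q z)) • Q z := fun z => by
    rw [hτ.comm (raiseForm Q z)]; exact (hr.rank z).star_mul_self (hr.V_P z)
  have hSV : ∀ z, S z * raiseForm Q z = 0 := by
    intro z
    have : dz (fun w => S w * Q w) z = dz (fun _ => (0 : A)) z :=
      dz_congr (Filter.Eventually.of_forall hSQ)
    rw [dz_mul (hSd z) (hr.diff z), dz_const, h.dz_pot, neg_mul, hr.sW_P, neg_zero, zero_add]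
      at this
    rw [raiseForm, ← mul_assoc, this, zero_mul]
  have hS'Y : ∀ z, (S z + Q z) * Y z = 0 := by
    refine eq_of_eq_of_ne_zero ((h.contDiff_pot.add h.contDiff).mul cY).continuous
      continuous_const hV fun z hz => ?_
    have e : (S z + Q z) * (raiseForm Q z * star (raiseForm Q z)) = 0 := by
      rw [← mul_assoc, add_mul, hSV, hr.P_V, add_zero, zero_mul]
    rw [hY, mul_smul_comm] at e
    exact (smul_eq_zero.mp e).resolve_left (hne z hz)
  have hQY : ∀ z, Q z * Y z = 0 := by
    intro z
    have := congrArg (fun y => Q z * y) (hS'Y z)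
    simpa [← mul_assoc, mul_add, (h.flag z).2, hr.idem] using this
  have hYQ : ∀ z, Y z * Q z = 0 := fun z => by
    have := congrArg star (hQY z)
    rwa [star_mul, hr.herm, (rY z).herm, star_zero] at this
  have hYV : ∀ z, Y z * raiseForm Q z = raiseForm Q z := by
    refine eq_of_eq_of_ne_zero (cY.continuous.mul hr.diff_raiseForm.continuous)
      hr.diff_raiseForm.continuous hV fun z hz => ?_
    refine smul_right_injective _ (hne z hz) ?_
    change _ • _ = _ • _
    rw [← smul_mul_assoc, ← hY, mul_assoc, hvv, mul_smul_comm, hr.V_P]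
  -- Apply ∂₋ to YV = V: with ∂₋V = VV* − V*V this leaves ∂₋Y V = −V*V. Multiply by V* and divide by
  -- τ(VV*). Then ∂₋(S + Q) = V* is minus the lowering form of Y.
  have hlow : ∀ z, lowerForm Y z = -star (raiseForm Q z) := by
    have c1 : Continuous (lowerForm Y) :=
      (contDiff_lowerForm (m := 1) cY (by norm_num)).continuous
    refine eq_of_eq_of_ne_zero c1 hr.diff_raiseForm.continuous.star.neg hV fun z hz => ?_
    have e1 : dzb (fun w => Y w * raiseForm Q w) z = dzb (raiseForm Q) z :=
      dzb_congr (Filter.Eventually.of_forall hYV)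
    have e0 : Y z * star (raiseForm Q z) = 0 := by
      rw [← hr.P_sV, ← mul_assoc, hYQ, zero_mul]
    rw [dzb_mul (hYd z) (hr.diff_raiseForm z), hr.dzb_raiseForm, mul_sub, ← mul_assoc (Y z), hYV,
      ← mul_assoc (Y z), e0, zero_mul, sub_zero] at e1
    have e2 : dzb Y z * raiseForm Q z = -(star (raiseForm Q z) * raiseForm Q z) := by
      have := sub_eq_zero.mpr e1
      rw [← sub_eq_zero, ← this]; abel
    refine smul_right_injective _ (hne z hz) ?_
    change _ • _ = _ • _
    rw [lowerForm, ← mul_smul_comm, ← hY, ← mul_assoc, e2, hvv, neg_mul, smul_mul_assoc, hr.P_sV,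
      smul_neg]
  refine ⟨⟨⟨cY, rY, h.contDiff_pot.add h.contDiff, fun z => ?_, fun z => ?_⟩, fun z => ⟨?_, ?_⟩⟩,
    hlow⟩
  · rw [star_add, h.herm_pot, hr.herm]
  · rw [hlow, dzb_add (hSd z) (hr.diff z), h.dzb_pot, hr.dzb_eq]; abel
  · simp only [mul_add, add_mul, (h.flag z).1, (h.flag z).2, hSQ, hr.idem]; simp
  · have := congrArg star (hS'Y z)
    rwa [star_mul, star_add, h.herm_pot, hr.herm, (rY z).herm, star_zero] at this

theorem lowerForm_comp_conj (P : ℂ → A) (z : ℂ) :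
    lowerForm (fun w => P (starRingEnd ℂ w)) z = raiseForm P (starRingEnd ℂ z) := by
  rw [lowerForm, raiseForm, dzb_comp_conj]

theorem raiseForm_comp_conj (P : ℂ → A) (z : ℂ) :
    raiseForm (fun w => P (starRingEnd ℂ w)) z = lowerForm P (starRingEnd ℂ z) := by
  rw [lowerForm, raiseForm, dz_comp_conj]

/-- Reflecting the plane exchanges the flag below `P` with the one above `P`. -/
theorem IsFlagPair.reflect {P S : ℂ → A} (h : IsFlagPair τ P S) :
    IsFlagPair τ (fun z => P (starRingEnd ℂ z))
      (fun z => 1 - S (starRingEnd ℂ z) - P (starRingEnd ℂ z)) := by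
  have hr := h.isHarmonic
  have hSd : Differentiable ℝ S := h.contDiff_pot.differentiable (by norm_num)
  have hc : ContDiff ℝ 2 (starRingEnd ℂ) := Complex.conjCLE.contDiff
  have hSP : ∀ z, S z * P z = 0 := fun z => by
    have := congrArg star (h.flag z).2
    rwa [star_mul, h.herm_pot, hr.herm, star_zero] at this
  refine ⟨⟨h.contDiff.comp hc, fun z => h.rank _,
    (contDiff_const.sub (h.contDiff_pot.comp hc)).sub (h.contDiff.comp hc), fun z => ?_,
    fun z => ?_⟩, fun z => ⟨?_, ?_⟩⟩
  · simp only [star_sub, star_one, h.herm_pot, hr.herm]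
  · rw [dzb_comp_conj (fun w => 1 - S w - P w), lowerForm_comp_conj]
    rw [dz_sub (f := fun w => 1 - S w) ((differentiableAt_const _).sub (hSd _)) (hr.diff _),
      dz_sub (differentiableAt_const _) (hSd _), dz_const, h.dz_pot, hr.dz_eq]
    abel
  · simp only [mul_sub, sub_mul, mul_one, one_mul, (h.flag _).1, (h.flag _).2, hSP, hr.idem]
    abel
  · simp only [mul_sub, mul_one, (h.flag _).2, hr.idem]; simp

theorem eventually_nhdsNE_conj {p : ℂ → Prop} (h : ∀ z, ∀ᶠ w in 𝓝[≠] z, p w) (z : ℂ) :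
    ∀ᶠ w in 𝓝[≠] z, p (starRingEnd ℂ w) := by
  have h1 := h (starRingEnd ℂ z)
  rw [eventually_nhdsWithin_iff] at h1 ⊢
  filter_upwards [(tendsto_conj z).eventually h1] with w hw hwz
  exact hw fun he => hwz ((starRingEnd ℂ).injective he)

theorem IsFlagPair.raiseForm_ne_zero (hτ : IsFaithfulTrace τ) {P S : ℂ → A} (h : IsFlagPair τ P S)
    (hV : ∃ z, raiseForm P z ≠ 0) (z : ℂ) : ∀ᶠ w in 𝓝[≠] z, raiseForm P w ≠ 0 := by
  obtain ⟨w, hw⟩ := hV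
  have := eventually_nhdsNE_conj (h.reflect.lowerForm_ne_zero hτ
    ⟨starRingEnd ℂ w, by rwa [lowerForm_comp_conj, Complex.conj_conj]⟩) z
  simpa only [lowerForm_comp_conj, Complex.conj_conj] using this

/-- The lowering operator maps flag pairs to flag pairs. -/
theorem IsFlagPair.lower (hτ : IsFaithfulTrace τ) {P S Y : ℂ → A} (h : IsFlagPair τ P S)
    (cY : ContDiff ℝ 2 Y) (rY : ∀ z, IsRankOne τ (Y z))
    (hY : ∀ z, lowerForm P z * star (lowerForm P z) =
      τ (lowerForm P z * star (lowerForm P z)) • Y z)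
    (hW : ∀ z, ∀ᶠ w in 𝓝[≠] z, lowerForm P w ≠ 0) :
    IsFlagPair τ Y (fun z => S z - Y z) ∧ ∀ z, raiseForm Y z = -star (lowerForm P z) := by
  have hc : ContDiff ℝ 2 (starRingEnd ℂ) := Complex.conjCLE.contDiff
  -- Lowering is raising of the reflected pair, whose potential is 1 − S − P. Raising makes it 1 −
  -- S, and reflecting back yields S − Y.
  obtain ⟨h1, h2⟩ := h.reflect.raise hτ (Y := fun z => Y (starRingEnd ℂ z)) (cY.comp hc)
    (fun z => rY _) (fun z => by rw [raiseForm_comp_conj]; exact hY _)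
    (fun z => by
      simp only [raiseForm_comp_conj]; exact eventually_nhdsNE_conj hW z)
  refine ⟨?_, fun z => ?_⟩
  · convert h1.reflect using 2 with z z
    · rw [Complex.conj_conj]
    · simp only [Complex.conj_conj]; abel
  · have := h2 (starRingEnd ℂ z)
    rwa [lowerForm_comp_conj, raiseForm_comp_conj, Complex.conj_conj] at this

end FlagPairs

/-! ### Chain forms, their ∂₊-derivatives, and isotropy. -/

section Chain

variable {A : Type*} [CStarAlgebra A] {τ : A →L[ℂ] ℂ}

/-- The iterated covariant `∂₋`-derivatives of the lowering form. -/
def chain (P : ℂ → A) : ℕ → ℂ → A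
  | 0 => lowerForm P
  | b + 1 => fun z => (1 - P z) * dzb (chain P b) z * P z

theorem contDiff_chain {P : ℂ → A} (b : ℕ) : ∀ m : ℕ, ContDiff ℝ ((m + b + 1 : ℕ) : WithTop ℕ∞) P →
    ContDiff ℝ (m : WithTop ℕ∞) (chain P b) := by
  induction b with
  | zero =>
    intro m hP
    exact contDiff_lowerForm hP (by norm_cast)
  | succ b ih =>
    intro m hP
    have h1 : ContDiff ℝ ((m + 1 : ℕ) : WithTop ℕ∞) (chain P b) :=
      ih (m + 1) (by convert hP using 2; omega)
    have h2 : ContDiff ℝ (m : WithTop ℕ∞) P := hP.of_le (by norm_cast; omega)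
    exact ((contDiff_const.sub h2).mul (contDiff_dzb h1 (by norm_cast))).mul h2

theorem IsHarmonic.proj_mul_chain {P : ℂ → A} (h : IsHarmonic τ P) (b : ℕ) (z : ℂ) :
    P z * chain P b z = 0 := by
  cases b with
  | zero => exact h.P_W z
  | succ b =>
    have : P z * (1 - P z) = 0 := by rw [mul_sub, mul_one, h.idem, sub_self]
    rw [chain, ← mul_assoc, ← mul_assoc, this, zero_mul, zero_mul]

theorem IsHarmonic.chain_mul_proj {P : ℂ → A} (h : IsHarmonic τ P) (b : ℕ) (z : ℂ) :
    chain P b z * P z = chain P b z := by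
  cases b with
  | zero => exact h.W_P z
  | succ b => rw [chain, mul_assoc, h.idem]

/-- The covariant derivatives of a form with values in `Hom(range P, ker P)`. -/
theorem IsHarmonic.covariant_deriv {P : ℂ → A} (h : IsHarmonic τ P) {ω : ℂ → A} {z : ℂ}
    (hω : DifferentiableAt ℝ ω z) (h1 : ∀ w, P w * ω w = 0) (h2 : ∀ w, ω w * P w = ω w) :
    (1 - P z) * dzb ω z * P z =
      dzb ω z + star (raiseForm P z) * ω z - ω z * star (raiseForm P z) ∧
    (1 - P z) * dz ω z * P z =
      dz ω z + star (lowerForm P z) * ω z - ω z * star (lowerForm P z) := by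
  have hWω : lowerForm P z * ω z = 0 := by rw [← h.W_P, mul_assoc, h1, mul_zero]
  have hVω : raiseForm P z * ω z = 0 := by rw [← h.V_P, mul_assoc, h1, mul_zero]
  have hωW : ω z * lowerForm P z = 0 := by rw [← h2, mul_assoc, h.P_W, mul_zero]
  have hωV : ω z * raiseForm P z = 0 := by rw [← h2, mul_assoc, h.P_V, mul_zero]
  constructor
  · have e1 : dzb (fun w => P w * ω w) z = dzb (fun _ => (0 : A)) z :=
      dzb_congr (Filter.Eventually.of_forall h1)
    have e2 : dzb (fun w => ω w * P w) z = dzb ω z :=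
      dzb_congr (Filter.Eventually.of_forall h2)
    rw [dzb_mul (h.diff z) hω, dzb_const, h.dzb_eq, add_mul, hWω, zero_add] at e1
    rw [dzb_mul hω (h.diff z), h.dzb_eq, mul_add, hωW, zero_add] at e2
    have e3 : P z * dzb ω z = -(star (raiseForm P z) * ω z) := eq_neg_of_add_eq_zero_right e1
    have e4 : dzb ω z * P z = dzb ω z - ω z * star (raiseForm P z) := eq_sub_of_add_eq e2
    rw [sub_mul, one_mul, e3, sub_neg_eq_add, add_mul, e4, mul_assoc, h2]
    abel
  · have e1 : dz (fun w => P w * ω w) z = dz (fun _ => (0 : A)) z :=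
      dz_congr (Filter.Eventually.of_forall h1)
    have e2 : dz (fun w => ω w * P w) z = dz ω z :=
      dz_congr (Filter.Eventually.of_forall h2)
    rw [dz_mul (h.diff z) hω, dz_const, h.dz_eq, add_mul, hVω, zero_add] at e1
    rw [dz_mul hω (h.diff z), h.dz_eq, mul_add, hωV, zero_add] at e2
    have e3 : P z * dz ω z = -(star (lowerForm P z) * ω z) := eq_neg_of_add_eq_zero_right e1
    have e4 : dz ω z * P z = dz ω z - ω z * star (lowerForm P z) := eq_sub_of_add_eq e2
    rw [sub_mul, one_mul, e3, sub_neg_eq_add, add_mul, e4, mul_assoc, h2]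
    abel

theorem IsHarmonic.dzb_chain {P : ℂ → A} (h : IsHarmonic τ P) {b : ℕ} {z : ℂ}
    (hω : DifferentiableAt ℝ (chain P b) z) : dzb (chain P b) z =
      chain P (b + 1) z - star (raiseForm P z) * chain P b z +
        chain P b z * star (raiseForm P z) := by
  have := (h.covariant_deriv hω (h.proj_mul_chain b) (h.chain_mul_proj b)).1
  change _ = (1 - P z) * dzb (chain P b) z * P z - _ + _
  rw [this]; abel

/-- The `∂₊`-derivative of the `b`-th chain form is, up to the connection, a combination of the
previous ones with coefficients of class `C^m`. -/
def HasChainExpansion (P : ℂ → A) (b m : ℕ) : Prop :=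
  ∃ c : ℕ → ℂ → ℂ, (∀ j, ContDiff ℝ (m : WithTop ℕ∞) (c j)) ∧ ∀ z,
    dz (chain P b) z = ∑ j ∈ Finset.range b, c j z • chain P j z -
      star (lowerForm P z) * chain P b z + chain P b z * star (lowerForm P z)

theorem IsHarmonic.hasChainExpansion_zero {P : ℂ → A} (h : IsHarmonic τ P) (m : ℕ) :
    HasChainExpansion P 0 m := by
  refine ⟨fun _ _ => 0, fun _ => contDiff_const, fun z => ?_⟩
  change dz (lowerForm P) z = _ - star (lowerForm P z) * lowerForm P z +
    lowerForm P z * star (lowerForm P z)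
  rw [h.dz_lowerForm]; simp; abel

/-- Commute the covariant derivatives: ∂₊∂₋ω_b equals ∂₋∂₊ω_b plus curvature. The first term
differentiates the expansion of ω_b. The curvature enters through WW*ω, ωW*W and ωV*V, which rank
one reduces to a multiple of W and multiples of ω. One derivative of the coefficients is lost. -/
theorem IsHarmonic.hasChainExpansion_succ {P : ℂ → A} (h : IsHarmonic τ P) {b m : ℕ}
    (hP : ContDiff ℝ ((m + b + 3 : ℕ) : WithTop ℕ∞) P)
    (hb : HasChainExpansion P b (m + 1))
    (hiso : ∀ z, star (raiseForm P z) * chain P b z = 0) : HasChainExpansion P (b + 1) m := by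
  obtain ⟨c, hc, hexp⟩ := hb
  have hω2 : ContDiff ℝ 2 (chain P b) :=
    (contDiff_chain b (m + 2) (by convert hP using 2; omega)).of_le (by norm_cast; omega)
  have hωd : ∀ j ≤ b + 1, Differentiable ℝ (chain P j) := fun j hj =>
    (contDiff_chain j 1 (hP.of_le (by norm_cast; omega))).differentiable (by norm_num)
  have hcd : ∀ j, Differentiable ℝ (c j) := fun j =>
    (hc j).differentiable (by norm_cast)
  have hP1 : ContDiff ℝ ((m + 1 : ℕ) : WithTop ℕ∞) P := hP.of_le (by norm_cast; omega)
  set t : ℂ → ℂ := fun z => τ (star (lowerForm P z) * chain P b z) with ht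
  set s : ℂ → ℂ := fun z => τ (star (raiseForm P z) * raiseForm P z) -
    τ (star (lowerForm P z) * lowerForm P z) with hs
  have hVm : ContDiff ℝ (m : WithTop ℕ∞) (raiseForm P) := contDiff_raiseForm hP1 (by norm_cast)
  have hWm : ContDiff ℝ (m : WithTop ℕ∞) (lowerForm P) := contDiff_lowerForm hP1 (by norm_cast)
  have hωm : ContDiff ℝ (m : WithTop ℕ∞) (chain P b) :=
    contDiff_chain b m (hP.of_le (by norm_cast; omega))
  have htm : ContDiff ℝ (m : WithTop ℕ∞) t := clm_contDiff τ ((contDiff_star hWm).mul hωm)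
  have hsm : ContDiff ℝ (m : WithTop ℕ∞) s :=
    (clm_contDiff τ ((contDiff_star hVm).mul hVm)).sub
      (clm_contDiff τ ((contDiff_star hWm).mul hWm))
  -- By the Leibniz rule c_j contributes ∂₋c_j at index j and itself at index j + 1. The curvature
  -- adds −t at index 0, since W = ω₀, and s at index b.
  refine ⟨fun j z => (if j < b then dzb (c j) z else 0) +
    (match j with | 0 => -t z | j + 1 => c j z) + (if j = b then s z else 0), ?_, ?_⟩
  · intro j
    refine (ContDiff.add ?_ ?_).add ?_
    · split_ifs
      · exact contDiff_dzb (hc j) (by norm_cast)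
      · exact contDiff_const
    · cases j with
      | zero => exact htm.neg
      | succ j => exact (hc j).of_le (by norm_cast; omega)
    · split_ifs
      · exact hsm
      · exact contDiff_const
  · intro z
    have hcov := (h.covariant_deriv (hωd (b + 1) le_rfl z) (h.proj_mul_chain (b + 1))
      (h.chain_mul_proj (b + 1))).2
    suffices hD : (1 - P z) * dz (chain P (b + 1)) z * P z =
        ∑ j ∈ Finset.range (b + 1), ((if j < b then dzb (c j) z else 0) +
          (match j with | 0 => -t z | j + 1 => c j z) + (if j = b then s z else 0)) •
            chain P j z by
      rw [hD] at hcov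
      rw [hcov]; abel
    have hsum : ∑ j ∈ Finset.range (b + 1), ((if j < b then dzb (c j) z else 0) +
          (match j with | 0 => -t z | j + 1 => c j z) + (if j = b then s z else 0)) •
            chain P j z =
        ∑ j ∈ Finset.range b, (dzb (c j) z • chain P j z + c j z • chain P (j + 1) z)
          - t z • lowerForm P z + s z • chain P b z := by
      simp only [add_smul, Finset.sum_add_distrib]
      congr 1
      · rw [Finset.sum_range_succ]
        conv_lhs => enter [2]; rw [Finset.sum_range_succ']
        simp only [lt_irrefl, if_false, zero_smul, add_zero, neg_smul]
        have : ∑ j ∈ Finset.range b, (if j < b then dzb (c j) z else 0) • chain P j z =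
            ∑ j ∈ Finset.range b, dzb (c j) z • chain P j z :=
          Finset.sum_congr rfl fun j hj => by rw [if_pos (Finset.mem_range.mp hj)]
        rw [this]
        change _ + (_ + -(t z • lowerForm P z)) = _
        abel
      · simp [ite_smul]
    rw [hsum]
    -- Isotropy removes the term V*ω_b from the covariant derivative, so it never has to be
    -- differentiated.
    have hfun : ∀ᶠ w in 𝓝 z, chain P (b + 1) w =
        dzb (chain P b) w - chain P b w * star (raiseForm P w) :=
      Filter.Eventually.of_forall fun w => by
        rw [h.dzb_chain (hωd b (by omega) w), hiso]; abel
    have hdzbd : DifferentiableAt ℝ (dzb (chain P b)) z :=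
      (contDiff_dzb (m := 1) hω2 (by norm_num)).differentiable (by norm_num) z
    have hωb := hωd b (by omega) z
    have hWd := h.diff_lowerForm z
    have hVd := h.diff_raiseForm z
    have hdd : dz (dzb (chain P b)) z =
        ∑ j ∈ Finset.range b, (dzb (c j) z • chain P j z + c j z • dzb (chain P j) z) -
          (star (dz (lowerForm P) z) * chain P b z +
            star (lowerForm P z) * dzb (chain P b) z) +
          (dzb (chain P b) z * star (lowerForm P z) +
            chain P b z * star (dz (lowerForm P) z)) := by
      rw [dz_dzb_comm hω2, dzb_congr (Filter.Eventually.of_forall hexp)]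
      have hd1 : ∀ j ∈ Finset.range b, DifferentiableAt ℝ (fun w => c j w • chain P j w) z :=
        fun j hj => (hcd j z).smul (hωd j (by have := Finset.mem_range.mp hj; omega) z)
      have hd2 : DifferentiableAt ℝ (fun w => ∑ j ∈ Finset.range b, c j w • chain P j w) z :=
        DifferentiableAt.fun_sum hd1
      have hd3 : DifferentiableAt ℝ (fun w => star (lowerForm P w) * chain P b w) z :=
        hWd.star.mul hωb
      have hd4 : DifferentiableAt ℝ (fun w => chain P b w * star (lowerForm P w)) z :=
        hωb.mul hWd.star
      rw [dzb_add (f := fun w => ∑ j ∈ Finset.range b, c j w • chain P j w -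
        star (lowerForm P w) * chain P b w) (hd2.sub hd3) hd4, dzb_sub hd2 hd3, dzb_sum hd1,
        dzb_mul hWd.star hωb, dzb_mul hωb hWd.star, dzb_star]
      congr 2
      exact Finset.sum_congr rfl fun j hj =>
        dzb_smul (hcd j z) (hωd j (by have := Finset.mem_range.mp hj; omega) z)
    rw [dz_congr hfun, dz_sub (g := fun w => chain P b w * star (raiseForm P w)) hdzbd
      (hωb.mul hVd.star), dz_mul hωb hVd.star, dz_star, hdd,
      h.dz_lowerForm, h.dzb_raiseForm]
    set p := P z
    set W := lowerForm P z
    set V := raiseForm P z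
    set ω := chain P b z
    have hp : (1 - p) * p = 0 := by rw [sub_mul, one_mul, h.idem, sub_self]
    have hsW : (1 - p) * star W = 0 := by rw [← h.P_sW, ← mul_assoc, hp, zero_mul]
    have hqW : (1 - p) * W = W := by rw [sub_mul, one_mul, h.P_W, sub_zero]
    have hqω : (1 - p) * ω = ω := by rw [sub_mul, one_mul, h.proj_mul_chain, sub_zero]
    have hωp : ω * p = ω := h.chain_mul_proj b z
    have hsWp : star W * p = 0 := h.sW_P z
    have hsVp : star V * p = 0 := h.sV_P z
    have hωW : ω * W = 0 := by rw [← hωp, mul_assoc, h.P_W, mul_zero]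
    have hωV : ω * V = 0 := by rw [← hωp, mul_assoc, h.P_V, mul_zero]
    have hWp : W * p = W := h.W_P z
    have hVp : V * p = V := h.V_P z
    have hsum2 : ∀ j ∈ Finset.range b, (1 - p) * (dzb (c j) z • chain P j z +
        c j z • dzb (chain P j) z) * p =
          dzb (c j) z • chain P j z + c j z • chain P (j + 1) z := by
      intro j _
      have e1 : (1 - p) * chain P j z * p = chain P j z := by
        rw [sub_mul, one_mul, h.proj_mul_chain, sub_zero, h.chain_mul_proj]
      rw [mul_add, add_mul, mul_smul_comm, mul_smul_comm, smul_mul_assoc, smul_mul_assoc, e1]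
      rfl
    have hWω : W * (star W * ω) = t z • W := by
      have e := (h.rank z).sandwich (star W * ω)
      have e' : p * (star W * ω) * p = star W * ω := by
        rw [mul_assoc, mul_assoc, hωp, ← mul_assoc, h.P_sW]
      rw [e', mul_assoc, hωp] at e
      rw [e, mul_smul_comm, hWp]
    have hWW : ω * (star W * W) = τ (star W * W) • ω := by
      rw [(h.rank z).star_mul_self hWp, mul_smul_comm, hωp, map_smul, (h.rank z).trace_one,
        smul_eq_mul, mul_one]
    have hVV : ω * (star V * V) = τ (star V * V) • ω := by
      rw [(h.rank z).star_mul_self hVp, mul_smul_comm, hωp, map_smul, (h.rank z).trace_one,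
        smul_eq_mul, mul_one]
    have hstar1 : star (W * star W - star W * W) = W * star W - star W * W := by
      simp [star_sub, star_mul]
    have hstar2 : star (V * star V - star V * V) = V * star V - star V * V := by
      simp [star_sub, star_mul]
    rw [hstar1, hstar2, ← Finset.sum_congr rfl hsum2, ← Finset.sum_mul, ← Finset.mul_sum]
    have f1 : (1 - p) * ((W * star W - star W * W) * ω + star W * dzb (chain P b) z) * p =
        t z • W := by
      rw [mul_add, ← mul_assoc (1 - p) (star W), hsW, zero_mul, add_zero, ← mul_assoc, mul_sub,
        ← mul_assoc (1 - p) W, hqW, ← mul_assoc (1 - p) (star W), hsW, zero_mul, sub_zero,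
        mul_assoc, hωp, mul_assoc, hWω]
    have f2 : (1 - p) * (dzb (chain P b) z * star W + ω * (W * star W - star W * W)) * p =
        -(τ (star W * W) • ω) := by
      rw [mul_add, add_mul, mul_assoc, mul_assoc (dzb (chain P b) z), hsWp, mul_zero, mul_zero,
        zero_add, mul_sub, ← mul_assoc ω W, hωW, zero_mul, zero_sub, hWW, mul_neg, neg_mul,
        mul_smul_comm, hqω, smul_mul_assoc, hωp]
    have f3 : (1 - p) * (dz (chain P b) z * star V + ω * (V * star V - star V * V)) * p =
        -(τ (star V * V) • ω) := by
      rw [mul_add, add_mul, mul_assoc, mul_assoc (dz (chain P b) z), hsVp, mul_zero, mul_zero,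
        zero_add, mul_sub, ← mul_assoc ω V, hωV, zero_mul, zero_sub, hVV, mul_neg, neg_mul,
        mul_smul_comm, hqω, smul_mul_assoc, hωp]
    rw [mul_sub (1 - p), mul_add (1 - p), mul_sub (1 - p), sub_mul _ _ p, add_mul _ _ p,
      sub_mul _ _ p, f1, f2, f3]
    simp only [hs, sub_smul]
    abel

/-- Each ∂₋ becomes conj(−w²) ∂₋ in the coordinate w = 1/z, so the chain forms stay regular at
infinity. `Ω` retains these factors and is not the chain form of `R`. -/
theorem exists_chain_at_infinity {P R : ℂ → A} (hPR : ∀ z, z ≠ 0 → P z = R z⁻¹) (b : ℕ) :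
    ∀ m : ℕ, ContDiff ℝ ((m + b + 1 : ℕ) : WithTop ℕ∞) R →
      ∃ Ω : ℂ → A, ContDiff ℝ (m : WithTop ℕ∞) Ω ∧ ∀ z, z ≠ 0 → chain P b z = Ω z⁻¹ := by
  have hconj : ∀ m : ℕ, ContDiff ℝ (m : WithTop ℕ∞) fun w : ℂ => starRingEnd ℂ (-(w ^ 2)) :=
    fun m => Complex.conjCLE.contDiff.comp (contDiff_id.pow 2).neg
  have key : ∀ (f g : ℂ → A) (z : ℂ), z ≠ 0 → (∀ w, w ≠ 0 → f w = g w⁻¹) →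
      DifferentiableAt ℝ g z⁻¹ →
      dzb f z = starRingEnd ℂ (-(z⁻¹ ^ 2)) • dzb g z⁻¹ := by
    intro f g z hz hfg hg
    rw [← (dz_comp_inv hz hg).2]
    refine dzb_congr ?_
    filter_upwards [isOpen_ne.mem_nhds hz] with w hw using hfg w hw
  induction b with
  | zero =>
    intro m hR
    refine ⟨fun w => (starRingEnd ℂ (-(w ^ 2)) • dzb R w) * R w, ?_, fun z hz => ?_⟩
    · exact ((hconj m).smul (contDiff_dzb hR (by norm_cast))).mul
        (hR.of_le (by norm_cast; omega))
    · have hd : Differentiable ℝ R := hR.differentiable (by norm_cast)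
      change dzb P z * P z = _
      rw [key P R z hz hPR (hd _), hPR z hz]
  | succ b ih =>
    intro m hR
    obtain ⟨Ω, hΩ, hchain⟩ := ih (m + 1) (by convert hR using 2; omega)
    have hRm : ContDiff ℝ (m : WithTop ℕ∞) R := hR.of_le (by norm_cast; omega)
    refine ⟨fun w => (1 - R w) * (starRingEnd ℂ (-(w ^ 2)) • dzb Ω w) * R w, ?_, fun z hz => ?_⟩
    · exact ((contDiff_const.sub hRm).mul
        ((hconj m).smul (contDiff_dzb hΩ (by norm_cast)))).mul hRm
    · have hd : Differentiable ℝ Ω := hΩ.differentiable (by norm_cast)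
      change (1 - P z) * dzb (chain P b) z * P z = _
      rw [key _ Ω z hz hchain (hd _), hPR z hz]

/-- An antiholomorphic function on the plane vanishing at infinity is zero. -/
theorem eq_zero_of_dz_eq_zero {η θ : ℂ → ℂ} (hη : Differentiable ℝ η) (hdz : ∀ z, dz η z = 0)
    (hθ : ContinuousAt θ 0) (hθ0 : θ 0 = 0) (hηθ : ∀ z, z ≠ 0 → η z = θ z⁻¹) (z : ℂ) :
    η z = 0 := by
  -- Conjugating the variable gives an entire function tending to 0 at infinity, and Liouville
  -- applies.
  have hd : Differentiable ℂ (fun ζ => η (starRingEnd ℂ ζ)) := fun ζ =>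
    differentiableAt_complex_of_dzb_eq_zero
      ((hη _).comp ζ Complex.conjCLE.differentiableAt) (by rw [dzb_comp_conj, hdz])
  have ht : Filter.Tendsto (fun ζ => η (starRingEnd ℂ ζ)) (Filter.cocompact ℂ) (𝓝 0) := by
    have h1 : Filter.Tendsto (fun ζ : ℂ => θ (starRingEnd ℂ ζ)⁻¹) (Filter.cocompact ℂ) (𝓝 0) := by
      rw [← Metric.cobounded_eq_cocompact]
      have h2 : Filter.Tendsto (fun ζ : ℂ => starRingEnd ℂ ζ⁻¹) (Bornology.cobounded ℂ) (𝓝 0) := by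
        have := (tendsto_conj 0).comp (Filter.tendsto_inv₀_cobounded (α := ℂ))
        simpa [Function.comp_def] using this
      have h3 := hθ.tendsto.comp h2
      rw [hθ0] at h3
      simpa [Function.comp_def, map_inv₀] using h3
    refine h1.congr' ?_
    have : ∀ᶠ ζ : ℂ in Filter.cocompact ℂ, ζ ≠ 0 := by
      have := (isCompact_singleton (x := (0 : ℂ))).compl_mem_cocompact
      filter_upwards [this] with ζ hζ using hζ
    filter_upwards [this] with ζ hζ
    rw [hηθ _ (by simpa using hζ)]
  have := hd.apply_eq_of_tendsto_cocompact (starRingEnd ℂ z) ht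
  simpa using this

/-- The chain forms are orthogonal to the raising form. -/
theorem IsHarmonic.chain_isotropic (hτ : IsFaithfulTrace τ) {P R : ℂ → A} (h : IsHarmonic τ P)
    (hPR : ∀ z, z ≠ 0 → P z = R z⁻¹) {b m : ℕ}
    (hP : ContDiff ℝ ((b + 2 : ℕ) : WithTop ℕ∞) P) (hR : ContDiff ℝ ((b + 2 : ℕ) : WithTop ℕ∞) R)
    (hexp : HasChainExpansion P b m)
    (hiso : ∀ j < b, ∀ z, star (raiseForm P z) * chain P j z = 0) (z : ℂ) :
    star (raiseForm P z) * chain P b z = 0 := by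
  obtain ⟨c, -, hc⟩ := hexp
  have hωd : Differentiable ℝ (chain P b) :=
    (contDiff_chain b 1 (hP.of_le (by norm_cast; omega))).differentiable (by norm_num)
  set η : ℂ → ℂ := fun z => τ (star (raiseForm P z) * chain P b z) with hη
  have hprod : Differentiable ℝ fun z => star (raiseForm P z) * chain P b z :=
    fun z => (h.diff_raiseForm z).star.mul (hωd z)
  have hηd : Differentiable ℝ η := fun z => clm_differentiableAt τ (hprod z)
  -- The earlier chain forms are annihilated by V*. In the remaining terms cyclicity of τ brings
  -- together ωV = 0 and W*V* = (VW)* = 0.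
  have hη0 : ∀ z, dz η z = 0 := by
    intro z
    rw [hη, dz_clm τ (hprod z), dz_mul (h.diff_raiseForm z).star (hωd z), dz_star,
      h.dzb_raiseForm, hc]
    set p := P z
    set W := lowerForm P z
    set V := raiseForm P z
    set ω := chain P b z
    have hωp : ω * p = ω := h.chain_mul_proj b z
    have hWp : W * p = W := h.W_P z
    have hVp : V * p = V := h.V_P z
    have hVω : V * ω = 0 := by rw [← hVp, mul_assoc, h.proj_mul_chain, mul_zero]
    have hωV : ω * V = 0 := by rw [← hωp, mul_assoc, h.P_V, mul_zero]
    have hWV : V * W = 0 := by rw [← hVp, mul_assoc, h.P_W, mul_zero]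
    have hVW : W * V = 0 := by rw [← hWp, mul_assoc, h.P_V, mul_zero]
    have hsVW : star V * star W = 0 := by rw [← star_mul, hVW, star_zero]
    have hsWV : star W * star V = 0 := by rw [← star_mul, hWV, star_zero]
    have hsum : star V * ∑ j ∈ Finset.range b, c j z • chain P j z = 0 := by
      rw [Finset.mul_sum]
      refine Finset.sum_eq_zero fun j hj => ?_
      rw [mul_smul_comm, hiso j (Finset.mem_range.mp hj), smul_zero]
    have hstar2 : star (V * star V - star V * V) = V * star V - star V * V := by
      simp [star_sub, star_mul]
    have e1 : star V * (∑ j ∈ Finset.range b, c j z • chain P j z - star W * ω + ω * star W) =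
        star V * ω * star W := by
      rw [mul_add, mul_sub, hsum, ← mul_assoc, hsVW, zero_mul, sub_zero, zero_add, mul_assoc]
    have e2 : (V * star V - star V * V) * ω = V * (star V * ω) := by
      rw [sub_mul, mul_assoc, mul_assoc, hVω, mul_zero, sub_zero]
    rw [hstar2, e1, e2, map_add, hτ.comm V, mul_assoc (star V) ω V, hωV, mul_zero, map_zero,
      zero_add, hτ.comm (star V * ω), ← mul_assoc, hsWV, zero_mul, map_zero]
  obtain ⟨Ω, hΩ, hchain⟩ := exists_chain_at_infinity hPR b 0 (hR.of_le (by norm_cast; omega))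
  have hRd : Differentiable ℝ R := hR.differentiable (by norm_cast)
  have hRc : Continuous (dzb R) :=
    (contDiff_dzb (m := 0) hR (by norm_cast; omega)).continuous
  -- V* = P ∂₋P contributes the factor conj(−w²) in the coordinate w = 1/z while the chain form
  -- stays bounded, so η vanishes at infinity.
  have hη1 : η z = 0 := by
    refine eq_zero_of_dz_eq_zero hηd hη0
      (θ := fun w => τ (R w * (starRingEnd ℂ (-(w ^ 2)) • dzb R w) * Ω w)) ?_ (by simp) ?_ z
    · refine Continuous.continuousAt (τ.continuous.comp ((hRd.continuous.mul ?_).mul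
        hΩ.continuous))
      exact (Complex.continuous_conj.comp (continuous_id.pow 2).neg).smul hRc
    · intro w hw
      simp only [hη]
      rw [star_raiseForm h.herm, hchain w hw, hPR w hw]
      have : dzb P w = starRingEnd ℂ (-(w⁻¹ ^ 2)) • dzb R w⁻¹ := by
        rw [← (dz_comp_inv hw (hRd _)).2]
        refine dzb_congr ?_
        filter_upwards [isOpen_ne.mem_nhds hw] with v hv using hPR v hv
      rw [this]
  -- V*ω_b maps the line of P to itself, so it equals η P and vanishes with its trace.
  have e := (h.rank z).sandwich (star (raiseForm P z) * chain P b z)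
  have e' : P z * (star (raiseForm P z) * chain P b z) * P z =
      star (raiseForm P z) * chain P b z := by
    rw [mul_assoc, mul_assoc, h.chain_mul_proj, ← mul_assoc, h.P_sV]
  rw [e', mul_assoc, h.chain_mul_proj] at e
  rw [e]
  change η z • P z = 0
  rw [hη1, zero_smul]

/-- The two statements feed each other: isotropy at b gives the expansion at b + 1, and this gives
isotropy at b + 1. The quantifier over `m` inside the induction pays for the derivative lost at each
step. -/
theorem IsHarmonic.chain_expansion_and_isotropic (hτ : IsFaithfulTrace τ) {P R : ℂ → A}
    (h : IsHarmonic τ P) (hPR : ∀ z, z ≠ 0 → P z = R z⁻¹) (b : ℕ) : ∀ m : ℕ,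
    ContDiff ℝ ((m + b + 2 : ℕ) : WithTop ℕ∞) P → ContDiff ℝ ((m + b + 2 : ℕ) : WithTop ℕ∞) R →
    HasChainExpansion P b m ∧ ∀ j ≤ b, ∀ z, star (raiseForm P z) * chain P j z = 0 := by
  induction b with
  | zero =>
    intro m hP hR
    refine ⟨h.hasChainExpansion_zero m, fun j hj z => ?_⟩
    obtain rfl : j = 0 := by omega
    exact h.chain_isotropic hτ hPR (hP.of_le (by norm_cast; omega))
      (hR.of_le (by norm_cast; omega)) (h.hasChainExpansion_zero m) (by simp) z
  | succ b ih =>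
    intro m hP hR
    obtain ⟨h1, h2⟩ := ih (m + 1) (hP.of_le (by norm_cast; omega)) (hR.of_le (by norm_cast; omega))
    have h3 : HasChainExpansion P (b + 1) m :=
      h.hasChainExpansion_succ (hP.of_le (by norm_cast)) h1 (h2 b le_rfl)
    refine ⟨h3, fun j hj z => ?_⟩
    rcases Nat.lt_or_eq_of_le hj with hj | rfl
    · exact h2 j (by omega) z
    · exact h.chain_isotropic hτ hPR (hP.of_le (by norm_cast; omega))
        (hR.of_le (by norm_cast; omega)) h3 (fun j hj => h2 j (by omega)) z

end Chain

/-! ### Derivatives of matrix inverses and determinants. -/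

section MatrixCalculus

open scoped Matrix.Norms.L2Operator

variable {k : ℕ}

theorem differentiableAt_matrix {M : ℂ → Matrix (Fin k) (Fin k) ℂ} {z : ℂ}
    (h : ∀ i j, DifferentiableAt ℝ (fun w => M w i j) z) : DifferentiableAt ℝ M z := by
  have : M = fun w => ∑ i, ∑ j, M w i j • Matrix.single i j (1 : ℂ) := by
    funext w
    conv_lhs => rw [Matrix.matrix_eq_sum_single (M w)]
    simp [Matrix.smul_single]
  rw [this]
  exact DifferentiableAt.fun_sum fun i _ => DifferentiableAt.fun_sum fun j _ =>
    (h i j).smul (differentiableAt_const _)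

/-- The entry of a matrix as a continuous linear form. -/
def entryCLM (i j : Fin k) : Matrix (Fin k) (Fin k) ℂ →L[ℂ] ℂ :=
  LinearMap.toContinuousLinearMap (Matrix.entryLinearMap ℂ ℂ i j)

@[simp] theorem entryCLM_apply (i j : Fin k) (M : Matrix (Fin k) (Fin k) ℂ) :
    entryCLM i j M = M i j := rfl

theorem differentiableAt_inv_entry {M : ℂ → Matrix (Fin k) (Fin k) ℂ} {z : ℂ}
    (h : ∀ i j, DifferentiableAt ℝ (fun w => M w i j) z) (hz : (M z).det ≠ 0) (i j : Fin k) :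
    DifferentiableAt ℝ (fun w => (M w)⁻¹ i j) z := by
  have hu : IsUnit (M z) := (Matrix.isUnit_iff_isUnit_det _).mpr (isUnit_iff_ne_zero.mpr hz)
  have h1 : DifferentiableAt ℝ (fun w => Ring.inverse (M w)) z :=
    (differentiableAt_inverse hu).comp z (differentiableAt_matrix h)
  have h2 := clm_differentiableAt (entryCLM i j) h1
  simpa only [entryCLM_apply, ← Matrix.nonsing_inv_eq_ringInverse] using h2

end MatrixCalculus

theorem dz_det {k : ℕ} {M : ℂ → Matrix (Fin k) (Fin k) ℂ} {z : ℂ}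
    (h : ∀ i j, DifferentiableAt ℝ (fun w => M w i j) z) :
    DifferentiableAt ℝ (fun w => (M w).det) z ∧
    dz (fun w => (M w).det) z =
      ∑ j, ((M z).updateCol j fun i => dz (fun w => M w i j) z).det := by
  have hf : HasFDerivAt (fun w => (M w).det) (∑ σ : Equiv.Perm (Fin k), Equiv.Perm.sign σ •
      ∑ j, (∏ i ∈ Finset.univ.erase j, M z (σ i) i) • fderiv ℝ (fun w => M w (σ j) j) z) z := by
    simp only [Matrix.det_apply]
    refine HasFDerivAt.fun_sum fun σ _ => ?_
    have := HasFDerivAt.finsetProd (u := Finset.univ) (g := fun i w => M w (σ i) i)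
      (g' := fun i => fderiv ℝ (fun w => M w (σ i) i) z) (x := z)
      (fun i _ => (h (σ i) i).hasFDerivAt)
    exact this.const_smul (Equiv.Perm.sign σ : ℤ)
  refine ⟨hf.differentiableAt, ?_⟩
  have hv : ∀ v, fderiv ℝ (fun w => (M w).det) z v = ∑ j, ∑ σ : Equiv.Perm (Fin k),
      Equiv.Perm.sign σ •
      ((∏ i ∈ Finset.univ.erase j, M z (σ i) i) * fderiv ℝ (fun w => M w (σ j) j) z v) := by
    intro v
    rw [hf.fderiv, Finset.sum_comm]
    simp [Finset.smul_sum, Units.smul_def]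
  have hprod : ∀ (σ : Equiv.Perm (Fin k)) (j : Fin k) (v : Fin k → ℂ),
      ∏ i, (M z).updateCol j v (σ i) i = (∏ i ∈ Finset.univ.erase j, M z (σ i) i) * v (σ j) := by
    intro σ j v
    rw [← Finset.prod_erase_mul _ _ (Finset.mem_univ j)]
    congr 1
    · refine Finset.prod_congr rfl fun i hi => ?_
      rw [Matrix.updateCol_ne (Finset.ne_of_mem_erase hi)]
    · rw [Matrix.updateCol_self]
  rw [dz, hv, hv, Finset.smul_sum, ← Finset.sum_sub_distrib, Finset.smul_sum]
  refine Finset.sum_congr rfl fun j _ => ?_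
  rw [Matrix.det_apply, Finset.smul_sum, ← Finset.sum_sub_distrib, Finset.smul_sum]
  refine Finset.sum_congr rfl fun σ _ => ?_
  rw [hprod, dz]
  simp only [smul_eq_mul, Units.smul_def, zsmul_eq_mul]
  ring

/-- A matrix whose columns evolve in a strictly triangular way has constant determinant. -/
theorem dz_det_eq_zero {k : ℕ} {M : ℂ → Matrix (Fin k) (Fin k) ℂ} {z : ℂ}
    (h : ∀ i j, DifferentiableAt ℝ (fun w => M w i j) z) (c : Fin k → Fin k → ℂ)
    (hc : ∀ j, c j j = 0) (hM : ∀ i j, dz (fun w => M w i j) z = ∑ l, c j l • M z i l) :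
    dz (fun w => (M w).det) z = 0 := by
  rw [(dz_det h).2]
  refine Finset.sum_eq_zero fun j _ => ?_
  have : (fun i => dz (fun w => M w i j) z) = fun i => ∑ l, c j l • M z i l := by
    funext i; exact hM i j
  rw [this, Matrix.det_updateCol_sum, hc, zero_smul]

/-! ### Gram matrices and projections onto spans. -/

section Gram

variable {A : Type*} [CStarAlgebra A] {τ : A →L[ℂ] ℂ} {k : ℕ}

/-- The Gram matrix of a family with respect to the trace form. -/
def gramMat (τ : A →L[ℂ] ℂ) (x : Fin k → A) : Matrix (Fin k) (Fin k) ℂ :=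
  Matrix.of fun i j => τ (star (x i) * x j)

/-- The projection onto the sum of the ranges of a family of rank-one elements with common
source. -/
def spanProj (τ : A →L[ℂ] ℂ) (x : Fin k → A) : A :=
  ∑ i, ∑ j, ((gramMat τ x)⁻¹ i j) • (x i * star (x j))

theorem gramMat_mulVec (x : Fin k → A) (v : Fin k → ℂ) (i : Fin k) :
    (gramMat τ x *ᵥ v) i = τ (star (x i) * ∑ j, v j • x j) := by
  simp [gramMat, Matrix.mulVec, dotProduct, Finset.mul_sum, mul_comm]

theorem gramMat_det_ne_zero_iff (hτ : IsFaithfulTrace τ) (x : Fin k → A) :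
    (gramMat τ x).det ≠ 0 ↔ LinearIndependent ℂ x := by
  constructor
  · intro h
    rw [Fintype.linearIndependent_iff]
    intro g hg
    have : gramMat τ x *ᵥ g = 0 := by
      funext i; rw [gramMat_mulVec, hg, mul_zero, map_zero]; rfl
    exact congrFun (Matrix.eq_zero_of_mulVec_eq_zero h this)
  · intro h h0
    obtain ⟨v, hv, hv0⟩ := Matrix.exists_mulVec_eq_zero_iff.mpr h0
    have hy : ∑ j, v j • x j = 0 := by
      apply hτ.faithful
      conv_lhs => enter [2, 1]; rw [star_sum]
      rw [Finset.sum_mul, map_sum]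
      refine Finset.sum_eq_zero fun i _ => ?_
      have := congrFun hv0 i
      rw [gramMat_mulVec] at this
      rw [star_smul, smul_mul_assoc, map_smul, this]; simp
    exact hv (funext (Fintype.linearIndependent_iff.mp h v hy))

variable {p : A} {x : Fin k → A}

/-- With a common rank-one source p, each x_j* x_l is the Gram coefficient times p, so the inverse
Gram matrix cancels it. -/
theorem spanProj_mul (hp : IsRankOne τ p) (hxp : ∀ i, x i * p = x i)
    (hx : (gramMat τ x).det ≠ 0) (l : Fin k) : spanProj τ x * x l = x l := by
  have hmul : ∀ j, star (x j) * x l = gramMat τ x j l • p := by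
    intro j
    have hpx : p * star (x j) = star (x j) := by
      have := congrArg star (hxp j)
      rwa [star_mul, hp.herm] at this
    have e := hp.sandwich (star (x j) * x l)
    have e' : p * (star (x j) * x l) * p = star (x j) * x l := by
      rw [mul_assoc, mul_assoc, hxp, ← mul_assoc, hpx]
    rwa [e', mul_assoc, hxp] at e
  have hinv : (gramMat τ x)⁻¹ * gramMat τ x = 1 :=
    Matrix.nonsing_inv_mul _ (isUnit_iff_ne_zero.mpr hx)
  have h1 : spanProj τ x * x l = ∑ i, (∑ j, (gramMat τ x)⁻¹ i j * gramMat τ x j l) • x i := by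
    rw [spanProj, Finset.sum_mul]
    refine Finset.sum_congr rfl fun i _ => ?_
    rw [Finset.sum_mul, Finset.sum_smul]
    refine Finset.sum_congr rfl fun j _ => ?_
    rw [smul_mul_assoc, mul_assoc, hmul, mul_smul_comm, hxp, smul_smul]
  rw [h1]
  have h2 : ∀ i, ∑ j, (gramMat τ x)⁻¹ i j * gramMat τ x j l = (1 : Matrix _ _ ℂ) i l := by
    intro i; rw [← hinv, Matrix.mul_apply]
  simp [h2, Matrix.one_apply]

theorem star_spanProj (hτ : IsFaithfulTrace τ) (x : Fin k → A) :
    star (spanProj τ x) = spanProj τ x := by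
  have hG : (gramMat τ x)ᴴ = gramMat τ x := by
    ext i j
    simp only [gramMat, Matrix.conjTranspose_apply, Matrix.of_apply]
    rw [← hτ.map_star, star_mul, star_star]
  have hG' : ((gramMat τ x)⁻¹)ᴴ = (gramMat τ x)⁻¹ := by
    rw [Matrix.conjTranspose_nonsing_inv, hG]
  rw [spanProj, star_sum, Finset.sum_comm]
  simp only [star_sum]
  rw [Finset.sum_comm]
  conv_rhs => rw [Finset.sum_comm]
  refine Finset.sum_congr rfl fun i _ => Finset.sum_congr rfl fun j _ => ?_
  rw [star_smul, star_mul, star_star]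
  have : star ((gramMat τ x)⁻¹ j i) = (gramMat τ x)⁻¹ i j := by
    conv_rhs => rw [← hG', Matrix.conjTranspose_apply]
  rw [this]

theorem mul_spanProj {s : A} (h : ∀ i, s * x i = x i) : s * spanProj τ x = spanProj τ x := by
  simp only [spanProj, Finset.mul_sum, mul_smul_comm, ← mul_assoc, h]

theorem mul_spanProj_eq_zero {s : A} (h : ∀ i, s * x i = 0) : s * spanProj τ x = 0 := by
  simp [spanProj, Finset.mul_sum, ← mul_assoc, h]

theorem trace_spanProj (hτ : IsFaithfulTrace τ) (hx : (gramMat τ x).det ≠ 0) :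
    τ (spanProj τ x) = k := by
  have hinv : (gramMat τ x)⁻¹ * gramMat τ x = 1 :=
    Matrix.nonsing_inv_mul _ (isUnit_iff_ne_zero.mpr hx)
  have : τ (spanProj τ x) = ((gramMat τ x)⁻¹ * gramMat τ x).trace := by
    rw [spanProj, map_sum, Matrix.trace]
    refine Finset.sum_congr rfl fun i _ => ?_
    rw [Matrix.diag_apply, Matrix.mul_apply, map_sum]
    refine Finset.sum_congr rfl fun j _ => ?_
    rw [map_smul, hτ.comm]; rfl
  rw [this, hinv, Matrix.trace_one, Fintype.card_fin]

/-- s − t is then a projection of trace zero. -/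
theorem IsFaithfulTrace.eq_of_proj (hτ : IsFaithfulTrace τ) {s t : A} (hs : s * s = s)
    (hsh : star s = s) (ht : t * t = t) (hth : star t = t) (hst : s * t = t) (htr : τ s = τ t) :
    s = t := by
  have hts : t * s = t := by
    have := congrArg star hst
    rwa [star_mul, hsh, hth] at this
  rw [← sub_eq_zero]
  apply hτ.faithful
  have : star (s - t) * (s - t) = s - t := by
    rw [star_sub, hsh, hth]; simp [mul_sub, sub_mul, hs, hst, hts, ht]
  rw [this, map_sub, htr, sub_self]

end Gram

/-! ### The span of the chain forms as a potential. -/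

section Existence

variable {A : Type*} [CStarAlgebra A] {τ : A →L[ℂ] ℂ}

/-- An isotropic harmonic map whose chain forms have generic rank at most `k`. -/
structure IsIsotropic (τ : A →L[ℂ] ℂ) (P : ℂ → A) (k : ℕ) : Prop where
  harm : IsHarmonic τ P
  diff : ∀ j ≤ k, Differentiable ℝ (chain P j)
  expansion : ∀ j ≤ k, HasChainExpansion P j 0
  iso : ∀ j ≤ k, ∀ z, star (raiseForm P z) * chain P j z = 0
  dep : ∀ z, ¬LinearIndependent ℂ fun j : Fin (k + 1) => chain P j z

/-- The projection onto the span of the first `k` chain forms. -/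
def chainProj (τ : A →L[ℂ] ℂ) (P : ℂ → A) (k : ℕ) (z : ℂ) : A :=
  spanProj τ fun j : Fin k => chain P j z

/-- The first `k` chain forms are linearly independent at `z`. -/
def ChainIndep (τ : A →L[ℂ] ℂ) (P : ℂ → A) (k : ℕ) (z : ℂ) : Prop :=
  (gramMat τ fun j : Fin k => chain P j z).det ≠ 0

section

variable {P : ℂ → A} {k : ℕ} {z : ℂ}

theorem IsHarmonic.chainProj_idem (h : IsHarmonic τ P) (hz : ChainIndep τ P k z) :
    chainProj τ P k z * chainProj τ P k z = chainProj τ P k z :=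
  mul_spanProj fun l => spanProj_mul (h.rank z) (fun i => h.chain_mul_proj i z) hz l

theorem IsHarmonic.proj_mul_chainProj (h : IsHarmonic τ P) (k : ℕ) (z : ℂ) :
    P z * chainProj τ P k z = 0 :=
  mul_spanProj_eq_zero fun i => h.proj_mul_chain i z

theorem IsHarmonic.chainProj_mul_proj (hτ : IsFaithfulTrace τ) (h : IsHarmonic τ P) (k : ℕ)
    (z : ℂ) : chainProj τ P k z * P z = 0 := by
  have := congrArg star (h.proj_mul_chainProj k z)
  rwa [star_mul, h.herm, star_zero, chainProj, star_spanProj hτ] at this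

/-- The chain forms are linearly independent only as long as there is room for them. -/
theorem IsHarmonic.lt_of_chainIndep (hτ : IsFaithfulTrace τ) {N : ℕ} (hN : τ 1 = N)
    (h : IsHarmonic τ P) (hz : ChainIndep τ P k z) : k < N := by
  set t := chainProj τ P k z with ht
  have htt : t * t = t := h.chainProj_idem hz
  have hth : star t = t := star_spanProj hτ _
  -- 1 − t − P is a projection, so its trace N − k − 1 is nonnegative.
  have h1 : star (1 - t - P z) * (1 - t - P z) = 1 - t - P z := by
    rw [star_sub, star_sub, star_one, hth, h.herm]
    simp only [mul_sub, sub_mul, mul_one, one_mul, h.idem, h.proj_mul_chainProj k z,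
      h.chainProj_mul_proj hτ k z, ht]
    rw [← ht, htt]
    abel
  have h2 := hτ.nonneg (1 - t - P z)
  rw [h1, map_sub, map_sub, hN, (h.rank z).trace_one, ht, chainProj, trace_spanProj hτ hz] at h2
  have h3 : (0 : ℝ) ≤ N - k - 1 := by simpa using h2
  have h4 : (k : ℝ) + 1 ≤ N := by linarith
  exact_mod_cast h4

theorem IsIsotropic.differentiableAt_gram (h : IsIsotropic τ P k) (i j : Fin k) (z : ℂ) :
    DifferentiableAt ℝ (fun w => gramMat τ (fun j : Fin k => chain P j w) i j) z := by
  have hi := h.diff i i.2.le z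
  have hj := h.diff j j.2.le z
  exact clm_differentiableAt τ (hi.star.mul hj)

theorem IsIsotropic.eventually_chainIndep (h : IsIsotropic τ P k) (hz : ChainIndep τ P k z) :
    ∀ᶠ w in 𝓝 z, ChainIndep τ P k w :=
  (dz_det fun i j => h.differentiableAt_gram i j z).1.continuousAt.eventually_ne hz

theorem IsIsotropic.chainProj_mul_chain (hτ : IsFaithfulTrace τ) (h : IsIsotropic τ P k)
    (hz : ChainIndep τ P k z) {j : ℕ} (hj : j ≤ k) :
    chainProj τ P k z * chain P j z = chain P j z := by
  have hlt : ∀ l : Fin k, chainProj τ P k z * chain P l z = chain P l z := fun l =>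
    spanProj_mul (h.harm.rank z) (fun i => h.harm.chain_mul_proj i z) hz l
  rcases Nat.lt_or_eq_of_le hj with hj | rfl
  · exact hlt ⟨j, hj⟩
  -- The case j = k: the first k + 1 forms are dependent and the first k are not, so the last one
  -- lies in their span.
  · have h1 := h.dep z
    rw [linearIndependent_finSucc'] at h1
    have h2 : LinearIndependent ℂ (fun i : Fin j => chain P i z) :=
      (gramMat_det_ne_zero_iff hτ _).mp hz
    have h3 : chain P j z ∈ Submodule.span ℂ (Set.range fun i : Fin j => chain P i z) := by
      by_contra h3
      exact h1 ⟨h2, h3⟩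
    generalize chain P j z = y at h3
    induction h3 using Submodule.span_induction with
    | mem x hx => obtain ⟨i, rfl⟩ := hx; exact hlt i
    | zero => rw [mul_zero]
    | add x y _ _ hx hy => rw [mul_add, hx, hy]
    | smul c x _ hx => rw [mul_smul_comm, hx]

theorem IsIsotropic.differentiableAt_chainProj (h : IsIsotropic τ P k)
    (hz : ChainIndep τ P k z) : DifferentiableAt ℝ (chainProj τ P k) z := by
  unfold chainProj spanProj
  refine DifferentiableAt.fun_sum fun i _ => DifferentiableAt.fun_sum fun j _ => ?_
  have h1 := differentiableAt_inv_entry (fun i j => h.differentiableAt_gram i j z) hz i j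
  exact h1.smul ((h.diff i i.2.le z).mul (h.diff j j.2.le z).star)

/-- Where the chain forms are independent, the projection onto their span is a potential. -/
theorem IsIsotropic.dzb_chainProj (hτ : IsFaithfulTrace τ) (h : IsIsotropic τ P k)
    (hz : ChainIndep τ P k z) : dzb (chainProj τ P k) z = -lowerForm P z ∧
      dz (chainProj τ P k) z = -star (lowerForm P z) := by
  set T := chainProj τ P k with hT
  have hTd : DifferentiableAt ℝ T z := h.differentiableAt_chainProj hz
  have hr := h.harm
  have hTh : ∀ w, star (T w) = T w := fun w => star_spanProj hτ _
  have hmem : ∀ j ≤ k, ∀ᶠ w in 𝓝 z, T w * chain P j w = chain P j w := fun j hj =>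
    (h.eventually_chainIndep hz).mono fun w hw => h.chainProj_mul_chain hτ hw hj
  have hTP : T z * P z = 0 := hr.chainProj_mul_proj hτ k z
  -- The span is stable under ∂₋: isotropy removes V*ω_l, and ω_{l+1} lies in the range of T even
  -- for l = k − 1.
  have e1 : ∀ l : Fin k, dzb T z * chain P l z = 0 := by
    intro l
    have hd := h.diff l l.2.le z
    have e : dzb (fun w => T w * chain P l w) z = dzb (chain P l) z := dzb_congr (hmem l l.2.le)
    rw [dzb_mul hTd hd, hr.dzb_chain hd, h.iso l l.2.le, sub_zero, mul_add,
      (hmem (l + 1) l.2).self_of_nhds, ← mul_assoc (T z), (hmem l l.2.le).self_of_nhds,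
      add_eq_right] at e
    exact e
  have e2 : dzb T z * T z = 0 := mul_spanProj_eq_zero e1
  -- By the expansion, ∂₊ω_l leaves the span only through the connection term −W*ω_l, which lies in
  -- the range of P and is annihilated by T.
  have e3 : ∀ l : Fin k, (dz T z + star (lowerForm P z)) * chain P l z = 0 := by
    intro l
    have hd := h.diff l l.2.le z
    have e : dz (fun w => T w * chain P l w) z = dz (chain P l) z := dz_congr (hmem l l.2.le)
    obtain ⟨c, -, hc⟩ := h.expansion l l.2.le
    have hsum : T z * ∑ j ∈ Finset.range l, c j z • chain P j z =
        ∑ j ∈ Finset.range l, c j z • chain P j z := by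
      rw [Finset.mul_sum]
      refine Finset.sum_congr rfl fun j hj => ?_
      rw [mul_smul_comm, (hmem j _).self_of_nhds]
      have := Finset.mem_range.mp hj
      have := l.2
      omega
    have hTW : T z * (star (lowerForm P z) * chain P l z) = 0 := by
      rw [← hr.P_sW, mul_assoc, ← mul_assoc (T z), hTP, zero_mul]
    rw [dz_mul hTd hd, hc, mul_add, mul_sub, hsum, hTW, sub_zero, ← mul_assoc (T z),
      (hmem l l.2.le).self_of_nhds, ← sub_eq_zero] at e
    rw [add_mul, ← e]; abel
  have e4 : (dz T z + star (lowerForm P z)) * T z = 0 := mul_spanProj_eq_zero e3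
  have hTi : ∀ᶠ w in 𝓝 z, T w * T w = T w :=
    (h.eventually_chainIndep hz).mono fun w hw => hr.chainProj_idem hw
  have e5 : dz T z * T z + T z * dz T z = dz T z := by
    rw [← dz_mul hTd hTd]; exact dz_congr hTi
  have e6 : T z * dz T z = 0 := by
    have := congrArg star e2
    rwa [star_mul, hTh, star_dzb_of_herm hTh, star_zero] at this
  have e7 : star (lowerForm P z) * T z = star (lowerForm P z) := by
    have := congrArg star (hmem 0 (Nat.zero_le k)).self_of_nhds
    rwa [star_mul, hTh] at this
  -- Since T ∂₊T = 0, ∂₊T = ∂₊T T = −W*T, and W*T = W* because W = ω₀ is in the span.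
  have e8 : dz T z = -star (lowerForm P z) := by
    rw [e6, add_zero] at e5
    rw [add_mul, e7, e5] at e4
    exact eq_neg_of_add_eq_zero_left e4
  refine ⟨?_, e8⟩
  rw [← star_dz_of_herm hTh, e8, star_neg, star_star]

/-- On a ball where the chain forms are independent, S and the chain projection have the same
differential, so equality at the centre propagates. -/
theorem IsIsotropic.eventually_eq_chainProj (hτ : IsFaithfulTrace τ) (h : IsIsotropic τ P k)
    {S : ℂ → A} (hS : IsPotential τ P S) (hz : ChainIndep τ P k z)
    (hSz : S z = chainProj τ P k z) :
    ∀ᶠ w in 𝓝 z, ChainIndep τ P k w ∧ S w = chainProj τ P k w := by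
  have hSd : Differentiable ℝ S := hS.contDiff_pot.differentiable (by norm_num)
  obtain ⟨ε, hε, hball⟩ := Metric.eventually_nhds_iff_ball.mp (h.eventually_chainIndep hz)
  rw [Metric.eventually_nhds_iff_ball]
  refine ⟨ε, hε, fun w hw => ⟨hball w hw, ?_⟩⟩
  refine Metric.isOpen_ball.eqOn_of_fderiv_eq (𝕜 := ℝ) Metric.isPreconnected_ball
    hSd.differentiableOn
    (fun v hv => (h.differentiableAt_chainProj (hball v hv)).differentiableWithinAt) ?_
    (Metric.mem_ball_self hε) hSz hw
  intro v hv
  obtain ⟨h1, h2⟩ := h.dzb_chainProj hτ (hball v hv)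
  ext u
  rw [fderiv_apply_eq, fderiv_apply_eq, h1, h2, hS.dzb_pot, hS.dz_pot]

theorem IsIsotropic.flagAt_of_eq (h : IsIsotropic τ P k)
    {S : ℂ → A} (hz : ChainIndep τ P k z) (hSz : S z = chainProj τ P k z) : FlagAt P S z := by
  rw [FlagAt, hSz]
  exact ⟨h.harm.chainProj_idem hz, h.harm.proj_mul_chainProj k z⟩

/-- Apply ∂₋ to Sω_j = ω_j: the term Wω_j vanishes, and by isotropy ∂₋ω_j is ω_{j+1} + ω_j V*. The
base case is SW = W. -/
theorem IsIsotropic.pot_mul_chain (h : IsIsotropic τ P k) {S : ℂ → A} (hS : IsPotential τ P S)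
    {j : ℕ} (hj : j ≤ k) : ∀ z, (∀ᶠ w in 𝓝 z, FlagAt P S w) → S z * chain P j z = chain P j z := by
  have hr := h.harm
  have hSd : Differentiable ℝ S := hS.contDiff_pot.differentiable (by norm_num)
  induction j with
  | zero => exact fun z hf => FlagAt.pot_mul_lowerForm hS hf
  | succ j ih =>
    intro z hf
    have hd := h.diff j (by omega) z
    have e : dzb (fun w => S w * chain P j w) z = dzb (chain P j) z :=
      dzb_congr (hf.eventually_nhds.mono fun w hw => ih (by omega) w hw)
    have e0 : lowerForm P z * chain P j z = 0 := by
      rw [← hr.W_P, mul_assoc, hr.proj_mul_chain, mul_zero]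
    rw [dzb_mul (hSd z) hd, hS.dzb_pot, neg_mul, e0, neg_zero, zero_add, hr.dzb_chain hd,
      h.iso j (by omega), sub_zero, mul_add, ← mul_assoc (S z), ih (by omega) z hf,
      add_left_inj] at e
    exact e

/-- The derivatives of S are off-diagonal with respect to P, hence traceless. -/
theorem IsPotential.trace_const {S : ℂ → A} (hτ : IsFaithfulTrace τ) (hS : IsPotential τ P S)
    (z w : ℂ) : τ (S z) = τ (S w) := by
  have hr := hS.isHarmonic
  have hSd : Differentiable ℝ S := hS.contDiff_pot.differentiable (by norm_num)
  have hW : ∀ z, τ (lowerForm P z) = 0 := fun z => by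
    rw [← hr.W_P, hτ.comm, hr.P_W, map_zero]
  refine is_const_of_fderiv_eq_zero (𝕜 := ℝ) (f := fun z => τ (S z))
    (fun z => clm_differentiableAt τ (hSd z)) (fun z => ?_) z w
  apply fderiv_eq_zero_of_dz_dzb
  · rw [dz_clm τ (hSd z), hS.dz_pot, map_neg, hτ.map_star, hW]; simp
  · rw [dzb_clm τ (hSd z), hS.dzb_pot, map_neg, hW, neg_zero]

end

/-! ### Spreading the flag condition from one point to the plane. -/

section Extension

variable {P S : ℂ → A} {k : ℕ}

/-- The open set where `S` is a projection orthogonal to `P` spanned by the chain forms. -/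
def goodSet (τ : A →L[ℂ] ℂ) (P S : ℂ → A) (k : ℕ) : Set ℂ :=
  {z | (∀ᶠ w in 𝓝 z, FlagAt P S w) ∧ ChainIndep τ P k z}

theorem IsIsotropic.isOpen_goodSet (h : IsIsotropic τ P k) : IsOpen (goodSet τ P S k) := by
  rw [isOpen_iff_mem_nhds]
  rintro z ⟨h1, h2⟩
  exact (h1.eventually_nhds.and (h.eventually_chainIndep h2))

theorem IsPotential.isClosed_flagAt (hS : IsPotential τ P S) : IsClosed {z | FlagAt P S z} := by
  have hc := hS.contDiff_pot.continuous
  have hP := hS.contDiff.continuous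
  exact (isClosed_eq (hc.mul hc) hc).inter (isClosed_eq (hP.mul hc) continuous_const)

theorem IsPotential.flagAt_of_mem_closure (hS : IsPotential τ P S) {z : ℂ}
    (hz : z ∈ closure (goodSet τ P S k)) : FlagAt P S z :=
  closure_minimal (t := {z | FlagAt P S z}) (fun _ hw => hw.1.self_of_nhds) hS.isClosed_flagAt hz

/-- By continuity S is a projection fixing the chain forms at z. Its trace is k, so it equals the
projection onto their span, and then does so nearby. The good set can thus be left only at points
where the chain forms degenerate. -/
theorem IsIsotropic.mem_goodSet_of_mem_closure (hτ : IsFaithfulTrace τ) (h : IsIsotropic τ P k)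
    (hS : IsPotential τ P S) (htr : ∀ z, τ (S z) = k) {z : ℂ}
    (hz : z ∈ closure (goodSet τ P S k)) (hi : ChainIndep τ P k z) : z ∈ goodSet τ P S k := by
  have hf := hS.flagAt_of_mem_closure hz
  have hSc := hS.contDiff_pot.continuous
  have hmem : ∀ j : Fin k, S z * chain P j z = chain P j z := by
    intro j
    have hcl : IsClosed {w | S w * chain P j w = chain P j w} :=
      isClosed_eq (hSc.mul (h.diff j j.2.le).continuous) (h.diff j j.2.le).continuous
    exact closure_minimal (t := {w | S w * chain P j w = chain P j w})
      (fun w hw => h.pot_mul_chain hS j.2.le w hw.1) hcl hz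
  have hST : S z = chainProj τ P k z := by
    refine hτ.eq_of_proj hf.1 (hS.herm_pot z) (h.harm.chainProj_idem hi) (star_spanProj hτ _)
      (mul_spanProj hmem) ?_
    rw [htr, chainProj, trace_spanProj hτ hi]
  exact ⟨(h.eventually_eq_chainProj hτ hS hi hST).mono fun w hw =>
    h.flagAt_of_eq hw.1 hw.2, hi⟩

/-- The good set is dense in a neighbourhood of each point of its closure. -/
theorem IsIsotropic.closure_goodSet_mem_nhds (hτ : IsFaithfulTrace τ) (h : IsIsotropic τ P k)
    (hS : IsPotential τ P S) (htr : ∀ z, τ (S z) = k) {z₁ : ℂ}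
    (hz₁ : z₁ ∈ closure (goodSet τ P S k)) : closure (goodSet τ P S k) ∈ 𝓝 z₁ := by
  have hr := h.harm
  set U := goodSet τ P S k with hU
  obtain ⟨E, X, G, H, -, -, hL⟩ := exists_localFrame hτ le_rfl hS hS.contDiff hS.contDiff_pot
    (hS.flagAt_of_mem_closure hz₁)
  obtain ⟨ε, hε, hball⟩ := Metric.eventually_nhds_iff_ball.mp hL
  obtain ⟨z₂, hz₂U, hz₂⟩ := Metric.mem_closure_iff.mp hz₁ ε hε
  rw [dist_comm] at hz₂
  set η : ℕ → ℂ → A := fun j z => star (E z) * chain P j z * H z with hη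
  set q : Fin k → A := fun i => chain P i z₂ * H z₂ with hq
  set M : ℂ → Matrix (Fin k) (Fin k) ℂ := fun z =>
    Matrix.of fun i j => τ (star (q i) * η j z) with hM
  set γ : ℂ → ℂ := fun z => (M z).det with hγ
  have hηd : ∀ z ∈ Metric.ball z₁ ε, ∀ j ≤ k, DifferentiableAt ℝ (η j) z := by
    intro z hz j hj
    have hl := hball z hz
    exact ((hl.contDiff_E.differentiableAt (by norm_num)).star.mul (h.diff j hj z)).mul
      (hl.contDiff_H.differentiableAt (by norm_num))
  have hMd : ∀ z ∈ Metric.ball z₁ ε, ∀ i j, DifferentiableAt ℝ (fun w => M w i j) z :=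
    fun z hz i j => clm_differentiableAt τ ((differentiableAt_const _).mul (hηd z hz j j.2.le))
  have hγd : ∀ z ∈ Metric.ball z₁ ε, DifferentiableAt ℝ γ z := fun z hz => (dz_det (hMd z hz)).1
  -- On the good set the frames remove the connection terms, and ∂₊η_j = ∑_{l<j} c_l η_l is strictly
  -- triangular.
  have hγ0 : ∀ z ∈ Metric.ball z₁ ε, z ∈ U → dz γ z = 0 := by
    intro z hz hzU
    have hl := hball z hz
    choose c _ hc using fun j : Fin k => h.expansion j j.2.le
    have hdη : ∀ j : Fin k, dz (η j) z = ∑ l ∈ Finset.range j, c j l z • η l z := by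
      intro j
      rw [hη, hl.dz_compress le_rfl hzU.1 (h.diff j j.2.le z) (hr.chain_mul_proj j z), hc]
      have e1 : star (E z) * star (lowerForm P z) = 0 := by
        rw [← hr.P_sW, ← mul_assoc, hl.star_E_mul_P hS hzU.1.self_of_nhds, zero_mul]
      have e2 : star (lowerForm P z) * H z = 0 := by
        rw [← hl.P_H, ← mul_assoc, hr.sW_P, zero_mul]
      rw [mul_add, mul_sub, ← mul_assoc (star (E z)) (star (lowerForm P z)), e1, zero_mul,
        sub_zero, add_mul, mul_assoc, mul_assoc, mul_assoc (chain P j z), e2, mul_zero, mul_zero,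
        add_zero, ← mul_assoc, Finset.mul_sum, Finset.sum_mul]
      exact Finset.sum_congr rfl fun l _ => by rw [mul_smul_comm, smul_mul_assoc]
    refine dz_det_eq_zero (hMd z hz) (fun j l => if l < j then c j l z else 0)
      (fun j => by simp) fun i j => ?_
    have e3 : dz (fun w => M w i j) z = τ (star (q i) * dz (η j) z) := by
      change dz (fun w => τ (star (q i) * η j w)) z = _
      rw [dz_clm τ (f := fun w => star (q i) * η j w)
        ((differentiableAt_const _).mul (hηd z hz j j.2.le)),
        dz_mul (differentiableAt_const _) (hηd z hz j j.2.le), dz_const, zero_mul, zero_add]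
    rw [e3, hdη, Finset.mul_sum, map_sum]
    have e4 : ∀ l ∈ Finset.range (j : ℕ), l < k := fun l hl =>
      (Finset.mem_range.mp hl).trans j.2
    have e5 : ∑ l ∈ Finset.range (j : ℕ), τ (star (q i) * c j l z • η l z) =
        ∑ l ∈ Finset.range k, if l < j then c j l z • τ (star (q i) * η l z) else 0 := by
      rw [← Finset.sum_filter]
      refine Finset.sum_congr ?_ fun l _ => by rw [mul_smul_comm, map_smul]
      ext l
      simp only [Finset.mem_range, Finset.mem_filter]
      have := j.2
      omega
    rw [e5, Finset.sum_range]
    refine Finset.sum_congr rfl fun l _ => ?_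
    by_cases hlj : l < j
    · rw [if_pos hlj, if_pos (by exact_mod_cast hlj)]; rfl
    · rw [if_neg hlj, if_neg (by exact_mod_cast hlj), zero_smul]
  have hγdep : ∀ z, ¬ChainIndep τ P k z → γ z = 0 := by
    intro z hz
    rw [ChainIndep, gramMat_det_ne_zero_iff hτ, Fintype.linearIndependent_iff] at hz
    push Not at hz
    obtain ⟨g, hg, i, hi⟩ := hz
    refine Matrix.exists_mulVec_eq_zero_iff.mp ⟨g, fun h0 => hi (congrFun h0 i), ?_⟩
    funext l
    have : (M z *ᵥ g) l = τ (star (q l) * (star (E z) * (∑ j, g j • chain P j z) * H z)) := by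
      simp only [hM, hη, Matrix.mulVec, dotProduct, Matrix.of_apply, Finset.mul_sum,
        Finset.sum_mul, map_sum, mul_smul_comm, smul_mul_assoc, map_smul, smul_eq_mul]
      exact Finset.sum_congr rfl fun j _ => mul_comm _ _
    rw [this, hg]; simp
  have hz₂b : z₂ ∈ Metric.ball z₁ ε := hz₂
  have hγ2 : γ z₂ ≠ 0 := by
    have hl := hball z₂ hz₂b
    have hf := hz₂U.1.self_of_nhds
    have hEq : ∀ i, E z₂ * q i = q i := fun i => by
      refine hl.E_mul hf _ ?_
      rw [hq, ← mul_assoc, h.pot_mul_chain hS i.2.le z₂ hz₂U.1]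
    have hMG : M z₂ = gramMat τ q := by
      ext i j
      simp only [hM, hη, gramMat, Matrix.of_apply]
      have : star (q i) * (star (E z₂) * chain P j z₂ * H z₂) = star (E z₂ * q i) * q j := by
        simp only [hq, star_mul, mul_assoc]
      rw [this, hEq]
    rw [hγ]
    simp only
    rw [hMG, gramMat_det_ne_zero_iff hτ, Fintype.linearIndependent_iff]
    intro g hg
    have hind := (gramMat_det_ne_zero_iff hτ _).mp hz₂U.2
    refine Fintype.linearIndependent_iff.mp hind g ?_
    have e := congrArg (fun y => y * star (G z₂)) hg
    simp only [hq, Finset.sum_mul, smul_mul_assoc, zero_mul, mul_assoc, hl.H_G,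
      hr.chain_mul_proj] at e
    exact e
  classical
  -- Off the good set γ is only real differentiable, so it is cut off there. At a point of the
  -- closure outside `U` the chain forms are dependent and γ vanishes; squaring makes f of order |w
  -- − ζ|², hence complex differentiable with derivative zero.
  set f : ℂ → ℂ := fun ζ => if starRingEnd ℂ ζ ∈ U then γ (starRingEnd ℂ ζ) ^ 2 else 0 with hf
  set ζ₁ := starRingEnd ℂ z₁ with hζ₁
  have hconj : ∀ ζ, ζ ∈ Metric.ball ζ₁ ε → starRingEnd ℂ ζ ∈ Metric.ball z₁ ε := by
    intro ζ hζ
    rw [Metric.mem_ball] at hζ ⊢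
    rw [← Complex.dist_conj_conj, Complex.conj_conj]
    exact hζ
  have hfd : DifferentiableOn ℂ f (Metric.ball ζ₁ ε) := by
    intro ζ hζ
    apply DifferentiableAt.differentiableWithinAt
    have hzb := hconj ζ hζ
    have hcd : DifferentiableAt ℝ (fun w => γ (starRingEnd ℂ w)) ζ :=
      (hγd _ hzb).comp ζ Complex.conjCLE.differentiableAt
    by_cases hζU : starRingEnd ℂ ζ ∈ U
    · have h1 : DifferentiableAt ℂ (fun w => γ (starRingEnd ℂ w)) ζ :=
        differentiableAt_complex_of_dzb_eq_zero hcd (by rw [dzb_comp_conj, hγ0 _ hzb hζU])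
      refine (h1.pow 2).congr_of_eventuallyEq ?_
      have := (tendsto_conj ζ).eventually (h.isOpen_goodSet.mem_nhds hζU)
      filter_upwards [this] with w hw
      exact if_pos hw
    · have hζ0 : f ζ = 0 := if_neg hζU
      by_cases hcl : starRingEnd ℂ ζ ∈ closure U
      · have hnot : ¬ChainIndep τ P k (starRingEnd ℂ ζ) := fun hi =>
          hζU (h.mem_goodSet_of_mem_closure hτ hS htr hcl hi)
        have hγζ : γ (starRingEnd ℂ ζ) = 0 := hγdep _ hnot
        have hO : (fun w => γ (starRingEnd ℂ w)) =O[𝓝 ζ] fun w => w - ζ := by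
          have := hcd.isBigO_sub
          simpa [hγζ] using this
        have hO2 : f =O[𝓝 ζ] fun w => (w - ζ) ^ 2 := by
          refine Asymptotics.IsBigO.trans ?_ (hO.pow 2)
          refine Asymptotics.IsBigO.of_bound 1 (Filter.Eventually.of_forall fun w => ?_)
          simp only [hf, one_mul]
          split_ifs
          · exact le_rfl
          · rw [norm_zero]; positivity
        have hder : HasDerivAt f 0 ζ := by
          rw [hasDerivAt_iff_isLittleO, hζ0]
          simp only [sub_zero, smul_zero]
          refine hO2.trans_isLittleO ?_
          have : (fun w : ℂ => (w - ζ) ^ 2) = fun w => (w - ζ) * (w - ζ) := by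
            funext w; ring
          rw [this]
          have h1 : (fun w : ℂ => w - ζ) =o[𝓝 ζ] fun _ => (1 : ℂ) := by
            rw [Asymptotics.isLittleO_one_iff]
            have : Filter.Tendsto (fun w : ℂ => w - ζ) (𝓝 ζ) (𝓝 (ζ - ζ)) :=
              (continuous_id.sub continuous_const).tendsto ζ
            rwa [sub_self] at this
          simpa using h1.mul_isBigO (Asymptotics.isBigO_refl (fun w : ℂ => w - ζ) (𝓝 ζ))
        exact hder.differentiableAt
      · refine (differentiableAt_const (0 : ℂ)).congr_of_eventuallyEq ?_
        have := (tendsto_conj ζ).eventually (isClosed_closure.isOpen_compl.mem_nhds hcl)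
        filter_upwards [this] with w hw
        exact if_neg fun hwU => hw (subset_closure hwU)
  have han : AnalyticOnNhd ℂ f (Metric.ball ζ₁ ε) := hfd.analyticOnNhd Metric.isOpen_ball
  have hζ1b : ζ₁ ∈ Metric.ball ζ₁ ε := Metric.mem_ball_self hε
  -- f is holomorphic on the ball and nonzero at the conjugate of z₂, so it cannot vanish near ζ₁;
  -- wherever f ≠ 0 the conjugate point lies in `U`.
  have hne : ∀ᶠ ζ in 𝓝[≠] ζ₁, f ζ ≠ 0 := by
    refine (han ζ₁ hζ1b).eventually_eq_zero_or_eventually_ne_zero.resolve_left fun h0 => ?_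
    have hb : starRingEnd ℂ z₂ ∈ Metric.ball ζ₁ ε := by
      rw [Metric.mem_ball, hζ₁, Complex.dist_conj_conj]; exact hz₂
    have := han.eqOn_zero_of_preconnected_of_eventuallyEq_zero Metric.isPreconnected_ball hζ1b h0
      hb
    simp only [hf, Complex.conj_conj, if_pos hz₂U, Pi.zero_apply] at this
    exact hγ2 (pow_eq_zero_iff two_ne_zero |>.mp this)
  rw [eventually_nhdsWithin_iff] at hne
  have hne' := (tendsto_conj z₁).eventually hne
  filter_upwards [hne'] with w hw
  by_cases hwz : w = z₁
  · rwa [hwz]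
  · have := hw fun he => hwz ((starRingEnd ℂ).injective he)
    simp only [hf, Complex.conj_conj] at this
    by_contra hwU
    exact this (if_neg fun h0 => hwU (subset_closure h0))

theorem IsIsotropic.flag (hτ : IsFaithfulTrace τ) (h : IsIsotropic τ P k)
    (hS : IsPotential τ P S) {z₀ : ℂ} (hz₀ : ChainIndep τ P k z₀)
    (hSz₀ : S z₀ = chainProj τ P k z₀) : IsFlagPair τ P S ∧ ∀ z, τ (S z) = k := by
  have htr : ∀ z, τ (S z) = k := fun z => by
    rw [hS.trace_const hτ z z₀, hSz₀, chainProj, trace_spanProj hτ hz₀]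
  refine ⟨⟨hS, fun z => hS.flagAt_of_mem_closure (k := k) ?_⟩, htr⟩
  have hz₀U : z₀ ∈ goodSet τ P S k :=
    ⟨(h.eventually_eq_chainProj hτ hS hz₀ hSz₀).mono fun w hw => h.flagAt_of_eq hw.1 hw.2, hz₀⟩
  -- Connectedness of the plane then makes the closure everything, and the flag condition is closed.
  have hclopen : IsClopen (closure (goodSet τ P S k)) :=
    ⟨isClosed_closure, isOpen_iff_mem_nhds.mpr fun z hz =>
      h.closure_goodSet_mem_nhds hτ hS htr hz⟩
  rw [hclopen.eq_univ ⟨z₀, subset_closure hz₀U⟩]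
  trivial

end Extension

/-- A harmonic rank-one projector map of the sphere with a potential `S` belongs to a flag pair,
after adjusting the constant of integration of `S`. -/
theorem IsHarmonic.exists_flagPair (hτ : IsFaithfulTrace τ) {N : ℕ} (hN : τ 1 = N) {P R S : ℂ → A}
    (h : IsHarmonic τ P) (hPR : ∀ z, z ≠ 0 → P z = R z⁻¹)
    (hP : ContDiff ℝ ((N + 2 : ℕ) : WithTop ℕ∞) P) (hR : ContDiff ℝ ((N + 2 : ℕ) : WithTop ℕ∞) R)
    (cS : ContDiff ℝ 2 S) (hSh : ∀ z, star (S z) = S z) (hSd : ∀ z, dzb S z = -lowerForm P z) :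
    ∃ (c : A) (k : ℕ), star c = c ∧ k < N ∧ IsFlagPair τ P (fun z => S z + c) ∧
      ∀ z, τ (S z + c) = k := by
  -- The generic number of independent chain forms; it exists because k independent forms require k
  -- < N.
  have hex : ∃ k, (∃ z, ChainIndep τ P k z) ∧ ¬∃ z, ChainIndep τ P (k + 1) z := by
    by_contra hcon
    push Not at hcon
    have hall : ∀ k, ∃ z, ChainIndep τ P k z := by
      intro k
      induction k with
      | zero => exact ⟨0, by simp [ChainIndep]⟩
      | succ k ih => obtain ⟨z, hz⟩ := ih; exact hcon k ⟨z, hz⟩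
    obtain ⟨z, hz⟩ := hall N
    exact lt_irrefl _ (h.lt_of_chainIndep hτ hN hz)
  obtain ⟨k, ⟨z₀, hz₀⟩, hmax⟩ := hex
  have hkN : k < N := h.lt_of_chainIndep hτ hN hz₀
  -- Expansion and isotropy up to order k use k + 2 derivatives, available since k < N.
  have hall := fun j (hj : j ≤ k) => h.chain_expansion_and_isotropic hτ hPR j 0
    (hP.of_le (by norm_cast; omega)) (hR.of_le (by norm_cast; omega))
  have hI : IsIsotropic τ P k :=
    ⟨h, fun j hj => (contDiff_chain j 1 (hP.of_le (by norm_cast; omega))).differentiable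
      (by norm_num), fun j hj => (hall j hj).1, fun j hj => (hall j hj).2 j le_rfl,
      fun z hz => hmax ⟨z, (gramMat_det_ne_zero_iff hτ _).mpr hz⟩⟩
  -- This constant makes the potential equal to the chain projection at z₀.
  have hc : star (chainProj τ P k z₀ - S z₀) = chainProj τ P k z₀ - S z₀ := by
    rw [star_sub, hSh, chainProj, star_spanProj hτ]
  have hpot : IsPotential τ P (fun z => S z + (chainProj τ P k z₀ - S z₀)) := by
    refine ⟨h.contDiff, h.rank, cS.add contDiff_const, fun z => ?_, fun z => ?_⟩
    · rw [star_add, hSh, hc]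
    · rw [dzb_add (cS.differentiable (by norm_num) z) (differentiableAt_const _), dzb_const,
        add_zero, hSd]
  exact ⟨_, k, hc, hkN, hI.flag hτ hpot hz₀ (by abel)⟩

end Existence

/-! ### Pointwise algebra: characteristic polynomial versus projections. -/

section SurfaceAlgebra

variable {N : ℕ}

theorem exists_diagonalization {M : Matrix (Fin N) (Fin N) ℂ} (hM : Mᴴ = M) :
    ∃ (U : Matrix (Fin N) (Fin N) ℂ) (d : Fin N → ℝ), Uᴴ * U = 1 ∧ U * Uᴴ = 1 ∧
      M = U * Matrix.diagonal (fun i => (d i : ℂ)) * Uᴴ := by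
  have h : M.IsHermitian := hM
  refine ⟨h.eigenvectorUnitary, h.eigenvalues, ?_, ?_, ?_⟩
  · exact Unitary.coe_star_mul_self h.eigenvectorUnitary
  · exact Unitary.coe_mul_star_self h.eigenvectorUnitary
  · have := h.spectral_theorem
    rw [Unitary.conjStarAlgAut_apply] at this
    exact this

section Diag

variable {U : Matrix (Fin N) (Fin N) ℂ} (hU : Uᴴ * U = 1)

include hU in
theorem conj_mul_conj (D E : Matrix (Fin N) (Fin N) ℂ) :
    (U * D * Uᴴ) * (U * E * Uᴴ) = U * (D * E) * Uᴴ := by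
  calc (U * D * Uᴴ) * (U * E * Uᴴ) = U * D * (Uᴴ * U) * E * Uᴴ := by noncomm_ring
    _ = U * (D * E) * Uᴴ := by rw [hU]; noncomm_ring

include hU in
theorem trace_conj (D : Matrix (Fin N) (Fin N) ℂ) : (U * D * Uᴴ).trace = D.trace := by
  rw [Matrix.trace_mul_comm, ← mul_assoc, hU, one_mul]

include hU in
theorem conj_injective {D E : Matrix (Fin N) (Fin N) ℂ} (h : U * D * Uᴴ = U * E * Uᴴ) : D = E := by
  have e : ∀ D : Matrix (Fin N) (Fin N) ℂ, Uᴴ * (U * D * Uᴴ) * U = D := fun D => by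
    calc Uᴴ * (U * D * Uᴴ) * U = (Uᴴ * U) * D * (Uᴴ * U) := by noncomm_ring
      _ = D := by rw [hU, one_mul, mul_one]
  rw [← e D, h, e]

theorem charpoly_conj_diagonal (hU : Uᴴ * U = 1) (hU' : U * Uᴴ = 1) (a b : ℂ) (d : Fin N → ℂ) :
    (a • (1 : Matrix (Fin N) (Fin N) ℂ) + b • (U * Matrix.diagonal d * Uᴴ)).charpoly =
      ∏ i, (Polynomial.X - Polynomial.C (a + b * d i)) := by
  have : a • (1 : Matrix (Fin N) (Fin N) ℂ) + b • (U * Matrix.diagonal d * Uᴴ) =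
      U * Matrix.diagonal (fun i => a + b * d i) * Uᴴ := by
    have h1 : Matrix.diagonal (fun i => a + b * d i) =
        a • (1 : Matrix (Fin N) (Fin N) ℂ) + b • Matrix.diagonal d := by
      ext i j
      by_cases hij : i = j
      · subst hij; simp
      · simp [hij]
    rw [h1, mul_add, add_mul, mul_smul_comm, smul_mul_assoc, mul_one, hU', mul_smul_comm,
      smul_mul_assoc]
  rw [this, mul_assoc, Matrix.charpoly_mul_comm, mul_assoc, hU, mul_one,
    Matrix.charpoly_diagonal]

end Diag

theorem trace_diag_sum {M U : Matrix (Fin N) (Fin N) ℂ} {d : Fin N → ℝ} (hU : Uᴴ * U = 1)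
    (hM : M = U * Matrix.diagonal (fun i => (d i : ℂ)) * Uᴴ) :
    M.trace = ∑ i, (d i : ℂ) ∧ (M * M).trace = ∑ i, (d i : ℂ) * d i := by
  constructor
  · rw [hM, trace_conj hU, Matrix.trace_diagonal]
  · rw [hM, conj_mul_conj hU, trace_conj hU, Matrix.diagonal_mul_diagonal, Matrix.trace_diagonal]

/-- The characteristic polynomial of an affine function of a Hermitian matrix with eigenvalues
in `{1, 0, -1}`. -/
theorem charpoly_of_cube {M : Matrix (Fin N) (Fin N) ℂ} (hM : Mᴴ = M) (h3 : M * M * M = M)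
    {k : ℕ} (hk : k < N) (h1 : M.trace = (N : ℂ) - 1 - 2 * k) (h2 : (M * M).trace = (N : ℂ) - 1)
    (a b : ℂ) : (a • (1 : Matrix (Fin N) (Fin N) ℂ) + b • M).charpoly =
      (Polynomial.X - Polynomial.C (a + b)) ^ (N - k - 1) * (Polynomial.X - Polynomial.C a) *
        (Polynomial.X - Polynomial.C (a - b)) ^ k := by
  obtain ⟨U, d, hU, hU', hd⟩ := exists_diagonalization hM
  obtain ⟨t1, t2⟩ := trace_diag_sum hU hd
  have hd3 : ∀ i, d i * d i * d i = d i := by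
    intro i
    rw [hd, conj_mul_conj hU, conj_mul_conj hU, Matrix.diagonal_mul_diagonal,
      Matrix.diagonal_mul_diagonal] at h3
    have := congrFun (Matrix.diagonal_injective (conj_injective hU h3)) i
    exact_mod_cast this
  have hcases : ∀ i, d i = 1 ∨ d i = 0 ∨ d i = -1 := by
    intro i
    have : d i * ((d i - 1) * (d i + 1)) = 0 := by linear_combination hd3 i
    rcases mul_eq_zero.mp this with h | h
    · exact Or.inr (Or.inl h)
    · rcases mul_eq_zero.mp h with h | h
      · exact Or.inl (by linarith)
      · exact Or.inr (Or.inr (by linarith))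
  set e : ℝ → Fin N → ℕ := fun v i => if d i = v then 1 else 0 with he
  have hsplit : ∀ i, (Polynomial.X - Polynomial.C (a + b * (d i : ℂ)) : Polynomial ℂ) =
      (Polynomial.X - Polynomial.C (a + b)) ^ e 1 i * (Polynomial.X - Polynomial.C a) ^ e 0 i *
        (Polynomial.X - Polynomial.C (a - b)) ^ e (-1) i := by
    intro i
    rcases hcases i with h | h | h <;> simp only [he, h]
    · norm_num
    · norm_num
    · norm_num [sub_eq_add_neg]
  -- The multiplicities solve n₁ + n₀ + n₋₁ = N, n₁ − n₋₁ = N − 1 − 2k and n₁ + n₋₁ = N − 1, from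
  -- the size, the trace and the trace of the square.
  have hn1 : ∑ i, e 1 i = N - k - 1 ∧ ∑ i, e 0 i = 1 ∧ ∑ i, e (-1) i = k := by
    have s0 : (∑ i, e 1 i : ℕ) + ∑ i, e 0 i + ∑ i, e (-1) i = N := by
      rw [← Finset.sum_add_distrib, ← Finset.sum_add_distrib]
      have : ∀ i, e 1 i + e 0 i + e (-1) i = 1 := by
        intro i
        rcases hcases i with h | h | h <;> simp only [he, h] <;> norm_num
      simp [this]
    have s1 : ((∑ i, e 1 i : ℕ) : ℝ) - (∑ i, e (-1) i : ℕ) = N - 1 - 2 * k := by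
      have e1 : ((∑ i, e 1 i : ℕ) : ℝ) - (∑ i, e (-1) i : ℕ) = ∑ i, d i := by
        push_cast
        rw [← Finset.sum_sub_distrib]
        refine Finset.sum_congr rfl fun i _ => ?_
        rcases hcases i with h | h | h <;> simp only [he, h] <;> norm_num
      rw [e1]
      rw [t1] at h1
      exact_mod_cast h1
    have s2 : ((∑ i, e 1 i : ℕ) : ℝ) + (∑ i, e (-1) i : ℕ) = N - 1 := by
      have e1 : ((∑ i, e 1 i : ℕ) : ℝ) + (∑ i, e (-1) i : ℕ) = ∑ i, d i * d i := by
        push_cast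
        rw [← Finset.sum_add_distrib]
        refine Finset.sum_congr rfl fun i _ => ?_
        rcases hcases i with h | h | h <;> simp only [he, h] <;> norm_num
      rw [e1]
      rw [t2] at h2
      exact_mod_cast h2
    have r2 : (∑ i, e (-1) i : ℕ) = k := by
      have : ((∑ i, e (-1) i : ℕ) : ℝ) = k := by linarith
      exact_mod_cast this
    have r1 : (∑ i, e 1 i : ℕ) + k + 1 = N := by
      have : ((∑ i, e 1 i : ℕ) : ℝ) + k + 1 = N := by linarith
      exact_mod_cast this
    omega
  rw [hd, charpoly_conj_diagonal hU hU', Finset.prod_congr rfl fun i _ => hsplit i,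
    Finset.prod_mul_distrib, Finset.prod_mul_distrib, Finset.prod_pow_eq_pow_sum,
    Finset.prod_pow_eq_pow_sum, Finset.prod_pow_eq_pow_sum, hn1.1, hn1.2.1, hn1.2.2, pow_one]

/-- A Hermitian matrix is recovered up to conjugation from the characteristic polynomial of an
affine function of it. -/
theorem cube_of_charpoly {M : Matrix (Fin N) (Fin N) ℂ} (hM : Mᴴ = M) {k : ℕ} (hk : k < N)
    {a b : ℂ} (hb : b ≠ 0) (h : (a • (1 : Matrix (Fin N) (Fin N) ℂ) + b • M).charpoly =
      (Polynomial.X - Polynomial.C (a + b)) ^ (N - k - 1) * (Polynomial.X - Polynomial.C a) *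
        (Polynomial.X - Polynomial.C (a - b)) ^ k) :
    M * M * M = M ∧ M.trace = (N : ℂ) - 1 - 2 * k ∧ (M * M).trace = (N : ℂ) - 1 := by
  obtain ⟨U, d, hU, hU', hd⟩ := exists_diagonalization hM
  obtain ⟨t1, t2⟩ := trace_diag_sum hU hd
  rw [hd, charpoly_conj_diagonal hU hU'] at h
  have hne : ∀ c : ℂ, (Polynomial.X - Polynomial.C c : Polynomial ℂ) ≠ 0 :=
    Polynomial.X_sub_C_ne_zero
  have hroots := congrArg Polynomial.roots h
  rw [Polynomial.roots_prod _ _ (Finset.prod_ne_zero_iff.mpr fun i _ => hne _),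
    Polynomial.roots_mul (mul_ne_zero (mul_ne_zero (pow_ne_zero _ (hne _)) (hne _))
      (pow_ne_zero _ (hne _))),
    Polynomial.roots_mul (mul_ne_zero (pow_ne_zero _ (hne _)) (hne _)), Polynomial.roots_pow,
    Polynomial.roots_pow] at hroots
  simp only [Polynomial.roots_X_sub_C, Multiset.bind_singleton, Multiset.nsmul_singleton]
    at hroots
  -- The roots are the a + b d_i; undoing the affine map gives the multiset of eigenvalues of M.
  have hmap : (Finset.univ.val.map fun i => (d i : ℂ)) =
      Multiset.replicate (N - k - 1) 1 + {0} + Multiset.replicate k (-1) := by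
    have := congrArg (Multiset.map fun x => (x - a) / b) hroots
    rw [Multiset.map_map] at this
    simp only [Multiset.map_add, Multiset.map_replicate, Multiset.map_singleton,
      Function.comp_def, add_sub_cancel_left, sub_self, zero_div, sub_sub_cancel_left,
      neg_div, div_self hb, mul_div_cancel_left₀ _ hb] at this
    exact this
  have hkN : ((N - k - 1 : ℕ) : ℂ) = (N : ℂ) - k - 1 := by
    have : N - k - 1 + k + 1 = N := by omega
    have h2 : (((N - k - 1 + k + 1 : ℕ)) : ℂ) = N := by rw [this]
    push_cast at h2
    linear_combination h2
  refine ⟨?_, ?_, ?_⟩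
  · have hd3 : ∀ i, (d i : ℂ) * d i * d i = d i := by
      intro i
      have hi : (d i : ℂ) ∈ Finset.univ.val.map fun i => (d i : ℂ) :=
        Multiset.mem_map_of_mem _ (Finset.mem_univ i)
      rw [hmap, Multiset.mem_add, Multiset.mem_add, Multiset.mem_singleton] at hi
      rcases hi with (hi | hi) | hi
      · rw [Multiset.eq_of_mem_replicate hi]; norm_num
      · rw [hi]; norm_num
      · rw [Multiset.eq_of_mem_replicate hi]; norm_num
    rw [hd, conj_mul_conj hU, conj_mul_conj hU, Matrix.diagonal_mul_diagonal,
      Matrix.diagonal_mul_diagonal]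
    simp only [hd3]
  · have := congrArg Multiset.sum hmap
    rw [t1]
    change ∑ i, (d i : ℂ) = _ at this
    rw [this]
    simp only [Multiset.sum_add, Multiset.sum_replicate, Multiset.sum_singleton, nsmul_eq_mul, hkN]
    ring
  · have := congrArg (fun m => (Multiset.map (fun x : ℂ => x * x) m).sum) hmap
    simp only [Multiset.map_map, Multiset.map_add, Multiset.map_replicate, Multiset.map_singleton,
      Multiset.sum_add, Multiset.sum_replicate, Multiset.sum_singleton, nsmul_eq_mul, hkN] at this
    rw [t2]
    change ∑ i, (d i : ℂ) * d i = _ at this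
    rw [this]
    ring

/-- The surface point determined by the projections `p` and `s`. -/
def surfacePoint (lam : ℝ) (p s : Matrix (Fin N) (Fin N) ℂ) : Matrix (Fin N) (Fin N) ℂ :=
  (-Complex.I) • (p + (2 : ℂ) • s - (lam : ℂ) • (1 : Matrix (Fin N) (Fin N) ℂ))

theorem surfacePoint_sub (lam : ℝ) (p s : Matrix (Fin N) (Fin N) ℂ) :
    surfacePoint lam p s - (Complex.I * ((lam : ℂ) - 1)) • (1 : Matrix (Fin N) (Fin N) ℂ) =
      Complex.I • (1 - p - (2 : ℂ) • s) := by
  rw [surfacePoint]; module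

/-- 1 − p − 2s is 0 on the range of p, −1 on the range of s and 1 on their common kernel. -/
theorem sq_one_sub {p s : Matrix (Fin N) (Fin N) ℂ} (hp : p * p = p) (hs : s * s = s)
    (hps : p * s = 0) (hsp : s * p = 0) :
    (1 - p - (2 : ℂ) • s) * (1 - p - (2 : ℂ) • s) = 1 - p := by
  simp only [mul_sub, sub_mul, mul_one, one_mul, smul_mul_assoc, mul_smul_comm, hp, hs, hps, hsp]
  module

theorem surfacePoint_sq {p s : Matrix (Fin N) (Fin N) ℂ} (hp : p * p = p) (hs : s * s = s)
    (hps : p * s = 0) (hsp : s * p = 0) (lam : ℝ) :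
    (surfacePoint lam p s - (Complex.I * ((lam : ℂ) - 1)) •
      (1 : Matrix (Fin N) (Fin N) ℂ)) ^ 2 = p - 1 := by
  rw [surfacePoint_sub, pow_two, smul_mul_smul_comm, sq_one_sub hp hs hps hsp, Complex.I_mul_I]
  module

theorem surfacePoint_charpoly {p s : Matrix (Fin N) (Fin N) ℂ} (hp : p * p = p) (hs : s * s = s)
    (hps : p * s = 0) (hsp : s * p = 0) (hph : pᴴ = p) (hsh : sᴴ = s) (htp : p.trace = 1)
    {k : ℕ} (hk : k < N) (hts : s.trace = k) (lam : ℝ) :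
    (surfacePoint lam p s).charpoly =
      (Polynomial.X - Polynomial.C (Complex.I * (lam : ℂ))) ^ (N - k - 1) *
      (Polynomial.X - Polynomial.C (Complex.I * ((lam : ℂ) - 1))) *
      (Polynomial.X - Polynomial.C (Complex.I * ((lam : ℂ) - 2))) ^ k := by
  set M := 1 - p - (2 : ℂ) • s with hM
  have hMM : M * M = 1 - p := sq_one_sub hp hs hps hsp
  have hMh : Mᴴ = M := by
    rw [hM, Matrix.conjTranspose_sub, Matrix.conjTranspose_sub, Matrix.conjTranspose_one, hph,
      Matrix.conjTranspose_smul, hsh]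
    simp
  have h3 : M * M * M = M := by
    rw [hMM, hM]
    simp only [mul_sub, sub_mul, mul_one, one_mul, mul_smul_comm, hp, hps]
    module
  have h1 : M.trace = (N : ℂ) - 1 - 2 * k := by
    rw [hM, Matrix.trace_sub, Matrix.trace_sub, Matrix.trace_one, htp, Matrix.trace_smul, hts]
    simp
  have h2 : (M * M).trace = (N : ℂ) - 1 := by
    rw [hMM, Matrix.trace_sub, Matrix.trace_one, htp]; simp
  have key := charpoly_of_cube hMh h3 hk h1 h2 (Complex.I * ((lam : ℂ) - 1)) Complex.I
  have e : surfacePoint lam p s =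
      (Complex.I * ((lam : ℂ) - 1)) • (1 : Matrix (Fin N) (Fin N) ℂ) + Complex.I • M := by
    rw [← surfacePoint_sub]; abel
  rw [e, key]
  congr 4 <;> ring_nf

/-- The projections `p` and `s` recovered from a surface point. -/
theorem projections_of_charpoly {f : Matrix (Fin N) (Fin N) ℂ} (hf : fᴴ = -f) {k : ℕ} (hk : k < N)
    {lam : ℝ} (h : f.charpoly =
      (Polynomial.X - Polynomial.C (Complex.I * (lam : ℂ))) ^ (N - k - 1) *
      (Polynomial.X - Polynomial.C (Complex.I * ((lam : ℂ) - 1))) *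
      (Polynomial.X - Polynomial.C (Complex.I * ((lam : ℂ) - 2))) ^ k)
    {p s : Matrix (Fin N) (Fin N) ℂ}
    (hp : p = (f - (Complex.I * ((lam : ℂ) - 1)) • (1 : Matrix (Fin N) (Fin N) ℂ)) ^ 2 + 1)
    (hs : s = (1 / 2 : ℂ) • (Complex.I • f + (lam : ℂ) • (1 : Matrix (Fin N) (Fin N) ℂ) - p)) :
    p * p = p ∧ s * s = s ∧ p * s = 0 ∧ pᴴ = p ∧ sᴴ = s ∧ p.trace = 1 ∧ s.trace = k ∧
      f = surfacePoint lam p s := by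
  set a : ℂ := Complex.I * ((lam : ℂ) - 1) with ha
  -- M is Hermitian with eigenvalues 1, 0, −1. Then p = 1 − M² and s = ½(M² − M) are its spectral
  -- projections for 0 and −1.
  set M := (-Complex.I) • (f - a • (1 : Matrix (Fin N) (Fin N) ℂ)) with hM
  have hI : Complex.I * Complex.I = -1 := Complex.I_mul_I
  have hfM : f = a • (1 : Matrix (Fin N) (Fin N) ℂ) + Complex.I • M := by
    rw [hM, smul_smul, mul_neg, hI]; module
  have hsa : star a = -a := by
    simp [ha]
  have hMh : Mᴴ = M := by
    rw [hM, Matrix.conjTranspose_smul, Matrix.conjTranspose_sub, hf, Matrix.conjTranspose_smul,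
      Matrix.conjTranspose_one, hsa]
    simp only [star_neg, RCLike.star_def, Complex.conj_I, neg_neg]
    module
  have hch : (a • (1 : Matrix (Fin N) (Fin N) ℂ) + Complex.I • M).charpoly =
      (Polynomial.X - Polynomial.C (a + Complex.I)) ^ (N - k - 1) *
        (Polynomial.X - Polynomial.C a) * (Polynomial.X - Polynomial.C (a - Complex.I)) ^ k := by
    rw [← hfM, h]
    have e1 : a + Complex.I = Complex.I * (lam : ℂ) := by rw [ha]; ring
    have e2 : a - Complex.I = Complex.I * ((lam : ℂ) - 2) := by rw [ha]; ring
    rw [e1, e2]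
  obtain ⟨h3, t1, t2⟩ := cube_of_charpoly hMh hk Complex.I_ne_zero hch
  have hpM : p = 1 - M * M := by
    have : f - a • (1 : Matrix (Fin N) (Fin N) ℂ) = Complex.I • M := by
      conv_lhs => rw [hfM]
      abel
    rw [hp, this, pow_two, smul_mul_smul_comm, hI]; module
  have hsM : s = (1 / 2 : ℂ) • (M * M - M) := by
    have hif : Complex.I • f = (1 - (lam : ℂ)) • (1 : Matrix (Fin N) (Fin N) ℂ) - M := by
      conv_lhs => rw [hfM]
      rw [smul_add, smul_smul, smul_smul, hI, ha, ← mul_assoc, hI]; module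
    rw [hs, hif, hpM]; module
  have h4 : M * M * (M * M) = M * M := by rw [← mul_assoc, h3]
  have h3' : M * (M * M) = M := by rw [← mul_assoc, h3]
  refine ⟨?_, ?_, ?_, ?_, ?_, ?_, ?_, ?_⟩
  · rw [hpM]; simp only [mul_sub, sub_mul, mul_one, one_mul, h4]; abel
  · rw [hsM, smul_mul_smul_comm]; simp only [mul_sub, sub_mul, h4, h3, h3']; module
  · rw [hsM, hpM, mul_smul_comm]
    simp only [mul_sub, sub_mul, one_mul, h4, h3]; module
  · rw [hpM, Matrix.conjTranspose_sub, Matrix.conjTranspose_one, Matrix.conjTranspose_mul, hMh]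
  · rw [hsM, Matrix.conjTranspose_smul, Matrix.conjTranspose_sub, Matrix.conjTranspose_mul, hMh]
    simp
  · rw [hpM, Matrix.trace_sub, Matrix.trace_one, t2]; simp
  · rw [hsM, Matrix.trace_smul, Matrix.trace_sub, t1, t2, smul_eq_mul]; ring
  · rw [surfacePoint, hs]
    have : p + (2 : ℂ) • (1 / 2 : ℂ) •
        (Complex.I • f + (lam : ℂ) • (1 : Matrix (Fin N) (Fin N) ℂ) - p) -
          (lam : ℂ) • (1 : Matrix (Fin N) (Fin N) ℂ) = Complex.I • f := by module
    rw [this, smul_smul, neg_mul, hI, neg_neg, one_smul]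

end SurfaceAlgebra

/-! ### Matrices as a C*-algebra with trace; the two charts. -/

section Bridge

open scoped Matrix.Norms.L2Operator ComplexOrder

variable {N : ℕ}

/-- The matrix trace as a continuous linear form. -/
def traceCLM (N : ℕ) : Matrix (Fin N) (Fin N) ℂ →L[ℂ] ℂ :=
  LinearMap.toContinuousLinearMap (Matrix.traceLinearMap (Fin N) ℂ ℂ)

@[simp] theorem traceCLM_apply (M : Matrix (Fin N) (Fin N) ℂ) : traceCLM N M = M.trace := rfl

theorem isFaithfulTrace_traceCLM : IsFaithfulTrace (traceCLM N) where
  comm a b := Matrix.trace_mul_comm a b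
  map_star a := Matrix.trace_conjTranspose a
  nonneg a := by
    have := (Matrix.posSemidef_conjTranspose_mul_self a).trace_nonneg
    exact (Complex.le_def.mp this).1
  faithful a h := Matrix.trace_conjTranspose_mul_self_eq_zero_iff.mp h

theorem contDiff_matrix_iff {n : WithTop ℕ∞} {X : ℂ → Matrix (Fin N) (Fin N) ℂ} :
    ContDiff ℝ n X ↔ ∀ i j, ContDiff ℝ n (fun z => X z i j) := by
  refine ⟨fun h i j => clm_contDiff (entryCLM i j) h, fun h => ?_⟩
  have : X = fun w => ∑ i, ∑ j, X w i j • Matrix.single i j (1 : ℂ) := by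
    funext w
    conv_lhs => rw [Matrix.matrix_eq_sum_single (X w)]
    simp [Matrix.smul_single]
  rw [this]
  exact ContDiff.sum fun i _ => ContDiff.sum fun j _ => (h i j).smul contDiff_const

theorem dPlus_eq_dz {X : ℂ → Matrix (Fin N) (Fin N) ℂ} {z : ℂ} (h : DifferentiableAt ℝ X z) :
    dPlus X z = dz X z := by
  ext i j
  exact dz_clm (entryCLM i j) h

theorem dMinus_eq_dzb {X : ℂ → Matrix (Fin N) (Fin N) ℂ} {z : ℂ} (h : DifferentiableAt ℝ X z) :
    dMinus X z = dzb X z := by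
  ext i j
  exact dzb_clm (entryCLM i j) h

theorem isCrOnSphere_iff {r : ℕ∞} {X : OnePoint ℂ → Matrix (Fin N) (Fin N) ℂ} :
    IsCrOnSphere r X ↔ ContDiff ℝ r (onPlane X) ∧ ContDiff ℝ r (hat X) := by
  rw [contDiff_matrix_iff, contDiff_matrix_iff]; rfl

theorem hat_zero (X : OnePoint ℂ → Matrix (Fin N) (Fin N) ℂ) : hat X 0 = X OnePoint.infty :=
  if_pos rfl

theorem hat_of_ne_zero (X : OnePoint ℂ → Matrix (Fin N) (Fin N) ℂ) {w : ℂ} (hw : w ≠ 0) :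
    hat X w = onPlane X w⁻¹ := if_neg hw

theorem onPlane_of_ne_zero (X : OnePoint ℂ → Matrix (Fin N) (Fin N) ℂ) {z : ℂ} (hz : z ≠ 0) :
    onPlane X z = hat X z⁻¹ := by
  rw [hat_of_ne_zero X (inv_ne_zero hz), inv_inv]

theorem forall_sphere {p : OnePoint ℂ → Prop} (h1 : ∀ z : ℂ, p z) (h2 : p OnePoint.infty)
    (z : OnePoint ℂ) : p z := by
  induction z using OnePoint.rec with
  | infty => exact h2
  | coe z => exact h1 z

theorem isRankOne_single (i : Fin N) : IsRankOne (traceCLM N) (Matrix.single i i 1) where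
  idem := by simp
  herm := by simp [Matrix.star_eq_conjTranspose]
  sandwich x := by
    ext a b
    simp only [traceCLM_apply, Matrix.trace_mul_single, Matrix.smul_apply, smul_eq_mul]
    simp [Matrix.single_mul_mul_single, Matrix.single_apply]
  trace_one := by simp

/-- Some column of p is nonzero; the projection onto its line lies below p and has the same trace,
so it is p. -/
theorem isRankOne_of_trace {p : Matrix (Fin N) (Fin N) ℂ} (hi : p * p = p) (hh : pᴴ = p)
    (ht : p.trace = 1) : IsRankOne (traceCLM N) p := by
  have hτ := isFaithfulTrace_traceCLM (N := N)
  obtain ⟨i, hne⟩ : ∃ i, p * Matrix.single i i 1 ≠ 0 := by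
    by_contra hcon
    push Not at hcon
    have : p = 0 := by
      ext a b
      have := congrFun (congrFun (hcon b) a) b
      simpa using this
    rw [this] at ht; simp at ht
  have hy : p * Matrix.single i i 1 * Matrix.single i i (1 : ℂ) = p * Matrix.single i i 1 := by
    rw [mul_assoc, (isRankOne_single i).idem]
  have h1 := isRankOne_lineProj hτ (isRankOne_single i) hy hne
  have : p = lineProj (traceCLM N) (p * Matrix.single i i 1) := by
    refine hτ.eq_of_proj hi hh h1.idem h1.herm ?_ ?_
    · rw [lineProj, mul_smul_comm, ← mul_assoc p, ← mul_assoc p p, hi]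
    · rw [h1.trace_one]; exact ht
  rw [this]; exact h1

end Bridge

/-! ### Flag pairs in the coordinate at infinity. -/

section Inversion

variable {A : Type*} [CStarAlgebra A] {τ : A →L[ℂ] ℂ}

theorem lowerForm_inv {P R : ℂ → A} (hP : Differentiable ℝ P) (hR : ∀ w, w ≠ 0 → R w = P w⁻¹)
    {w : ℂ} (hw : w ≠ 0) :
    lowerForm R w = starRingEnd ℂ (-(w⁻¹ ^ 2)) • lowerForm P w⁻¹ := by
  have e : R =ᶠ[𝓝 w] fun w => P w⁻¹ := (eventually_ne_nhds hw).mono hR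
  rw [lowerForm, dzb_congr e, (dz_comp_inv hw (hP _)).2, hR w hw, smul_mul_assoc, lowerForm]

theorem eq_of_eq_away_zero {E : Type*} [TopologicalSpace E] [T2Space E] {f g : ℂ → E}
    (hf : Continuous f) (hg : Continuous g) (h : ∀ z, z ≠ 0 → f z = g z) (z : ℂ) : f z = g z :=
  eq_of_eq_of_ne_zero (u := id) hf hg
    (fun z => by
      rw [eventually_nhdsWithin_iff]
      by_cases hz : z = 0
      · subst hz; exact Filter.Eventually.of_forall fun w hw => hw
      · exact (eventually_ne_nhds hz).mono fun w hw _ => hw) h z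

/-- Flag pairs on the plane extend to the chart at infinity. -/
theorem IsFlagPair.inv {P S R T : ℂ → A} (h : IsFlagPair τ P S)
    (hR : ∀ w, w ≠ 0 → R w = P w⁻¹) (hT : ∀ w, w ≠ 0 → T w = S w⁻¹)
    (cR : ContDiff ℝ 2 R) (cT : ContDiff ℝ 2 T) : IsFlagPair τ R T := by
  have hr := h.isHarmonic
  have kR := cR.continuous
  have kT := cT.continuous
  have hSd : Differentiable ℝ S := h.contDiff_pot.differentiable (by norm_num)
  refine ⟨⟨cR, fun z => ⟨?_, ?_, fun x => ?_, ?_⟩, cT, fun z => ?_, fun z => ?_⟩,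
    fun z => ⟨?_, ?_⟩⟩
  · exact eq_of_eq_away_zero (f := fun z => R z * R z) (kR.mul kR) kR (fun w hw => by rw [hR w hw, hr.idem]) z
  · exact eq_of_eq_away_zero kR.star kR (fun w hw => by rw [hR w hw, hr.herm]) z
  · exact eq_of_eq_away_zero (f := fun z => R z * x * R z) (g := fun z => τ (x * R z) • R z)
      ((kR.mul continuous_const).mul kR)
      ((τ.continuous.comp (continuous_const.mul kR)).smul kR)
      (fun w hw => by rw [hR w hw, (h.rank _).sandwich]) z
  · exact eq_of_eq_away_zero (f := fun z => τ (R z)) (τ.continuous.comp kR) continuous_const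
      (fun w hw => by rw [hR w hw, (h.rank _).trace_one]) z
  · exact eq_of_eq_away_zero kT.star kT (fun w hw => by rw [hT w hw, h.herm_pot]) z
  · refine eq_of_eq_away_zero (g := fun z => -lowerForm R z) (contDiff_dzb (m := 1) cT (by norm_num)).continuous
      (contDiff_lowerForm (m := 1) cR (by norm_num)).continuous.neg (fun w hw => ?_) z
    have e : T =ᶠ[𝓝 w] fun w => S w⁻¹ := (eventually_ne_nhds hw).mono hT
    rw [lowerForm_inv hr.diff hR hw, dzb_congr e, (dz_comp_inv hw (hSd _)).2, h.dzb_pot, smul_neg]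
  · exact eq_of_eq_away_zero (f := fun z => T z * T z) (kT.mul kT) kT (fun w hw => by rw [hT w hw, (h.flag _).1]) z
  · exact eq_of_eq_away_zero (f := fun z => R z * T z) (kR.mul kT) continuous_const
      (fun w hw => by rw [hR w hw, hT w hw, (h.flag _).2]) z

end Inversion

/-! ### Flag pairs on the sphere: lowering to, and raising from, a holomorphic map. -/

section Sphere

open scoped Matrix.Norms.L2Operator

variable {N : ℕ} {r : ℕ∞} {P S Q : OnePoint ℂ → Matrix (Fin N) (Fin N) ℂ}

theorem two_le_of_natCast_le (hr : (N : ℕ∞) + 2 ≤ r) : (2 : WithTop ℕ∞) ≤ r := by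
  have : ((2 : ℕ∞) : WithTop ℕ∞) ≤ r := WithTop.coe_le_coe.mpr (le_add_self.trans hr)
  exact this

theorem IsCrOnSphere.contDiff_onPlane (h : IsCrOnSphere r P) : ContDiff ℝ r (onPlane P) :=
  (isCrOnSphere_iff.mp h).1

theorem IsCrOnSphere.contDiff_hat (h : IsCrOnSphere r P) : ContDiff ℝ r (hat P) :=
  (isCrOnSphere_iff.mp h).2

theorem hat_sub (X Y : OnePoint ℂ → Matrix (Fin N) (Fin N) ℂ) :
    hat (fun z => X z - Y z) = fun w => hat X w - hat Y w := by
  funext w; unfold hat; split_ifs <;> rfl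

theorem hat_const_smul (c : ℂ) (X : OnePoint ℂ → Matrix (Fin N) (Fin N) ℂ) :
    hat (fun z => c • X z) = fun w => c • hat X w := by
  funext w; unfold hat; split_ifs <;> rfl

theorem hat_add (X Y : OnePoint ℂ → Matrix (Fin N) (Fin N) ℂ) :
    hat (fun z => X z + Y z) = fun w => hat X w + hat Y w := by
  funext w; unfold hat; split_ifs <;> rfl

theorem hat_mul (X Y : OnePoint ℂ → Matrix (Fin N) (Fin N) ℂ) :
    hat (fun z => X z * Y z) = fun w => hat X w * hat Y w := by
  funext w; unfold hat; split_ifs <;> rfl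

theorem hat_const (C : Matrix (Fin N) (Fin N) ℂ) : hat (fun _ => C) = fun _ => C := by
  funext w; unfold hat; split_ifs <;> rfl

theorem isCrOnSphere_const (C : Matrix (Fin N) (Fin N) ℂ) : IsCrOnSphere r fun _ => C := by
  rw [isCrOnSphere_iff, hat_const]; exact ⟨contDiff_const, contDiff_const⟩

theorem IsCrOnSphere.add (hP : IsCrOnSphere r P) (hQ : IsCrOnSphere r Q) :
    IsCrOnSphere r fun z => P z + Q z := by
  rw [isCrOnSphere_iff, hat_add]
  exact ⟨hP.contDiff_onPlane.add hQ.contDiff_onPlane, hP.contDiff_hat.add hQ.contDiff_hat⟩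

theorem IsCrOnSphere.sub (hP : IsCrOnSphere r P) (hQ : IsCrOnSphere r Q) :
    IsCrOnSphere r fun z => P z - Q z := by
  rw [isCrOnSphere_iff, hat_sub]
  exact ⟨hP.contDiff_onPlane.sub hQ.contDiff_onPlane, hP.contDiff_hat.sub hQ.contDiff_hat⟩

theorem IsCrOnSphere.mul (hP : IsCrOnSphere r P) (hQ : IsCrOnSphere r Q) :
    IsCrOnSphere r fun z => P z * Q z := by
  rw [isCrOnSphere_iff, hat_mul]
  exact ⟨hP.contDiff_onPlane.mul hQ.contDiff_onPlane, hP.contDiff_hat.mul hQ.contDiff_hat⟩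

theorem IsCrOnSphere.const_smul (c : ℂ) (hP : IsCrOnSphere r P) :
    IsCrOnSphere r fun z => c • P z := by
  rw [isCrOnSphere_iff, hat_const_smul]
  exact ⟨contDiff_const_smul_complex c hP.contDiff_onPlane, contDiff_const_smul_complex c hP.contDiff_hat⟩

theorem isCrOnSphere_sum {Q : ℕ → OnePoint ℂ → Matrix (Fin N) (Fin N) ℂ} {k : ℕ}
    (h : ∀ j < k, IsCrOnSphere r (Q j)) :
    IsCrOnSphere r fun z => ∑ j ∈ Finset.range k, Q j z := by
  induction k with
  | zero => simpa using isCrOnSphere_const 0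
  | succ k ih =>
    simp only [Finset.sum_range_succ]
    exact (ih fun j hj => h j (by omega)).add (h k (by omega))

/-- A flag pair in both charts of the extended plane. -/
structure SphereFlag (r : ℕ∞) (P S : OnePoint ℂ → Matrix (Fin N) (Fin N) ℂ) : Prop where
  crP : IsCrOnSphere r P
  crS : IsCrOnSphere r S
  plane : IsFlagPair (traceCLM N) (onPlane P) (onPlane S)
  chart : IsFlagPair (traceCLM N) (hat P) (hat S)

/-- The conditions at infinity come for free: they are closed and hold in the inverse chart off w =
0. -/
theorem SphereFlag.of_plane (h2 : (2 : WithTop ℕ∞) ≤ r) (crP : IsCrOnSphere r P)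
    (crS : IsCrOnSphere r S) (h : IsFlagPair (traceCLM N) (onPlane P) (onPlane S)) :
    SphereFlag r P S :=
  ⟨crP, crS, h, h.inv (fun _ hw => hat_of_ne_zero P hw) (fun _ hw => hat_of_ne_zero S hw)
    (crP.contDiff_hat.of_le h2) (crS.contDiff_hat.of_le h2)⟩

theorem SphereFlag.rank (h : SphereFlag r P S) (z : OnePoint ℂ) :
    IsRankOne (traceCLM N) (P z) :=
  forall_sphere (p := fun z => IsRankOne (traceCLM N) (P z)) h.plane.rank
    (by rw [← hat_zero P]; exact h.chart.rank 0) z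

theorem SphereFlag.herm (h : SphereFlag r P S) (z : OnePoint ℂ) : (S z)ᴴ = S z :=
  forall_sphere (p := fun z => (S z)ᴴ = S z) h.plane.herm_pot
    (by rw [← hat_zero S]; exact h.chart.herm_pot 0) z

theorem SphereFlag.flag (h : SphereFlag r P S) (z : OnePoint ℂ) :
    S z * S z = S z ∧ P z * S z = 0 ∧ S z * P z = 0 := by
  have h1 : S z * S z = S z ∧ P z * S z = 0 :=
    forall_sphere (p := fun z => S z * S z = S z ∧ P z * S z = 0) h.plane.flag
      (by rw [← hat_zero S, ← hat_zero P]; exact h.chart.flag 0) z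
  refine ⟨h1.1, h1.2, ?_⟩
  have := congrArg star h1.2
  rw [star_mul, (h.rank z).herm, star_zero] at this
  rwa [← h.herm z]

theorem IsProjectorMap.isRankOne (h : IsProjectorMap r P) (z : OnePoint ℂ) :
    IsRankOne (traceCLM N) (P z) :=
  isRankOne_of_trace (h.idem z) (h.herm z) (h.trace_one z)

theorem SphereFlag.isProjectorMap (h : SphereFlag r P S) : IsProjectorMap r P :=
  ⟨h.crP, fun z => (h.rank z).idem, fun z => (h.rank z).herm, fun z => (h.rank z).trace_one⟩

/-- The lowering operator on the extended plane. -/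
theorem SphereFlag.exists_lowered (h2 : (2 : WithTop ℕ∞) ≤ r) (h : SphereFlag r P S)
    (hW : ∃ z, lowerForm (onPlane P) z ≠ 0) :
    ∃ Q, SphereFlag r Q (fun z => S z - Q z) ∧
      ∀ z, raiseForm (onPlane Q) z = -star (lowerForm (onPlane P) z) := by
  have hτ := isFaithfulTrace_traceCLM (N := N)
  have hWinv : ∀ w : ℂ, w ≠ 0 → lowerForm (hat P) w =
      starRingEnd ℂ (-(w⁻¹ ^ 2)) • lowerForm (onPlane P) w⁻¹ := fun w hw =>
    lowerForm_inv h.plane.isHarmonic.diff (fun _ hw => hat_of_ne_zero P hw) hw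
  have hc : ∀ w : ℂ, w ≠ 0 → starRingEnd ℂ (-(w⁻¹ ^ 2)) ≠ 0 := fun w hw => by
    simpa using hw
  have hWp := h.plane.lowerForm_ne_zero hτ hW
  have hW' : ∃ w, lowerForm (hat P) w ≠ 0 := by
    have h1 : ∀ᶠ w in 𝓝[≠] (0 : ℂ), w ≠ 0 ∧ lowerForm (onPlane P) w ≠ 0 :=
      (eventually_mem_nhdsWithin (s := {(0 : ℂ)}ᶜ)).and (hWp 0)
    obtain ⟨w, hw, hw'⟩ := h1.exists
    refine ⟨w⁻¹, ?_⟩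
    rw [hWinv _ (inv_ne_zero hw), inv_inv]
    exact smul_ne_zero (by simpa using hw) hw'
  have hWh := h.chart.lowerForm_ne_zero hτ hW'
  obtain ⟨Qp, cQp, rQp, hQp⟩ := h.plane.exists_lowered hτ h2 h.crP.contDiff_onPlane h.crS.contDiff_onPlane hW
  obtain ⟨Qh, cQh, rQh, hQh⟩ := h.chart.exists_lowered hτ h2 h.crP.contDiff_hat h.crS.contDiff_hat hW'
  -- The change of chart only rescales W, so both constructions give the line of W off its zeros and
  -- agree by continuity; this allows gluing.
  have hQ : ∀ w, w ≠ 0 → Qh w = Qp w⁻¹ := by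
    intro w hw
    have t1 : Filter.Tendsto (fun w => Qp w⁻¹) (𝓝[≠] w) (𝓝 (Qp w⁻¹)) :=
      ((cQp.continuous.continuousAt.comp (continuousAt_inv₀ hw)).tendsto).mono_left
        nhdsWithin_le_nhds
    refine tendsto_nhds_unique_of_eventuallyEq
      (cQh.continuous.continuousAt.tendsto.mono_left nhdsWithin_le_nhds) t1 ?_
    filter_upwards [hWh w, (eventually_ne_nhds hw).filter_mono nhdsWithin_le_nhds] with v hv hv0
    have hv' := hv
    rw [hWinv v hv0] at hv'
    rw [hQh v hv, hQp v⁻¹ (smul_ne_zero_iff.mp hv').2, hWinv v hv0, lineProj_smul (hc v hv0)]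
  set Q : OnePoint ℂ → Matrix (Fin N) (Fin N) ℂ := fun z => z.elim (Qh 0) Qp with hQdef
  have hpl : onPlane Q = Qp := rfl
  have hht : hat Q = Qh := by
    funext w
    by_cases hw : w = 0
    · rw [hw, hat_zero]; rfl
    · rw [hat_of_ne_zero Q hw, hpl, hQ w hw]
  have crQ : IsCrOnSphere r Q := isCrOnSphere_iff.mpr ⟨by rwa [hpl], by rwa [hht]⟩
  have hlow := h.plane.lower hτ (cQp.of_le h2) rQp (fun z => by
    by_cases hz : lowerForm (onPlane P) z = 0
    · simp [hz]
    · rw [hQp z hz]; exact lineProj_spec hτ hz) hWp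
  exact ⟨Q, SphereFlag.of_plane h2 crQ (h.crS.sub crQ) hlow.1, hlow.2⟩

/-- When ∂₋P P = 0 the frame of P is holomorphic, and applying it to a fixed nonzero vector of the
range of `P z₀` gives a local holomorphic section. -/
theorem isHolomorphic_of_lowerForm (h2 : (2 : WithTop ℕ∞) ≤ r) (h : IsProjectorMap r P)
    (hW : ∀ z, lowerForm (onPlane P) z = 0) : IsHolomorphic P := by
  intro z₀
  have cP := h.cr.contDiff_onPlane.of_le h2
  have hi : ∀ z, onPlane P z * onPlane P z = onPlane P z := fun z => h.idem z
  obtain ⟨u, hu⟩ : ∃ u, onPlane P z₀ *ᵥ u ≠ 0 := by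
    by_contra hcon
    push Not at hcon
    have h0 : onPlane P z₀ = 0 := by
      ext i j
      have := congrFun (hcon (Pi.single j 1)) i
      simpa using this
    have h1 := h.trace_one z₀
    rw [show P z₀ = 0 from h0] at h1
    simp at h1
  set E := fun w => frame (onPlane P z₀) (onPlane P w) with hE
  have hev := eventually_isUnit_intertwiner cP.continuous.continuousAt (hi z₀)
  have hEd : ∀ᶠ z in 𝓝 z₀, DifferentiableAt ℂ E z := by
    filter_upwards [hev.eventually_nhds] with z hz
    have hd : DifferentiableAt ℝ E z :=
      (contDiffAt_frame cP.contDiffAt hz.self_of_nhds).differentiableAt (by norm_num)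
    exact differentiableAt_complex_of_dzb_eq_zero hd
      (dzb_frame (hi z₀) (cP.differentiable (by norm_num) z) (Filter.Eventually.of_forall hi)
        (hW z) hz hd)
  have hfd : ∀ z, DifferentiableAt ℂ E z →
      DifferentiableAt ℂ (fun w => E w *ᵥ (onPlane P z₀ *ᵥ u)) z := by
    intro z hz
    rw [differentiableAt_pi]
    intro i
    simp only [Matrix.mulVec, dotProduct]
    refine DifferentiableAt.fun_sum fun j _ => DifferentiableAt.mul_const ?_ _
    exact (entryCLM i j).differentiableAt.comp z hz
  have h0 : E z₀ *ᵥ (onPlane P z₀ *ᵥ u) ≠ 0 := by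
    rw [hE]; simp only [frame_self (hi z₀), Matrix.mulVec_mulVec, hi]; exact hu
  refine ⟨fun z => E z *ᵥ (onPlane P z₀ *ᵥ u), ?_⟩
  filter_upwards [hEd, (hfd z₀ hEd.self_of_nhds).continuousAt.eventually_ne h0] with z hz hz0
  refine ⟨hfd z hz, hz0, ?_⟩
  rw [Matrix.mulVec_mulVec, hE]
  simp only [proj_mul_frame (hi z)]

/-- Let Y be the matrix all of whose columns are the holomorphic vector. Then ∂₋ of PY = Y gives ∂₋P
Y = 0, and YY* is a nonzero multiple of P. -/
theorem IsHolomorphic.lowerForm_eq_zero (h2 : (2 : WithTop ℕ∞) ≤ r) (h : IsProjectorMap r P)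
    (hol : IsHolomorphic P) (z : ℂ) : lowerForm (onPlane P) z = 0 := by
  have hτ := isFaithfulTrace_traceCLM (N := N)
  have hPd : Differentiable ℝ (onPlane P) := (h.cr.contDiff_onPlane.of_le h2).differentiable (by norm_num)
  obtain ⟨f, hf⟩ := hol z
  set Y : ℂ → Matrix (Fin N) (Fin N) ℂ := fun w => Matrix.vecMulVec (f w) 1 with hY
  have hfz := hf.self_of_nhds
  have hYd : DifferentiableAt ℝ Y z := differentiableAt_matrix fun i j => by
    simp only [hY, Matrix.vecMulVec_apply, Pi.one_apply, mul_one]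
    exact ((differentiableAt_pi.mp hfz.1) i).restrictScalars ℝ
  have hY0 : dzb Y z = 0 := by
    ext i j
    have e : dzb Y z i j = dzb (fun w => Y w i j) z := (dzb_clm (entryCLM i j) hYd).symm
    rw [e]
    simp only [hY, Matrix.vecMulVec_apply, Pi.one_apply, mul_one]
    have hfi : DifferentiableAt ℂ (fun w => f w i) z := (differentiableAt_pi.mp hfz.1) i
    have := (differentiableAt_complex_iff_differentiableAt_real.mp hfi).2
    rw [dzb, this, smul_smul, Complex.I_mul_I]; simp
  have hPY : ∀ᶠ w in 𝓝 z, onPlane P w * Y w = Y w := hf.mono fun w hw => by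
    rw [hY]; simp only [Matrix.mul_vecMulVec, hw.2.2]
  have e1 := dzb_congr hPY
  rw [dzb_mul (hPd z) hYd, hY0, mul_zero, add_zero] at e1
  have hne : Y z ≠ 0 := by
    intro h0
    apply hfz.2.1
    funext i
    have := congrFun (congrFun h0 i) i
    simpa [hY, Matrix.vecMulVec_apply] using this
  have e2 := (h.isRankOne z).self_mul_star hτ hPY.self_of_nhds
  have e3 : traceCLM N (star (Y z) * Y z) • (dzb (onPlane P) z * onPlane P z) = 0 := by
    rw [← mul_smul_comm]
    change _ * (_ • P z) = 0
    rw [← e2, ← mul_assoc, e1, zero_mul]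
  exact (smul_eq_zero.mp e3).resolve_left (hτ.ne_zero hne)

theorem raisingNum_eq (h : IsHarmonic (traceCLM N) (onPlane P)) (z : ℂ) :
    raisingNum P z = raiseForm (onPlane P) z * star (raiseForm (onPlane P) z) := by
  rw [raisingNum, dPlus_eq_dz (h.diff z), dMinus_eq_dzb (h.diff z), star_raiseForm h.herm,
    raiseForm, ← mul_assoc, mul_assoc _ (onPlane P z) (onPlane P z), h.idem]

/-- Since the raising form of Q is −W*, the raising numerator of Q is W*W, a multiple of P. -/
theorem isRaising_of_raiseForm (h : IsHarmonic (traceCLM N) (onPlane P))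
    (hQ : IsHarmonic (traceCLM N) (onPlane Q))
    (hQP : ∀ z, raiseForm (onPlane Q) z = -star (lowerForm (onPlane P) z))
    (hW : ∃ z, lowerForm (onPlane P) z ≠ 0) : IsRaising Q P := by
  have hτ := isFaithfulTrace_traceCLM (N := N)
  have e : ∀ z, raisingNum Q z =
      traceCLM N (star (lowerForm (onPlane P) z) * lowerForm (onPlane P) z) • onPlane P z :=
    fun z => by
      rw [raisingNum_eq hQ, hQP, star_neg, star_star, neg_mul_neg]
      exact (h.rank z).star_mul_self (h.W_P z)
  have et : ∀ z, (onPlane P z).trace = 1 := fun z => (h.rank z).trace_one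
  refine ⟨?_, fun z => ?_⟩
  · obtain ⟨z, hz⟩ := hW
    refine ⟨z, ?_⟩
    rw [e]
    refine smul_ne_zero (hτ.ne_zero hz) fun h0 => ?_
    have := et z
    rw [h0] at this; simp at this
  · rw [e, Matrix.trace_smul, et, smul_eq_mul, mul_one]

/-- A flag pair without constant directions arises from a holomorphic map by raising. -/
theorem SphereFlag.exists_tower (h2 : (2 : WithTop ℕ∞) ≤ r) (k : ℕ) :
    ∀ {P S : OnePoint ℂ → Matrix (Fin N) (Fin N) ℂ}, SphereFlag r P S →
    (∀ z : ℂ, (onPlane S z).trace = k) →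
    (∀ C : Matrix (Fin N) (Fin N) ℂ, (∀ z, onPlane S z * C = C) → C = 0) →
    ∃ Q : ℕ → OnePoint ℂ → Matrix (Fin N) (Fin N) ℂ, IsHolomorphic (Q 0) ∧
      (∀ j ≤ k, IsProjectorMap r (Q j)) ∧ (∀ j < k, IsRaising (Q j) (Q (j + 1))) ∧ Q k = P ∧
      ∀ z, S z = ∑ j ∈ Finset.range k, Q j z := by
  have hτ := isFaithfulTrace_traceCLM (N := N)
  induction k with
  | zero =>
    intro P S h htr _
    have hS0 : ∀ z, onPlane S z = 0 := fun z => hτ.faithful _ <| by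
      rw [h.plane.herm_pot, (h.plane.flag z).1, traceCLM_apply, htr]; simp
    have hS0' : ∀ z, S z = 0 := forall_sphere (p := fun z => S z = 0) hS0 <| by
      rw [← hat_zero S]
      exact eq_of_eq_away_zero h.crS.contDiff_hat.continuous continuous_const
        (fun w hw => by rw [hat_of_ne_zero S hw, hS0]) 0
    refine ⟨fun _ => P, isHolomorphic_of_lowerForm h2 h.isProjectorMap fun z => ?_,
      fun _ _ => h.isProjectorMap, by simp, rfl, fun z => by simp [hS0' z]⟩
    have e1 := h.plane.dzb_pot z
    rw [show onPlane S = fun _ => 0 from funext hS0, dzb_const] at e1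
    exact neg_eq_zero.mp e1.symm
  | succ k ih =>
    intro P S h htr hC
    by_cases hW : ∃ z, lowerForm (onPlane P) z ≠ 0
    · obtain ⟨Q', hQ', hraise⟩ := h.exists_lowered h2 hW
      obtain ⟨Q, q0, q1, q2, q3, q4⟩ := ih hQ' (fun z => by
          have e1 : (Q' z).trace = 1 := (hQ'.rank z).trace_one
          have e2 : (S z).trace = ((k + 1 : ℕ) : ℂ) := htr z
          change (S z - Q' z).trace = _
          rw [Matrix.trace_sub, e1, e2]; push_cast; ring) (fun C hCz => by
          -- A matrix fixed by S − Q' is annihilated by Q', hence fixed by S: the absence of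
          -- constant directions is inherited.
          refine hC C fun z => ?_
          have f1 := (hQ'.plane.flag z)
          have e1 : (onPlane S z - onPlane Q' z) * C = C := hCz z
          have e2 : onPlane Q' z * (onPlane S z - onPlane Q' z) = 0 := f1.2
          have e3 : onPlane Q' z * C = 0 := by rw [← e1, ← mul_assoc, e2, zero_mul]
          rwa [sub_mul, e3, sub_zero] at e1)
      refine ⟨Function.update Q (k + 1) P, by simpa using q0, fun j hj => ?_, fun j hj => ?_,
        by simp, fun z => ?_⟩
      · rcases Nat.lt_or_ge k j with hjk | hjk
        · obtain rfl : j = k + 1 := by omega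
          simpa using h.isProjectorMap
        · rw [Function.update_of_ne (by omega)]; exact q1 j hjk
      · rw [Function.update_of_ne (by omega)]
        rcases Nat.lt_or_ge j k with hjk | hjk
        · rw [Function.update_of_ne (by omega)]; exact q2 j hjk
        · obtain rfl : j = k := by omega
          rw [Function.update_self, q3]
          exact isRaising_of_raiseForm h.plane.isHarmonic hQ'.plane.isHarmonic hraise hW
      · rw [Finset.sum_range_succ, Function.update_of_ne (by omega), q3,
          Finset.sum_congr rfl fun j hj => by
            rw [Function.update_of_ne (by have := Finset.mem_range.mp hj; omega)], ← q4]
        abel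
    -- If W vanished identically, S would be a constant projector fixing its own value. The
    -- hypothesis then forces S = 0, against its trace k + 1.
    · exfalso
      push Not at hW
      have hSd : Differentiable ℝ (onPlane S) :=
        h.plane.contDiff_pot.differentiable (by norm_num)
      have hconst : ∀ z w, onPlane S z = onPlane S w :=
        is_const_of_fderiv_eq_zero (𝕜 := ℝ) hSd fun z => fderiv_eq_zero_of_dz_dzb
          (by rw [h.plane.dz_pot, hW]; simp) (by rw [h.plane.dzb_pot, hW]; simp)
      have h0 := hC (onPlane S 0) fun z => by rw [hconst z 0, (h.plane.flag 0).1]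
      have := htr 0
      rw [h0, Matrix.trace_zero] at this
      exact absurd this.symm (Nat.cast_ne_zero.mpr (by omega))

/-- The flag pairs obtained from a holomorphic map by raising. -/
theorem SphereFlag.of_tower (h2 : (2 : WithTop ℕ∞) ≤ r) {k : ℕ}
    {Q : ℕ → OnePoint ℂ → Matrix (Fin N) (Fin N) ℂ} (h0 : IsHolomorphic (Q 0))
    (hQ : ∀ j ≤ k, IsProjectorMap r (Q j)) (hR : ∀ j < k, IsRaising (Q j) (Q (j + 1))) :
    SphereFlag r (Q k) (fun z => ∑ j ∈ Finset.range k, Q j z) := by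
  have hτ := isFaithfulTrace_traceCLM (N := N)
  refine SphereFlag.of_plane h2 (hQ k le_rfl).cr
    (isCrOnSphere_sum fun j hj => (hQ j hj.le).cr) ?_
  have key : ∀ l ≤ k, IsFlagPair (traceCLM N) (onPlane (Q l))
      (fun z => ∑ j ∈ Finset.range l, onPlane (Q j) z) := by
    intro l
    induction l with
    | zero =>
      intro hl
      simp only [Finset.range_zero, Finset.sum_empty]
      refine ⟨⟨(hQ 0 hl).cr.contDiff_onPlane.of_le h2, fun z => (hQ 0 hl).isRankOne z, contDiff_const,
        by simp, fun z => ?_⟩, fun z => ⟨by simp, by simp⟩⟩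
      rw [dzb_const, h0.lowerForm_eq_zero h2 (hQ 0 hl), neg_zero]
    | succ l ih =>
      intro hl
      have h1 := ih (by omega)
      have hr := hR l (by omega)
      simp only [Finset.sum_range_succ]
      refine (h1.raise hτ ((hQ _ hl).cr.contDiff_onPlane.of_le h2) (fun z => (hQ _ hl).isRankOne z)
        (fun z => ?_) (h1.raiseForm_ne_zero hτ ?_)).1
      · rw [← raisingNum_eq h1.isHarmonic]; exact hr.2 z
      · obtain ⟨z, hz⟩ := hr.1
        refine ⟨z, fun h0 => hz ?_⟩
        rw [raisingNum_eq h1.isHarmonic, h0, zero_mul]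
  exact key k le_rfl

end Sphere

/-! ### Finite action, the Weierstrass formula and the surface. -/

section Surface

open scoped Matrix.Norms.L2Operator

variable {N : ℕ} {r : ℕ∞} {F P S : OnePoint ℂ → Matrix (Fin N) (Fin N) ℂ}

/-- Regularity at infinity gives decay like |z|⁻⁴, integrable in real dimension 2. The constant 16 =
2⁴ comes from 1 + |z| ≤ 2 inside the unit disc and |z|⁻¹(1 + |z|) ≤ 2 outside it. -/
theorem integrable_of_inv_chart {g h : ℂ → ℂ} (hg : Continuous g) (hh : Continuous h)
    (hgh : ∀ z, z ≠ 0 → ‖g z‖ = ‖z⁻¹‖ ^ 4 * ‖h z⁻¹‖) : Integrable g := by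
  obtain ⟨C₁, hC₁⟩ := (isCompact_closedBall (0 : ℂ) 1).exists_bound_of_continuousOn hg.continuousOn
  obtain ⟨C₂, hC₂⟩ := (isCompact_closedBall (0 : ℂ) 1).exists_bound_of_continuousOn hh.continuousOn
  have hC₁0 : 0 ≤ C₁ := (norm_nonneg _).trans (hC₁ 0 (by simp))
  have hC₂0 : 0 ≤ C₂ := (norm_nonneg _).trans (hC₂ 0 (by simp))
  have hI : Integrable (fun z : ℂ => (16 * (C₁ + C₂)) * (1 + ‖z‖) ^ (-(4 : ℝ))) :=
    (integrable_one_add_norm (by rw [Complex.finrank_real_complex]; norm_num)).const_mul _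
  refine hI.mono' hg.aestronglyMeasurable (Filter.Eventually.of_forall fun z => ?_)
  have hpos : 0 < 1 + ‖z‖ := by positivity
  have e : (1 + ‖z‖) ^ (-(4 : ℝ)) = ((1 + ‖z‖) ^ 4)⁻¹ := by
    rw [Real.rpow_neg hpos.le]; norm_cast
  rw [e, ← div_eq_mul_inv, le_div_iff₀ (by positivity)]
  rcases le_total ‖z‖ 1 with hz | hz
  · have h1 : ‖g z‖ ≤ C₁ := hC₁ z (by simpa using hz)
    have h2 : (1 + ‖z‖) ^ 4 ≤ 2 ^ 4 := by gcongr; linarith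
    calc ‖g z‖ * (1 + ‖z‖) ^ 4 ≤ C₁ * 2 ^ 4 := by gcongr
      _ ≤ 16 * (C₁ + C₂) := by linarith
  · have hz0 : z ≠ 0 := by rintro rfl; simp at hz; linarith
    have h1 : ‖h z⁻¹‖ ≤ C₂ := hC₂ z⁻¹ (by simpa using inv_le_one_of_one_le₀ hz)
    have h2 : ‖z⁻¹‖ * (1 + ‖z‖) ≤ 2 := by
      rw [norm_inv, inv_mul_le_iff₀ (by positivity)]; linarith
    rw [hgh z hz0]
    calc ‖z⁻¹‖ ^ 4 * ‖h z⁻¹‖ * (1 + ‖z‖) ^ 4 = (‖z⁻¹‖ * (1 + ‖z‖)) ^ 4 * ‖h z⁻¹‖ := by ring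
      _ ≤ 2 ^ 4 * C₂ := by gcongr
      _ ≤ 16 * (C₁ + C₂) := by linarith

/-- Every `C^2` map on the extended plane has finite action. -/
theorem IsCrOnSphere.integrable_density (h2 : (2 : WithTop ℕ∞) ≤ r) (hP : IsCrOnSphere r P) :
    Integrable (fun z : ℂ => (dPlus (onPlane P) z * dMinus (onPlane P) z).trace) volume := by
  have c1 := hP.contDiff_onPlane.of_le h2
  have c2 := hP.contDiff_hat.of_le h2
  have d1 : Differentiable ℝ (onPlane P) := c1.differentiable (by norm_num)
  have d2 : Differentiable ℝ (hat P) := c2.differentiable (by norm_num)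
  have hcont : ∀ {X : ℂ → Matrix (Fin N) (Fin N) ℂ}, ContDiff ℝ 2 X →
      Continuous fun z => traceCLM N (dz X z * dzb X z) := fun hX =>
    (traceCLM N).continuous.comp ((contDiff_dz (m := 1) hX (by norm_num)).continuous.mul
      (contDiff_dzb (m := 1) hX (by norm_num)).continuous)
  have e : (fun z : ℂ => (dPlus (onPlane P) z * dMinus (onPlane P) z).trace) =
      fun z => traceCLM N (dz (onPlane P) z * dzb (onPlane P) z) := by
    funext z; rw [dPlus_eq_dz (d1 z), dMinus_eq_dzb (d1 z), traceCLM_apply]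
  rw [e]
  refine integrable_of_inv_chart (hcont c1) (hcont c2) fun z hz => ?_
  have ev : onPlane P =ᶠ[𝓝 z] fun w => hat P w⁻¹ :=
    (eventually_ne_nhds hz).mono fun w hw => onPlane_of_ne_zero P hw
  obtain ⟨i1, i2⟩ := dz_comp_inv hz (d2 z⁻¹)
  rw [dz_congr ev, dzb_congr ev, i1, i2, smul_mul_smul_comm, map_smul, norm_smul, norm_mul,
    RCLike.norm_conj, norm_neg, norm_pow]
  ring

theorem IsFiniteActionSolution.isHarmonic (h2 : (2 : WithTop ℕ∞) ≤ r)
    (h : IsFiniteActionSolution r P) : IsHarmonic (traceCLM N) (onPlane P) where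
  contDiff := h.projector.cr.contDiff_onPlane.of_le h2
  rank z := h.projector.isRankOne z
  el z := by
    have c1 := h.projector.cr.contDiff_onPlane.of_le h2
    have e : dMinus (onPlane P) = dzb (onPlane P) :=
      funext fun w => dMinus_eq_dzb (c1.differentiable (by norm_num) w)
    have := h.euler_lagrange z
    rw [e, dPlus_eq_dz ((contDiff_dzb (m := 1) c1 (by norm_num)).differentiable (by norm_num) z)]
      at this
    exact sub_eq_zero.mp this

theorem SphereFlag.isFiniteActionSolution (h2 : (2 : WithTop ℕ∞) ≤ r) (h : SphereFlag r P S) :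
    IsFiniteActionSolution r P where
  projector := h.isProjectorMap
  euler_lagrange z := by
    have hr := h.plane.isHarmonic
    have e : dMinus (onPlane P) = dzb (onPlane P) := funext fun w => dMinus_eq_dzb (hr.diff w)
    rw [e, dPlus_eq_dz (hr.diff_dzb z)]
    exact sub_eq_zero.mpr (hr.el z)
  finite_action := h.crP.integrable_density h2

theorem dPlus_sub_const (X : ℂ → Matrix (Fin N) (Fin N) ℂ) (C : Matrix (Fin N) (Fin N) ℂ) :
    dPlus (fun z => X z - C) = dPlus X := by
  funext z; ext i j; simp [dPlus, fderiv_sub_const]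

theorem dMinus_sub_const (X : ℂ → Matrix (Fin N) (Fin N) ℂ) (C : Matrix (Fin N) (Fin N) ℂ) :
    dMinus (fun z => X z - C) = dMinus X := by
  funext z; ext i j; simp [dMinus, fderiv_sub_const]

theorem hasWeierstrassDifferential_sub_const (C : Matrix (Fin N) (Fin N) ℂ) :
    HasWeierstrassDifferential (fun z => F z - C) P ↔ HasWeierstrassDifferential F P := by
  have e : onPlane (fun z => F z - C) = fun z => onPlane F z - C := rfl
  simp only [HasWeierstrassDifferential, e, dPlus_sub_const, dMinus_sub_const]

/-- Shifting by the identity changes neither derivatives nor commutators, so (b), written with P − I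
= (F − i(λ−1))², can be read with P. -/
theorem hasWeierstrassDifferential_sub_one :
    HasWeierstrassDifferential F (fun z => P z - 1) ↔ HasWeierstrassDifferential F P := by
  have e : onPlane (fun z => P z - 1) = fun z => onPlane P z - 1 := rfl
  simp only [HasWeierstrassDifferential, e, dPlus_sub_const, dMinus_sub_const, mul_sub, sub_mul,
    mul_one, one_mul, sub_sub_sub_cancel_right]

/-- The surface, up to constants and the projector, is a potential for the lowering form. -/
theorem HasWeierstrassDifferential.dzb_potential (h2 : (2 : WithTop ℕ∞) ≤ r)
    (hF : IsCrOnSphere r F) (cP : IsCrOnSphere r P) (hi : ∀ z, P z * P z = P z)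
    (hW : HasWeierstrassDifferential F P) (C : Matrix (Fin N) (Fin N) ℂ) (z : ℂ) :
    dzb (fun z => (1 / 2 : ℂ) • (Complex.I • onPlane F z + C - onPlane P z)) z =
      -lowerForm (onPlane P) z := by
  have dF : Differentiable ℝ (onPlane F) := (hF.contDiff_onPlane.of_le h2).differentiable (by norm_num)
  have dP : Differentiable ℝ (onPlane P) := (cP.contDiff_onPlane.of_le h2).differentiable (by norm_num)
  have dIF : DifferentiableAt ℝ (fun z => Complex.I • onPlane F z) z :=
    clm_differentiableAt (Complex.I • ContinuousLinearMap.id ℂ _) (dF z)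
  have e1 := (hW z).2
  rw [dMinus_eq_dzb (dF z), dMinus_eq_dzb (dP z)] at e1
  have e2 := dzb_idem dP (fun z => hi z) z
  rw [dzb_const_smul (f := fun z => Complex.I • onPlane F z + C - onPlane P z) _
      ((dIF.add (differentiableAt_const _)).sub (dP z)),
    dzb_sub (f := fun z => Complex.I • onPlane F z + C) (dIF.add (differentiableAt_const _)) (dP z),
    dzb_add dIF (differentiableAt_const _), dzb_const, dzb_const_smul _ (dF z), e1, smul_smul,
    Complex.I_mul_I, lowerForm]
  -- Splitting ∂₋P as ∂₋P P + P ∂₋P gives ½(−[∂₋P, P] − ∂₋P) = −∂₋P P.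
  nth_rewrite 3 [← e2]
  module

theorem SphereFlag.surfaceConditions {k : ℕ} {lam : ℝ} (h : SphereFlag r P S) (hk : k < N)
    (htr : ∀ z, (S z).trace = k) (hF : ∀ z, F z = surfacePoint lam (P z) (S z))
    (hW : HasWeierstrassDifferential F P) :
    SurfaceConditions k lam F ∧ P = surfaceProjector lam F := by
  have hsq : shiftSq lam F = fun z => P z - 1 := by
    funext z
    have hf := h.flag z
    rw [shiftSq, hF z, surfacePoint_sq (h.rank z).idem hf.1 hf.2.1 hf.2.2]
  refine ⟨⟨fun z => ?_, ?_⟩, ?_⟩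
  · have hf := h.flag z
    rw [hF z]
    exact surfacePoint_charpoly (h.rank z).idem hf.1 hf.2.1 hf.2.2 (h.rank z).herm (h.herm z)
      (h.rank z).trace_one hk (htr z) lam
  · rw [hsq]; exact hasWeierstrassDifferential_sub_one.mpr hW
  · funext z; rw [surfaceProjector, hsq]; simp

/-- S is the spectral projection of F for the eigenvalue i(λ−2), and P that for i(λ−1). Condition
(a) gives the flag relations and (b) makes S a potential. -/
theorem SurfaceConditions.exists_sphereFlag (h2 : (2 : WithTop ℕ∞) ≤ r) (hF : IsCrOnSphere r F)
    (hsk : ∀ z, (F z)ᴴ = -F z) {k : ℕ} (hk : k < N) {lam : ℝ} (h : SurfaceConditions k lam F) :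
    HasWeierstrassDifferential F (surfaceProjector lam F) ∧
    ∃ S, SphereFlag r (surfaceProjector lam F) S ∧ (∀ z, (S z).trace = k) ∧
      ∀ z, F z = surfacePoint lam (surfaceProjector lam F z) (S z) := by
  set P := surfaceProjector lam F with hP
  set S : OnePoint ℂ → Matrix (Fin N) (Fin N) ℂ := fun z =>
    (1 / 2 : ℂ) • (Complex.I • F z + (lam : ℂ) • (1 : Matrix (Fin N) (Fin N) ℂ) - P z) with hS
  have hsq : shiftSq lam F = fun z => P z - 1 := by
    funext z; rw [hP, surfaceProjector]; simp
  have hW : HasWeierstrassDifferential F P := by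
    have := h.2
    rwa [hsq, hasWeierstrassDifferential_sub_one] at this
  have alg := fun z => projections_of_charpoly (hsk z) hk (h.1 z) (p := P z) (s := S z) rfl rfl
  have hsh : IsCrOnSphere r fun z =>
      F z - (Complex.I * ((lam : ℂ) - 1)) • (1 : Matrix (Fin N) (Fin N) ℂ) :=
    hF.sub (isCrOnSphere_const _)
  have crP : IsCrOnSphere r P := by
    have : P = fun z => (F z - (Complex.I * ((lam : ℂ) - 1)) • (1 : Matrix (Fin N) (Fin N) ℂ)) *
        (F z - (Complex.I * ((lam : ℂ) - 1)) • (1 : Matrix (Fin N) (Fin N) ℂ)) + 1 := by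
      funext z; rw [hP, surfaceProjector, shiftSq, pow_two]
    rw [this]
    exact (hsh.mul hsh).add (isCrOnSphere_const 1)
  have crS : IsCrOnSphere r S :=
    ((((hF.const_smul _).add (isCrOnSphere_const _))).sub crP).const_smul _
  refine ⟨hW, S, SphereFlag.of_plane h2 crP crS ⟨⟨crP.contDiff_onPlane.of_le h2, fun z => ?_,
    crS.contDiff_onPlane.of_le h2, fun z => (alg z).2.2.2.2.1, fun z => ?_⟩, fun z => ?_⟩,
    fun z => (alg z).2.2.2.2.2.2.1, fun z => (alg z).2.2.2.2.2.2.2⟩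
  · exact isRankOne_of_trace (alg z).1 (alg z).2.2.2.1 (alg z).2.2.2.2.2.1
  · exact hW.dzb_potential h2 hF crP (fun z => (alg z).1) _ z
  · exact ⟨(alg z).2.1, (alg z).2.2.1⟩

theorem SphereFlag.trace_eq {c : ℂ} (h : SphereFlag r P S) (htr : ∀ z, (onPlane S z).trace = c)
    (z : OnePoint ℂ) : (S z).trace = c :=
  forall_sphere (p := fun z => (S z).trace = c) htr (by
    rw [← hat_zero S]
    exact eq_of_eq_away_zero (f := fun w => traceCLM N (hat S w))
      ((traceCLM N).continuous.comp h.crS.contDiff_hat.continuous) continuous_const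
      (fun w hw => by rw [hat_of_ne_zero S hw]; exact htr _) 0) z

/-- For a traceless surface this forces λN = 1 + 2k. -/
theorem trace_surfacePoint {lam : ℝ} {p s : Matrix (Fin N) (Fin N) ℂ} {k : ℕ}
    (hp : p.trace = 1) (hs : s.trace = k) :
    (surfacePoint lam p s).trace = -Complex.I * (1 + 2 * k - lam * N) := by
  simp [surfacePoint, Matrix.trace_sub, Matrix.trace_add, Matrix.trace_smul, hp, hs]

theorem IsFull.eq_zero_of_mul_eq_zero (h : IsFull P) {C : Matrix (Fin N) (Fin N) ℂ}
    (hC : ∀ z, C * onPlane P z = 0) : C = 0 := by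
  have hspan : Submodule.span ℂ
      {v : Fin N → ℂ | ∃ (z : ℂ) (u : Fin N → ℂ), v = onPlane P z *ᵥ u} ≤
      LinearMap.ker (Matrix.mulVecLin C) := by
    rw [Submodule.span_le]
    rintro v ⟨z, u, rfl⟩
    simp [Matrix.mulVec_mulVec, hC]
  rw [show Submodule.span ℂ _ = ⊤ from h] at hspan
  ext i j
  have : Matrix.mulVecLin C (Pi.single j 1) = 0 := hspan (Submodule.mem_top)
  simpa using congrFun this i

/-- ½(iF − P) is a potential of P, and `IsHarmonic.exists_flagPair` supplies the constant c that
makes it a projector. The matrix A carries c back to the surface. -/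
theorem exists_normalization (hr : (N : ℕ∞) + 2 ≤ r) (hF : IsCrOnSphere r F)
    (hsu : ∀ z, F z ∈ su N) (hP : IsFiniteActionSolution r P)
    (hW : HasWeierstrassDifferential F P) :
    ∃ A ∈ su N, ∃ k < N, ∃ lam : ℝ, SurfaceConditions k lam (fun z => F z - A) ∧
      P = surfaceProjector lam (fun z => F z - A) := by
  have h2 := two_le_of_natCast_le hr
  have hN2 : (((N + 2 : ℕ) : ℕ∞) : WithTop ℕ∞) ≤ r := by
    refine WithTop.coe_le_coe.mpr ?_
    push_cast; exact hr
  set S₁ : OnePoint ℂ → Matrix (Fin N) (Fin N) ℂ :=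
    fun z => (1 / 2 : ℂ) • (Complex.I • F z + 0 - P z) with hS₁
  have cP := hP.projector.cr
  have cS₁ : IsCrOnSphere r S₁ :=
    (((hF.const_smul _).add (isCrOnSphere_const _)).sub cP).const_smul _
  obtain ⟨c, k, hc, hk, hflag, htr⟩ := (hP.isHarmonic h2).exists_flagPair
    isFaithfulTrace_traceCLM (N := N) (by simp) (R := hat P) (S := onPlane S₁)
    (fun z hz => onPlane_of_ne_zero P hz) (cP.contDiff_onPlane.of_le hN2) (cP.contDiff_hat.of_le hN2)
    (cS₁.contDiff_onPlane.of_le h2) (fun z => by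
      change ((1 / 2 : ℂ) • (Complex.I • F z + 0 - P z))ᴴ = _
      rw [Matrix.conjTranspose_smul, Matrix.conjTranspose_sub, Matrix.conjTranspose_add,
        Matrix.conjTranspose_smul, (hsu z).1, hP.projector.herm]
      change _ = (1 / 2 : ℂ) • (Complex.I • F z + 0 - P z)
      simp)
    (fun z => hW.dzb_potential h2 hF cP hP.projector.idem 0 z)
  have hN0 : (N : ℂ) ≠ 0 := Nat.cast_ne_zero.mpr (by omega)
  have hS : SphereFlag r P (fun z => S₁ z + c) :=
    SphereFlag.of_plane h2 cP (cS₁.add (isCrOnSphere_const c)) hflag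
  have htrS : ∀ z, (S₁ z + c).trace = k := hS.trace_eq htr
  -- The value for which A is traceless. A itself is the solution of F − A = −i(P + 2(S₁ + c) − λ).
  set lam : ℝ := (1 + 2 * k) / N with hlam
  have hlamN : (lam : ℂ) * N = 1 + 2 * k := by
    rw [hlam]; push_cast; field_simp
  set A : Matrix (Fin N) (Fin N) ℂ :=
    Complex.I • ((2 : ℂ) • c - (lam : ℂ) • (1 : Matrix (Fin N) (Fin N) ℂ)) with hA
  have hFA : ∀ z, F z - A = surfacePoint lam (P z) (S₁ z + c) := fun z => by
    have e : F z = (-(Complex.I * Complex.I)) • F z := by simp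
    rw [surfacePoint, hA]
    conv_lhs => rw [e]
    simp only [hS₁]
    module
  have hAtr : A.trace = 0 := by
    have e1 := congrArg Matrix.trace (hFA OnePoint.infty)
    rw [trace_surfacePoint (hP.projector.trace_one _) (htrS _), hlamN, sub_self, mul_zero,
      Matrix.trace_sub, (hsu _).2, zero_sub, neg_eq_zero] at e1
    exact e1
  have hch : cᴴ = c := hc
  refine ⟨A, ⟨?_, hAtr⟩, k, hk, lam, hS.surfaceConditions hk htrS hFA
    ((hasWeierstrassDifferential_sub_const A).mpr hW)⟩
  rw [hA, Matrix.conjTranspose_smul, Matrix.conjTranspose_sub, Matrix.conjTranspose_smul,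
    Matrix.conjTranspose_smul, hch, Matrix.conjTranspose_one]
  simp

theorem HasNormalForm.surfaceConditions (h2 : (2 : WithTop ℕ∞) ≤ r)
    (hW : HasWeierstrassDifferential F P) {k : ℕ} (hk : k < N) (h : HasNormalForm r k F P) :
    ∃ lam : ℝ, SurfaceConditions k lam F ∧ P = surfaceProjector lam F := by
  obtain ⟨Q, q0, q1, q2, rfl, q4⟩ := h
  refine ⟨(1 + 2 * k) / N, (SphereFlag.of_tower h2 q0 q1 q2).surfaceConditions hk (fun z => ?_)
    (fun z => ?_) hW⟩
  · rw [Matrix.trace_sum, Finset.sum_congr rfl fun j hj =>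
      (q1 j (Finset.mem_range.mp hj).le).trace_one z]
    simp
  · rw [q4, surfacePoint]; push_cast; rfl

theorem SurfaceConditions.hasNormalForm (h2 : (2 : WithTop ℕ∞) ≤ r) (hF : IsCrOnSphere r F)
    (hsu : ∀ z, F z ∈ su N) {k : ℕ} (hk : k < N) {lam : ℝ} (h : SurfaceConditions k lam F)
    (hfull : IsFull (surfaceProjector lam F)) : HasNormalForm r k F (surfaceProjector lam F) := by
  obtain ⟨-, S, hS, htr, hFS⟩ := h.exists_sphereFlag h2 hF (fun z => (hsu z).1) hk
  -- If SC = C, then PC = PSC = 0, so C*P = 0 everywhere and fullness gives C = 0.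
  obtain ⟨Q, q0, q1, q2, q3, q4⟩ := hS.exists_tower h2 k (fun z => htr z) (fun C hC => by
    rw [← Matrix.conjTranspose_eq_zero]
    refine hfull.eq_zero_of_mul_eq_zero fun z => ?_
    have e1 : onPlane (surfaceProjector lam F) z * C = 0 := by
      rw [← hC z, ← mul_assoc, (hS.plane.flag z).2, zero_mul]
    have e2 := congrArg star e1
    rwa [star_mul, (hS.plane.rank z).herm, star_zero] at e2)
  have hN0 : (N : ℂ) ≠ 0 := Nat.cast_ne_zero.mpr (by omega)
  have hlam : (lam : ℂ) = (1 + 2 * k) / N := by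
    have e1 := (hsu OnePoint.infty).2
    rw [hFS, trace_surfacePoint (hS.rank _).trace_one (htr _)] at e1
    have e2 := (mul_eq_zero.mp e1).resolve_left (neg_ne_zero.mpr Complex.I_ne_zero)
    rw [eq_div_iff hN0]
    exact (sub_eq_zero.mp e2).symm
  refine ⟨Q, q0, q1, q2, q3, fun z => ?_⟩
  rw [q3, ← q4 z, ← hlam]
  exact hFS z

end Surface

end CPModel

end

/-! ### The two equivalences. -/

theorem theorem11 (N : ℕ) (r : ℕ∞) (hr : (N : ℕ∞) + 2 ≤ r)
    (F : OnePoint ℂ → Matrix (Fin N) (Fin N) ℂ)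
    (hF : CPModel.IsCrOnSphere r F) (hsu : ∀ z, F z ∈ CPModel.su N) :
    -- exact form, for full solutions and the canonical constant of integration
    (∀ P : OnePoint ℂ → Matrix (Fin N) (Fin N) ℂ, CPModel.IsFull P →
      ((CPModel.IsFiniteActionSolution r P ∧ CPModel.HasWeierstrassDifferential F P ∧
          ∃ k < N, CPModel.HasNormalForm r k F P) ↔
        ∃ k < N, ∃ lam : ℝ,
          CPModel.SurfaceConditions k lam F ∧ P = CPModel.surfaceProjector lam F)) ∧
    -- all solutions, with an arbitrary constant of integration
    (∀ P : OnePoint ℂ → Matrix (Fin N) (Fin N) ℂ,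
      (CPModel.IsFiniteActionSolution r P ∧ CPModel.HasWeierstrassDifferential F P) ↔
        ∃ A ∈ CPModel.su N, ∃ k < N, ∃ lam : ℝ,
          CPModel.SurfaceConditions k lam (fun z => F z - A) ∧
          P = CPModel.surfaceProjector lam (fun z => F z - A)) := by
  have h2 := CPModel.two_le_of_natCast_le hr
  refine ⟨fun P hfull => ⟨?_, ?_⟩, fun P => ⟨?_, ?_⟩⟩
  · rintro ⟨-, hW, k, hk, hnf⟩
    obtain ⟨lam, h⟩ := hnf.surfaceConditions h2 hW hk
    exact ⟨k, hk, lam, h⟩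
  · rintro ⟨k, hk, lam, h, rfl⟩
    obtain ⟨hW, S, hS, -, -⟩ := h.exists_sphereFlag h2 hF (fun z => (hsu z).1) hk
    exact ⟨hS.isFiniteActionSolution h2, hW, k, hk, h.hasNormalForm h2 hF hsu hk hfull⟩
  · rintro ⟨hP, hW⟩
    exact CPModel.exists_normalization hr hF hsu hP hW
  · rintro ⟨A, hA, k, hk, lam, h, rfl⟩
    obtain ⟨hW, S, hS, -, -⟩ := h.exists_sphereFlag h2 (hF.sub (CPModel.isCrOnSphere_const A))
      (fun z => by rw [Matrix.conjTranspose_sub, (hsu z).1, hA.1]; abel) hk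
    exact ⟨hS.isFiniteActionSolution h2, (CPModel.hasWeierstrassDifferential_sub_const A).mp hW⟩
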